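/- Let $N=2^n$ and index the entries of $x\in\mathbb R^N$ by $\mathbb F_2^n$. Write $\hat x(i)=\frac1{\sqrt N}\sum_{j\in\mathbb F_2^n}(-1)^{\langle i,j\rangle}x(j)$ for the Walsh–Hadamard transform of $x$, and let $H_k(x)$ agree with $x$ on $k$ coordinates of largest absolute value and vanish elsewhere (ties broken arbitrarily). A function $h\colon\mathbb F_2^n\times[D]\to\mathbb F_2^r$, $D\ge 1$, is a $(\kappa,\epsilon)$-lossless condenser if for every nonempty $S\subseteq\mathbb F_2^n$ with $|S|\le 2^\kappa$, when $X$ is uniform on $S$ and $Z$ is uniform on $[D]$ and independent of $X$, the distribution of $(Z,h(X,Z))$ is within statistical distance $\epsilon$ of a distribution on $[D]\times\mathbb F_2^r$ with min-entropy at least $\log_2(D|S|)$. It is explicit if it is computable in time polynomial in $n$, that is, if one fixed program, given the parameters $(n,k,r,D)$ and $(u,t)\in\mathbb F_2^n\times[D]$, outputs $h(u,t)$ in time $n^{O(1)}$. **Theorem.** There are absolute constants $c>0$ and $\epsilon>0$ such that the following holds. Let $n,k$ be positive integers with $k\le N=2^n$, and suppose that $h\colon\mathbb F_2^n\times[D]\to\mathbb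 F_2^r$, with $r\le n$, is an explicit $(\log_2(4k),\epsilon)$-lossless condenser such that $h(\cdot,t)$ is $\mathbb F_2$-linear for every $t\in[D]$. Then there is a deterministic algorithm running in time $2^rD^2n^{O(1)}$ that, given $(n,k,r,D)$ and non-adaptive query access to $\hat x\in\mathbb R^N$ (all query positions are determined before any answer is seen), where each entry of $\hat x$ is a binary fixed-point number of $n^{O(1)}$ bits, outputs $\tilde x\in\mathbb R^N$ such that $$\|\tilde x-x\|_1\le c\,\|x-H_k(x)\|_1 .$$ Here the algorithm and the polynomial hidden in its running time depend only on the program computing $h$, on the polynomial bounding the running time of that program, and on the polynomial bounding the bit length of the entries of $\hat x$; they do not depend on $n,k,r,D,x$. The output is a list of triples $(i,z,e)\in\mathbb F_2^n\times\mathbb Z\times\mathbb N$, each contributing $z\,(\sqrt2)^{-e}$ to $\tilde x(i)$. -/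

import Mathlib

open scoped BigOperators

namespace SparseHadamard

/-! ### Machine model

Programs manipulate binary trees built from cons cells, in the manner of pure LISP or of the
WHILE language.  Every primitive step reads, copies or creates a constant number of pointers, so
the number of steps is the running time on a pointer machine, and it agrees with the running time
on a random access machine up to a factor logarithmic in the running time. -/

/-- Binary trees: the data on which programs work. -/
inductive Data : Type
  | nil : Data
  | cons : Data → Data → Data

/-- Left component (`nil` on `nil`). -/
def Data.head : Data → Data
  | .nil => .nil
  | .cons a _ => a

/-- Right component (`nil` on `nil`). -/
def Data.tail : Data → Data
  | .nil => .nil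
  | .cons _ b => b

/-- Number of nodes of a tree, leaves included. -/
def Data.size : Data → ℕ
  | .nil => 1
  | .cons a b => a.size + b.size + 1

/-- Programs; each transforms one tree into another. In a test, `nil` means false and everything
else means true. -/
inductive Prog : Type
  /-- return `nil` -/
  | nil : Prog
  /-- return the input -/
  | id : Prog
  /-- return the left component of the input -/
  | head : Prog
  /-- return the right component of the input -/
  | tail : Prog
  /-- run both programs on the input and pair their results -/
  | cons : Prog → Prog → Prog
  /-- run the first program, then the second one on its result -/
  | comp : Prog → Prog → Prog
  /-- `cond c p q`: if `c` then `p` else `q` -/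
  | cond : Prog → Prog → Prog → Prog
  /-- `loop c p`: while `c` do `p` -/
  | loop : Prog → Prog → Prog

/-- `Runs p x y t`: the program `p`, started on `x`, halts with result `y` after `t` steps. -/
inductive Runs : Prog → Data → Data → ℕ → Prop
  | nil (x : Data) : Runs .nil x .nil 1
  | id (x : Data) : Runs .id x x 1
  | head (x : Data) : Runs .head x x.head 1
  | tail (x : Data) : Runs .tail x x.tail 1
  | cons {p q : Prog} {x y z : Data} {s t : ℕ} :
      Runs p x y s → Runs q x z t → Runs (.cons p q) x (.cons y z) (s + t + 1)
  | comp {p q : Prog} {x y z : Data} {s t : ℕ} :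
      Runs p x y s → Runs q y z t → Runs (.comp p q) x z (s + t + 1)
  | cond_true {c p q : Prog} {x y u v : Data} {s t : ℕ} :
      Runs c x (.cons u v) s → Runs p x y t → Runs (.cond c p q) x y (s + t + 1)
  | cond_false {c p q : Prog} {x y : Data} {s t : ℕ} :
      Runs c x .nil s → Runs q x y t → Runs (.cond c p q) x y (s + t + 1)
  | loop_done {c p : Prog} {x : Data} {s : ℕ} :
      Runs c x .nil s → Runs (.loop c p) x x (s + 1)
  | loop_step {c p : Prog} {x y z u v : Data} {s t w : ℕ} :
      Runs c x (.cons u v) s → Runs p x y t → Runs (.loop c p) y z w →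
        Runs (.loop c p) x z (s + t + w + 1)

/-! ### Encodings -/

/-- The space `𝔽₂ⁿ`. -/
abbrev F2 (n : ℕ) : Type := Fin n → ZMod 2

def encBool : Bool → Data
  | false => .nil
  | true => .cons .nil .nil

def encList {α : Type} (f : α → Data) : List α → Data
  | [] => .nil
  | a :: l => .cons (f a) (encList f l)

/-- Natural numbers in binary, least significant bit first. -/
def encNat (m : ℕ) : Data := encList encBool m.bits

/-- Integers by sign and absolute value. -/
def encInt (z : ℤ) : Data := .cons (encBool (decide (z < 0))) (encNat z.natAbs)

/-- Vectors over `𝔽₂` as lists of bits. -/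
def encVec {n : ℕ} (v : F2 n) : Data := encList encBool (List.ofFn fun i => decide (v i = 1))

/-- An answer `(z, e)` to a query. -/
def encAnswer (p : ℤ × ℕ) : Data := .cons (encInt p.1) (encNat p.2)

/-- An entry `(i, z, e)` of an output list. -/
def encEntry {n : ℕ} (p : F2 n × ℤ × ℕ) : Data :=
  .cons (encVec p.1) (.cons (encInt p.2.1) (encNat p.2.2))

def encParams (n k r D : ℕ) : Data :=
  .cons (encNat n) (.cons (encNat k) (.cons (encNat r) (encNat D)))

/-! ### Lossless condensers -/

/-- Statistical distance of two distributions on a finite space. -/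
noncomputable def statDist {Ω : Type} [Fintype Ω] (p q : PMF Ω) : ℝ :=
  (1 / 2) * ∑ s, |(p s).toReal - (q s).toReal|

/-- Min-entropy (in bits) of a distribution on a finite space. -/
noncomputable def minEntropy {Ω : Type} [Fintype Ω] (p : PMF Ω) : ℝ :=
  ⨅ s : p.support, -Real.logb 2 (p s).toReal

/-- The distribution of `(Z, h (X, Z))`, with `X` uniform on `S` and `Z` uniform on `[D]`
and independent of `X`. -/
noncomputable def condenserOutput {n r D : ℕ} [NeZero D] (h : F2 n × Fin D → F2 r)
    (S : Finset (F2 n)) (hS : S.Nonempty) : PMF (Fin D × F2 r) :=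
  (PMF.uniformOfFinset S hS).bind fun X =>
    (PMF.uniformOfFintype (Fin D)).bind fun Z => PMF.pure (Z, h (X, Z))

/-- `(κ, ε)`-lossless condensers. -/
def IsLosslessCondenser {n r D : ℕ} [NeZero D] (κ ε : ℝ) (h : F2 n × Fin D → F2 r) : Prop :=
  ∀ (S : Finset (F2 n)) (hS : S.Nonempty), (S.card : ℝ) ≤ (2 : ℝ) ^ κ →
    ∃ Y : PMF (Fin D × F2 r),
      Real.logb 2 ((D : ℝ) * S.card) ≤ minEntropy Y ∧
      statDist (condenserOutput h S hS) Y ≤ ε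

/-- `h` is linear over `𝔽₂` in its first argument. -/
def LinearInFirst {n r D : ℕ} (h : F2 n × Fin D → F2 r) : Prop :=
  ∀ t : Fin D, IsLinearMap (ZMod 2) fun u : F2 n => h (u, t)

/-- The program `P`, given the parameters `(n, k, r, D)` and `(u, t)`, outputs `h (u, t)` within
`T` steps. -/
def ComputesWithin (P : Prog) {n r D : ℕ} (k : ℕ) (h : F2 n × Fin D → F2 r) (T : ℕ) : Prop :=
  ∀ (u : F2 n) (t : Fin D), ∃ s ≤ T,
    Runs P (.cons (encParams n k r D) (.cons (encVec u) (encNat t))) (encVec (h (u, t))) s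

/-! ### Signals -/

/-- The Walsh-Hadamard transform on `ℝ^N`, `N = 2 ^ n`. -/
noncomputable def dht {n : ℕ} (x : F2 n → ℝ) : F2 n → ℝ := fun i =>
  (1 / Real.sqrt (2 ^ n)) * ∑ j : F2 n, (-1 : ℝ) ^ (ZMod.val (i ⬝ᵥ j)) * x j

/-- The `ℓ₁` norm. -/
noncomputable def l1norm {n : ℕ} (x : F2 n → ℝ) : ℝ := ∑ i, |x i|

/-- `y` is `H_k(x)`: it agrees with `x` on the positions of `k` largest entries of `x` in absolute
value and vanishes elsewhere. Ties may be broken in any way. -/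
def IsHk {n : ℕ} (k : ℕ) (x y : F2 n → ℝ) : Prop :=
  ∃ S : Finset (F2 n), S.card = k ∧ (∀ i ∈ S, ∀ j ∉ S, |x j| ≤ |x i|) ∧
    y = fun i => if i ∈ S then x i else 0

theorem exists_isHk {n k : ℕ} (hk : k ≤ 2 ^ n) (x : F2 n → ℝ) : ∃ y, IsHk k x y := by
  suffices H : ∃ S : Finset (F2 n), S.card = k ∧ ∀ i ∈ S, ∀ j ∉ S, |x j| ≤ |x i| by
    obtain ⟨S, h1, h2⟩ := H
    exact ⟨_, S, h1, h2, rfl⟩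
  induction k with
  | zero => exact ⟨∅, by simp⟩
  | succ k ih =>
    obtain ⟨S, hc, hS⟩ := ih (by omega)
    have hne : (Sᶜ : Finset (F2 n)).Nonempty := by
      rw [← Finset.card_pos, Finset.card_compl, hc]
      simp
      omega
    obtain ⟨m, hm, hmax⟩ := Finset.exists_max_image Sᶜ (fun i => |x i|) hne
    have hm' : m ∉ S := by simpa using hm
    refine ⟨insert m S, by rw [Finset.card_insert_of_notMem hm', hc], ?_⟩
    intro i hi j hj
    rw [Finset.mem_insert, not_or] at hj
    rcases Finset.mem_insert.1 hi with rfl | hi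
    · exact hmax j (by simpa using hj.2)
    · exact hS i hi j hj.2

/-- The entries of `v` are binary fixed-point numbers `z / 2 ^ e`, with `|z| < 2 ^ b` and `e ≤ b`;
`ans` lists the pairs `(z, e)`. -/
def HasBits {n : ℕ} (b : ℕ) (v : F2 n → ℝ) (ans : F2 n → ℤ × ℕ) : Prop :=
  ∀ i, v i = ((ans i).1 : ℝ) / 2 ^ (ans i).2 ∧ |(ans i).1| < 2 ^ b ∧ (ans i).2 ≤ b

/-! ### Algorithms with non-adaptive queries -/

/-- The vector described by a list of entries: `(i, z, e)` contributes `z / (√2) ^ e` at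
position `i`. The root is needed because of the factor `1 / √(2 ^ n)` in the transform. -/
noncomputable def outputVector {n : ℕ} (L : List (F2 n × ℤ × ℕ)) : F2 n → ℝ := fun i =>
  (L.map fun p => if p.1 = i then (p.2.1 : ℝ) / (Real.sqrt 2) ^ p.2.2 else 0).sum

/-- A non-adaptive query algorithm `(Q, R)`: from the input alone, `Q` writes down the list of all
query positions; then `R` receives the input together with the list of the answers and writes
down the output. The total number of steps, including the writing of the queries and of the output
in full, is at most `T`. -/
def OutputsWithin (Q R : Prog) {n : ℕ} (input : Data) (ans : F2 n → ℤ × ℕ)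
    (L : List (F2 n × ℤ × ℕ)) (T : ℕ) : Prop :=
  ∃ (qs : List (F2 n)) (t₁ t₂ : ℕ),
    Runs Q input (encList encVec qs) t₁ ∧
    Runs R (.cons input (encList encAnswer (qs.map ans))) (encList encEntry L) t₂ ∧
    t₁ + (encList encVec qs).size + t₂ + (encList encEntry L).size ≤ T

end SparseHadamard

open SparseHadamard

/-!
The recovery algorithm is iterative. Write `h t` for the condenser with seed `t`, a linear map from
`𝔽₂ⁿ` to `𝔽₂ʳ`.

*Condensers are expanders.* A distribution of min-entropy `log (D |S|)` gives little mass to any set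
with much fewer than `D |S|` points, so a lossless condenser has the property that, for every set
`S` of at most `4k` positions, the pairs `(t, h t i)` with `i ∈ S` are almost all distinct
(`IsLosslessCondenser.le_sum_card_image`).

*Measurements.* For a seed `t`, a bucket `z` and a bit position `b`, the algorithm needs the sums of
the entries `x i` over the bucket `h t i = z`, once as they are and once with the signs
`(-1) ^ i b`. As `h t` is linear, the Poisson summation formula expresses these sums, for all `z` at
once, as the Walsh-Hadamard transform over `𝔽₂ʳ` of `w ↦ x̂ (wᵀ h t + e)`, where `e` is zero or the unit
vector of `b` (`measures_measOf`). So there are `D 2 ^ r (n + 1)` queries, and they do not depend on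
the answers. Because the answers are fixed-point numbers, the signal is an integer vector after
multiplication by a power of `√2` (`signalOf_eq`), and the arithmetic is exact.

*Recovery.* Let `y` be the current sparse approximation. For every seed `t`, the signs of the
measurements of `x - y` spell out a candidate position in each bucket: it is the right one if an
entry dominates its bucket. Adding the bucket sums at these positions to `y` and keeping the `k`
largest entries gives one new approximation for each seed. The averaging argument in
`IsExpander.round_le` shows that the expansion property makes one of them halve the `ℓ₁` error, up
to a multiple of the tail `‖x - H_k x‖₁`. To select a good one, the algorithm compares the sums over
all seeds and buckets of the absolute values of the bucket sums of `x - y`; up to constants this is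
`D ‖x - y‖₁`, again by expansion and up to the tail. After a number of rounds linear in `n` and the
number of bits, the error is less than `1` plus a multiple of the tail, and integrality removes the
`1` (`recover_norm1_le`).

*Running time.* In each round, all `D` candidates are compared with the measurements for all `D`
seeds, which gives the factor `D ^ 2`; sparse vectors are collected, sorted and truncated by radix
sort on bit strings in time `2 ^ r n ^ O(1)`. Expansion also gives `k ≤ 2 * 2 ^ r`, so that the
approximations are short enough. If `D ≥ 2 ^ n`, the numbers below `D` need too many bits; then the
identity map takes the place of the condenser, and time `2 ^ n n ^ O(1)` suffices
(`exists_matrices`). The programs are built from left folds; `Does p x y T` says that the program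
`p` turns `x` into `y` within `T` steps, and the `..._spec` lemmas bound the costs of all parts.
In their proofs the cost function is a metavariable: the analysis of the program determines it, and
the resulting expression is then seen to be bounded as claimed.
-/

namespace SparseHadamard

/-! ### Running times of programs -/

/-- `p` turns `x` into `y` in at most `T` steps. -/
def Does (p : Prog) (x y : Data) (T : ℕ) : Prop := ∃ t ≤ T, Runs p x y t

theorem Does.mono {p : Prog} {x y : Data} {S T : ℕ} (h : Does p x y S) (hST : S ≤ T) :
    Does p x y T := by
  obtain ⟨t, ht, hr⟩ := h
  exact ⟨t, ht.trans hST, hr⟩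

theorem Does.cons {p q : Prog} {x y z : Data} {S T : ℕ} (h : Does p x y S) (h' : Does q x z T) :
    Does (.cons p q) x (.cons y z) (S + T + 1) := by
  obtain ⟨s, hs, hr⟩ := h
  obtain ⟨t, ht, hr'⟩ := h'
  exact ⟨s + t + 1, by omega, .cons hr hr'⟩

theorem Does.comp {p q : Prog} {x y z : Data} {S T : ℕ} (h : Does p x y S) (h' : Does q y z T) :
    Does (.comp p q) x z (S + T + 1) := by
  obtain ⟨s, hs, hr⟩ := h
  obtain ⟨t, ht, hr'⟩ := h'
  exact ⟨s + t + 1, by omega, .comp hr hr'⟩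

theorem Does.cond_true {c p q : Prog} {x y u v : Data} {S T : ℕ}
    (h : Does c x (.cons u v) S) (h' : Does p x y T) : Does (.cond c p q) x y (S + T + 1) := by
  obtain ⟨s, hs, hr⟩ := h
  obtain ⟨t, ht, hr'⟩ := h'
  exact ⟨s + t + 1, by omega, .cond_true hr hr'⟩

theorem Does.cond_false {c p q : Prog} {x y : Data} {S T : ℕ}
    (h : Does c x .nil S) (h' : Does q x y T) : Does (.cond c p q) x y (S + T + 1) := by
  obtain ⟨s, hs, hr⟩ := h
  obtain ⟨t, ht, hr'⟩ := h'
  exact ⟨s + t + 1, by omega, .cond_false hr hr'⟩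

/-- A conditional on an encoded Boolean. -/
theorem Does.ite {c p q : Prog} {x y : Data} {b : Bool} {S T : ℕ}
    (h : Does c x (encBool b) S) (h₁ : b = true → Does p x y T) (h₂ : b = false → Does q x y T) :
    Does (.cond c p q) x y (S + T + 1) := by
  cases b
  · exact Does.cond_false h (h₂ rfl)
  · exact Does.cond_true h (h₁ rfl)

/-- Programs without loops. -/
def Prog.loopFree : Prog → Bool
  | .nil => true
  | .id => true
  | .head => true
  | .tail => true
  | .cons p q => p.loopFree && q.loopFree
  | .comp p q => p.loopFree && q.loopFree
  | .cond c p q => c.loopFree && p.loopFree && q.loopFree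
  | .loop _ _ => false

/-- The function computed by a loop-free program (loops count as the identity). -/
def Prog.ev : Prog → Data → Data
  | .nil, _ => .nil
  | .id, x => x
  | .head, x => x.head
  | .tail, x => x.tail
  | .cons p q, x => .cons (p.ev x) (q.ev x)
  | .comp p q, x => q.ev (p.ev x)
  | .cond c p q, x => match c.ev x with
    | .nil => q.ev x
    | .cons _ _ => p.ev x
  | .loop _ _, x => x

/-- The length of a program; for a loop-free program this bounds the running time. -/
def Prog.sz : Prog → ℕ
  | .nil => 1
  | .id => 1
  | .head => 1
  | .tail => 1
  | .cons p q => p.sz + q.sz + 1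
  | .comp p q => p.sz + q.sz + 1
  | .cond c p q => c.sz + (p.sz + q.sz) + 1
  | .loop _ _ => 1

theorem Does.ev {p : Prog} (h : p.loopFree = true) (x : Data) : Does p x (p.ev x) p.sz := by
  induction p generalizing x with
  | nil => exact ⟨1, le_rfl, .nil x⟩
  | id => exact ⟨1, le_rfl, .id x⟩
  | head => exact ⟨1, le_rfl, .head x⟩
  | tail => exact ⟨1, le_rfl, .tail x⟩
  | cons p q hp hq =>
    simp only [Prog.loopFree, Bool.and_eq_true] at h
    exact (hp h.1 x).cons (hq h.2 x)
  | comp p q hp hq =>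
    simp only [Prog.loopFree, Bool.and_eq_true] at h
    exact (hp h.1 x).comp (hq h.2 _)
  | cond c p q hc hp hq =>
    simp only [Prog.loopFree, Bool.and_eq_true] at h
    have h1 := hc h.1.1 x
    simp only [Prog.ev, Prog.sz]
    rcases hcx : c.ev x with _ | ⟨u, v⟩
    · rw [hcx] at h1
      exact (Does.cond_false h1 (hq h.2 x)).mono (by omega)
    · rw [hcx] at h1
      exact (Does.cond_true h1 (hp h.1.2 x)).mono (by omega)
  | loop => simp [Prog.loopFree] at h

/-- Variant of `Does.ev` with the result given up to definitional unfolding. -/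
theorem Does.free {p : Prog} {x y : Data} (h : p.loopFree = true) (hy : p.ev x = y) :
    Does p x y p.sz := hy ▸ Does.ev h x

-- `p ▷ q` runs `p`, then `q` on its result.
infixl:75 " ▷ " => Prog.comp

/-- Run `g` on the result of `a`, put the result beside the input, and go on with `rest`. -/
def letP (a g rest : Prog) : Prog := .comp (.cons .id (a ▷ g)) rest

theorem Does.letP {a g rest : Prog} {x y z : Data} {S T : ℕ} (ha : a.loopFree = true)
    (hg : Does g (a.ev x) y S) (hr : Does rest (.cons x y) z T) :
    Does (letP a g rest) x z (a.sz + S + T + 4) :=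
  (Does.comp (Does.cons (Does.free (p := .id) rfl rfl) ((Does.ev ha x).comp hg)) hr).mono
    (by simp only [Prog.sz]; omega)

/-- Run `g` on the result of `a`. -/
theorem Does.call {a g : Prog} {x y : Data} {S : ℕ} (ha : a.loopFree = true)
    (hg : Does g (a.ev x) y S) : Does (a ▷ g) x y (a.sz + S + 1) :=
  (Does.ev ha x).comp hg

/-! ### Iteration over lists -/

/-- The loop body of `foldP`. -/
def foldBody (p : Prog) : Prog :=
  .cons .head (.cons (.cons .head (.cons (.tail ▷ .tail ▷ .head) (.tail ▷ .head)) ▷ p)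
    (.tail ▷ .tail ▷ .tail))

/-- Left fold: the input is `(env, acc, l)`, and `p` turns `(env, a, acc)` into the new
accumulator. -/
def foldP (p : Prog) : Prog := .loop (.tail ▷ .tail) (foldBody p) ▷ (.tail ▷ .head)

theorem Does.fold_prefix {α β : Type} {encA : α → Data} {encB : β → Data} {f : β → α → β}
    {env : Data} {p : Prog} {T N : ℕ} {l : List α} {b : β} (hl : l.length ≤ N)
    (h : ∀ pre a, (pre ++ [a]) <+: l →
      Does p (.cons env (.cons (encA a) (encB (pre.foldl f b))))
        (encB (f (pre.foldl f b) a)) T) :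
    Does (foldP p) (.cons env (.cons (encB b) (encList encA l))) (encB (l.foldl f b))
      (N * (T + 30) + 10) := by
  have key : ∀ (l : List α) (b : β), (∀ pre a, (pre ++ [a]) <+: l →
      Does p (.cons env (.cons (encA a) (encB (pre.foldl f b))))
        (encB (f (pre.foldl f b) a)) T) →
      Does (.loop (.tail ▷ .tail) (foldBody p)) (.cons env (.cons (encB b) (encList encA l)))
        (.cons env (.cons (encB (l.foldl f b)) .nil)) (l.length * (T + 30) + 4) := by
    intro l
    induction l with
    | nil =>
      intro b _
      obtain ⟨t, ht, hr⟩ := Does.free (p := .tail ▷ .tail)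
        (x := .cons env (.cons (encB b) .nil)) (y := .nil) rfl rfl
      refine ⟨t + 1, ?_, .loop_done hr⟩
      simp only [Prog.sz] at ht
      omega
    | cons a l ih =>
      intro b h
      have h0 := h [] a (by simp)
      have hrest : ∀ pre a', (pre ++ [a']) <+: l →
          Does p (.cons env (.cons (encA a') (encB (pre.foldl f (f b a)))))
            (encB (f (pre.foldl f (f b a)) a')) T := by
        intro pre a' hpre
        have := h (a :: pre) a' (by simpa using hpre)
        simpa using this
      obtain ⟨w, hw, hloop⟩ := ih (f b a) hrest
      obtain ⟨s, hs, hc⟩ := Does.free (p := .tail ▷ .tail)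
        (x := .cons env (.cons (encB b) (encList encA (a :: l))))
        (y := .cons (encA a) (encList encA l)) rfl rfl
      have hbody : Does (foldBody p) (.cons env (.cons (encB b) (encList encA (a :: l))))
          (.cons env (.cons (encB (f b a)) (encList encA l))) (T + 24) := by
        refine Does.mono (Does.cons (Does.free rfl rfl) (Does.cons
          (Does.call rfl h0) (Does.free rfl rfl))) ?_
        simp only [Prog.sz]
        omega
      obtain ⟨t, ht, hb⟩ := hbody
      refine ⟨s + t + w + 1, ?_, .loop_step hc hb hloop⟩
      simp only [Prog.sz] at hs
      simp only [List.length_cons]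
      have : (l.length + 1) * (T + 30) = l.length * (T + 30) + (T + 30) := by ring
      omega
  refine Does.mono (Does.comp (key l b h) (Does.free (p := .tail ▷ .head) rfl rfl)) ?_
  have := Nat.mul_le_mul_right (T + 30) hl
  simp only [Prog.sz]
  omega

/-- Left fold whose accumulator satisfies an invariant. -/
theorem Does.fold {α β : Type} {encA : α → Data} {encB : β → Data} {f : β → α → β}
    {env : Data} {p : Prog} {T N : ℕ} {l : List α} {b : β} (I : β → Prop) (hl : l.length ≤ N)
    (hb : I b) (hI : ∀ b, ∀ a ∈ l, I b → I (f b a))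
    (h : ∀ b, ∀ a ∈ l, I b → Does p (.cons env (.cons (encA a) (encB b))) (encB (f b a)) T) :
    Does (foldP p) (.cons env (.cons (encB b) (encList encA l))) (encB (l.foldl f b))
      (N * (T + 30) + 10) := by
  refine Does.fold_prefix hl fun pre a hpre => ?_
  have hsub : ∀ a' ∈ pre ++ [a], a' ∈ l := fun a' ha' => hpre.subset ha'
  refine h _ a (hsub a (by simp)) ?_
  have hsub' : ∀ a' ∈ pre, a' ∈ l := fun a' ha' => hsub a' (by simp [ha'])
  clear hpre hsub
  induction pre using List.reverseRecOn with
  | nil => exact hb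
  | append_singleton pre a' ih =>
    rw [List.foldl_append]
    exact hI _ _ (hsub' a' (by simp)) (ih fun x hx => hsub' x (by simp [hx]))

/-- List reversal onto an accumulator: the input is `(acc, l)`. -/
def revAppendP : Prog :=
  .cons .nil .id ▷ foldP (.cons (.tail ▷ .head) (.tail ▷ .tail))

theorem Does.revAppend {α : Type} {encA : α → Data} {l acc : List α} {N : ℕ}
    (hl : l.length ≤ N) :
    Does revAppendP (.cons (encList encA acc) (encList encA l))
      (encList encA (l.reverse ++ acc)) (N * 40 + 20) := by
  have h := Does.fold (encA := encA) (encB := encList encA) (f := fun b a => a :: b)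
    (env := .nil) (p := .cons (.tail ▷ .head) (.tail ▷ .tail)) (T := 7) (b := acc)
    (fun _ => True) hl trivial (fun _ _ _ _ => trivial)
    (fun b a _ _ => Does.free rfl rfl)
  have e : l.foldl (fun b a => a :: b) acc = l.reverse ++ acc := by
    simp
  rw [e] at h
  refine Does.mono (Does.call (a := .cons .nil .id) rfl h) ?_
  simp only [Prog.sz]
  omega

/-- List reversal. -/
def revP : Prog := .cons .nil .id ▷ revAppendP

theorem Does.rev {α : Type} {encA : α → Data} {l : List α} {N : ℕ} (hl : l.length ≤ N) :
    Does revP (encList encA l) (encList encA l.reverse) (N * 40 + 30) := by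
  have h := Does.revAppend (encA := encA) (acc := []) hl
  rw [List.append_nil] at h
  refine Does.mono (Does.call (a := .cons .nil .id) rfl h) ?_
  simp only [Prog.sz]
  omega

/-- Concatenation of the two lists of a pair. -/
def appendP : Prog := .cons .tail (.head ▷ revP) ▷ revAppendP

theorem Does.append {α : Type} {encA : α → Data} {l l' : List α} {N : ℕ} (hl : l.length ≤ N) :
    Does appendP (.cons (encList encA l) (encList encA l')) (encList encA (l ++ l'))
      (N * 80 + 60) := by
  have h := Does.revAppend (encA := encA) (acc := l') (l := l.reverse) (N := N) (by simpa)
  rw [List.reverse_reverse] at h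
  refine Does.mono (Does.comp (Does.cons (Does.free (p := .tail) rfl rfl)
    (Does.call (a := .head) rfl (Does.rev hl))) h) ?_
  simp only [Prog.sz]
  omega

/-- Map along a list while threading a state; returns the outputs and the final state. -/
def mapAcc {α β σ : Type} (f : σ → α → β × σ) : σ → List α → List β × σ
  | s, [] => ([], s)
  | s, a :: l => ((f s a).1 :: (mapAcc f (f s a).2 l).1, (mapAcc f (f s a).2 l).2)

theorem length_mapAcc {α β σ : Type} (f : σ → α → β × σ) (s : σ) (l : List α) :
    (mapAcc f s l).1.length = l.length := by
  induction l generalizing s with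
  | nil => rfl
  | cons a l ih => simp [mapAcc, ih]

theorem foldl_eq_mapAcc {α β σ : Type} (f : σ → α → β × σ) (s : σ) (l : List α)
    (acc : List β) :
    l.foldl (fun (b : List β × σ) a => ((f b.2 a).1 :: b.1, (f b.2 a).2)) (acc, s) =
      ((mapAcc f s l).1.reverse ++ acc, (mapAcc f s l).2) := by
  induction l generalizing s acc with
  | nil => rfl
  | cons a l ih => simp [mapAcc, ih]

/-- Encoding of pairs. -/
def encPair {α β : Type} (encA : α → Data) (encB : β → Data) (p : α × β) : Data :=
  .cons (encA p.1) (encB p.2)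

/-- Program for `mapAcc`: the input is `(env, s, l)`, and `p` turns `(env, a, s)` into the pair of
an output and the new state. -/
def mapAccP (p : Prog) : Prog :=
  .cons .head (.cons (.cons .nil (.tail ▷ .head)) (.tail ▷ .tail)) ▷
    foldP (.cons (.tail ▷ .tail ▷ .head)
      (.cons .head (.cons (.tail ▷ .head) (.tail ▷ .tail ▷ .tail)) ▷ p) ▷
      .cons (.cons (.tail ▷ .head) .head) (.tail ▷ .tail)) ▷
    .cons (.head ▷ revP) .tail

theorem Does.mapAcc {α β σ : Type} {encA : α → Data} {encB : β → Data} {encS : σ → Data}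
    {f : σ → α → β × σ} {env : Data} {p : Prog} {T N : ℕ} {l : List α} {s : σ} (I : σ → Prop)
    (hl : l.length ≤ N) (hs : I s) (hI : ∀ s, ∀ a ∈ l, I s → I (f s a).2)
    (h : ∀ s, ∀ a ∈ l, I s →
      Does p (.cons env (.cons (encA a) (encS s))) (encPair encB encS (f s a)) T) :
    Does (mapAccP p) (.cons env (.cons (encS s) (encList encA l)))
      (encPair (encList encB) encS (mapAcc f s l)) (N * (T + 110) + 80) := by
  have h1 := Does.fold (encA := encA)
    (encB := encPair (encList encB) encS) (env := env)
    (p := .cons (.tail ▷ .tail ▷ .head)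
      (.cons .head (.cons (.tail ▷ .head) (.tail ▷ .tail ▷ .tail)) ▷ p) ▷
      .cons (.cons (.tail ▷ .head) .head) (.tail ▷ .tail))
    (f := fun (b : List β × σ) a => ((f b.2 a).1 :: b.1, (f b.2 a).2))
    (b := ([], s)) (T := T + 35) (fun b => I b.2) hl hs (fun b a ha hb => hI b.2 a ha hb)
    (fun b a ha hb => by
      refine Does.mono (Does.comp (Does.cons (Does.free rfl rfl)
        (Does.call rfl (h b.2 a ha hb))) (Does.free rfl rfl)) ?_
      simp only [Prog.sz]
      omega)
  rw [foldl_eq_mapAcc, List.append_nil] at h1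
  have h2 := Does.rev (encA := encB) (l := (SparseHadamard.mapAcc f s l).1.reverse) (N := N)
    (by simpa [length_mapAcc] using hl)
  rw [List.reverse_reverse] at h2
  refine Does.mono (Does.comp (Does.call rfl h1) (Does.cons
    (Does.call (a := .head) rfl h2) (Does.free (p := .tail) rfl rfl))) ?_
  simp only [Prog.sz]
  have : N * (T + 110) = N * (T + 35 + 30) + N * 40 + N * 5 := by ring
  omega

/-- Map over a list: the input is `(env, l)`, and `p` acts on `(env, a)`. -/
def mapP (p : Prog) : Prog :=
  .cons .head (.cons .nil .tail) ▷
    mapAccP (.cons (.cons .head (.tail ▷ .head) ▷ p) .nil) ▷ .head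

theorem mapAcc_eq_map {α β : Type} (f : α → β) (l : List α) :
    mapAcc (fun (_ : Unit) a => (f a, ())) () l = (l.map f, ()) := by
  induction l with
  | nil => rfl
  | cons a l ih => simp [mapAcc, ih]

theorem Does.map {α β : Type} {encA : α → Data} {encB : β → Data} {f : α → β} {env : Data}
    {p : Prog} {T N : ℕ} {l : List α} (hl : l.length ≤ N)
    (h : ∀ a ∈ l, Does p (.cons env (encA a)) (encB (f a)) T) :
    Does (mapP p) (.cons env (encList encA l)) (encList encB (l.map f))
      (N * (T + 130) + 100) := by
  have h1 := Does.mapAcc (encA := encA) (encB := encB) (encS := fun _ : Unit => .nil)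
    (f := fun _ a => (f a, ())) (env := env) (s := ())
    (p := .cons (.cons .head (.tail ▷ .head) ▷ p) .nil) (T := T + 10) (fun _ => True) hl trivial
    (fun _ _ _ _ => trivial) (fun _ a ha _ => by
      refine Does.mono (Does.cons (Does.call rfl (h a ha)) (Does.free (p := .nil) rfl rfl)) ?_
      simp only [Prog.sz]
      omega)
  rw [mapAcc_eq_map] at h1
  refine Does.mono (Does.comp (Does.call rfl h1) (Does.free (p := .head) rfl rfl)) ?_
  simp only [Prog.sz]
  have : N * (T + 130) = N * (T + 10 + 110) + N * 10 := by ring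
  omega

/-- Zip of the two lists of a pair. -/
def zipP : Prog :=
  .cons .nil (.cons .tail .head) ▷
    mapAccP (.cons (.cons (.tail ▷ .head) (.tail ▷ .tail ▷ .head)) (.tail ▷ .tail ▷ .tail)) ▷ .head

theorem Does.zip {α β : Type} {encA : α → Data} {encB : β → Data} {l : List α} {l' : List β}
    {N : ℕ} (hl : l.length ≤ N) (hl' : l.length ≤ l'.length) :
    Does zipP (.cons (encList encA l) (encList encB l'))
      (encList (encPair encA encB) (l.zip l')) (N * 150 + 100) := by
  -- The state is the not yet used part of the second list; `Option` hides the missing default.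
  have h1 := Does.mapAcc (encA := encA)
    (encB := fun q : α × Option β => .cons (encA q.1) (match q.2 with
      | none => .nil
      | some b => encB b)) (encS := encList encB) (env := .nil)
    (f := fun s a => ((a, s.head?), s.tail)) (s := l') (T := 20)
    (p := .cons (.cons (.tail ▷ .head) (.tail ▷ .tail ▷ .head)) (.tail ▷ .tail ▷ .tail))
    (fun _ => True) hl trivial (fun _ _ _ _ => trivial)
    (fun s a _ _ => by
      refine Does.mono (Does.free rfl ?_) (by simp only [Prog.sz]; omega : _ ≤ 20)
      cases s <;> rfl)
  have e : ∀ (l : List α) (l' : List β), l.length ≤ l'.length →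
      encList (fun q : α × Option β => .cons (encA q.1) (match q.2 with
        | none => .nil
        | some b => encB b))
        (SparseHadamard.mapAcc (fun s a => ((a, s.head?), s.tail)) l' l).1 =
      encList (encPair encA encB) (l.zip l') := by
    intro l
    induction l with
    | nil => intro l' _; rfl
    | cons a l ih =>
      intro l' hl
      cases l' with
      | nil => simp at hl
      | cons b l' =>
        simp only [List.length_cons, add_le_add_iff_right] at hl
        simp only [SparseHadamard.mapAcc, List.head?_cons, List.tail_cons, List.zip_cons_cons,
          encList, encPair]
        rw [ih l' hl]
  have h2 := Does.comp (Does.call (a := .cons .nil (.cons .tail .head))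
    (x := .cons (encList encA l) (encList encB l')) rfl h1) (Does.free (p := .head) rfl rfl)
  rw [← e l l' hl']
  refine Does.mono h2 ?_
  simp only [Prog.sz]
  omega

/-! ### Polynomially bounded cost functions -/

/-- Functions bounded by a polynomial. -/
@[fun_prop]
def IsPoly (c : ℕ → ℕ) : Prop := ∃ q : Polynomial ℕ, ∀ m, c m ≤ q.eval m

@[fun_prop]
theorem IsPoly.const (a : ℕ) : IsPoly fun _ => a := ⟨Polynomial.C a, fun m => by simp⟩

@[fun_prop]
theorem IsPoly.id : IsPoly fun m => m := ⟨Polynomial.X, fun m => by simp⟩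

@[fun_prop]
theorem IsPoly.add {f g : ℕ → ℕ} (hf : IsPoly f) (hg : IsPoly g) : IsPoly fun m => f m + g m := by
  obtain ⟨p, hp⟩ := hf
  obtain ⟨q, hq⟩ := hg
  exact ⟨p + q, fun m => by rw [Polynomial.eval_add]; exact Nat.add_le_add (hp m) (hq m)⟩

@[fun_prop]
theorem IsPoly.mul {f g : ℕ → ℕ} (hf : IsPoly f) (hg : IsPoly g) : IsPoly fun m => f m * g m := by
  obtain ⟨p, hp⟩ := hf
  obtain ⟨q, hq⟩ := hg
  exact ⟨p * q, fun m => by rw [Polynomial.eval_mul]; exact Nat.mul_le_mul (hp m) (hq m)⟩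

/-! ### Bit strings -/

/-- Encoding of bit strings. -/
abbrev encBits (l : List Bool) : Data := encList encBool l

/-- The program returning `true`. -/
def trueP : Prog := .cons .nil .nil

/-- Negation of the Boolean returned by `p`. -/
def notP (p : Prog) : Prog := .cond p .nil trueP

/-- Exclusive or of the Booleans returned by `p` and `q`. -/
def xorP (p q : Prog) : Prog := .cond p (notP q) q

/-- Majority of three Booleans. -/
def majP (p q s : Prog) : Prog := .cond p (.cond q trueP s) (.cond q s .nil)

/-- Entrywise exclusive or of bit strings. -/
def vxor (u v : List Bool) : List Bool := List.zipWith (fun a b => a ^^ b) u v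

/-- The inner product over `𝔽₂` of two bit strings. -/
def dotB : List Bool → List Bool → Bool
  | a :: u, b :: v => (a && b) ^^ dotB u v
  | _, _ => false

/-- Program for `vxor`. -/
def vxorP : Prog := zipP ▷ .cons .nil .id ▷ mapP (xorP (.tail ▷ .head) (.tail ▷ .tail))

theorem vxorP_spec : ∃ c, IsPoly c ∧ ∀ (M : ℕ) (u v : List Bool), u.length ≤ M →
    u.length = v.length →
    Does vxorP (.cons (encBits u) (encBits v)) (encBits (vxor u v)) (c M) := by
  apply Exists.intro
  apply And.intro
  case right =>
    intro M u v hM hl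
    have h1 := Does.zip (encA := encBool) (encB := encBool) hM hl.le
    have h2 := Does.map (encA := encPair encBool encBool) (encB := encBool)
      (f := fun p : Bool × Bool => p.1 ^^ p.2) (env := .nil) (T := 30) (N := M) (l := u.zip v)
      (p := xorP (.tail ▷ .head) (.tail ▷ .tail))
      (by simp; omega) (fun a _ => by
        refine Does.mono (Does.free rfl ?_) (by decide : _ ≤ 30)
        rcases a with ⟨a, b⟩
        cases a <;> cases b <;> rfl)
    have e : vxor u v = (u.zip v).map (fun p : Bool × Bool => p.1 ^^ p.2) := by
      rw [vxor, List.zip, List.map_zipWith]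
    rw [e]
    exact Does.mono (Does.comp (Does.comp h1 (Does.free rfl rfl)) h2) le_rfl
  case left =>
    fun_prop

/-- Program for `dotB`. -/
def dotP : Prog :=
  zipP ▷ .cons .nil (.cons .nil .id) ▷
    foldP (xorP (.tail ▷ .tail) (.cond (.tail ▷ .head ▷ .head) (.tail ▷ .head ▷ .tail) .nil))

theorem foldl_dotB (u v : List Bool) (c : Bool) :
    (u.zip v).foldl (fun c p => c ^^ (p.1 && p.2)) c = (c ^^ dotB u v) := by
  induction u generalizing v c with
  | nil => simp [dotB]
  | cons a u ih =>
    cases v with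
    | nil => simp [dotB]
    | cons b v => simp [dotB, ih]

theorem dotP_spec : ∃ c, IsPoly c ∧ ∀ (M : ℕ) (u v : List Bool), u.length ≤ M →
    u.length = v.length → Does dotP (.cons (encBits u) (encBits v)) (encBool (dotB u v)) (c M) := by
  apply Exists.intro
  apply And.intro
  case right =>
    intro M u v hM hl
    have h1 := Does.zip (encA := encBool) (encB := encBool) hM hl.le
    have h2 := Does.fold (encA := encPair encBool encBool) (encB := encBool)
      (f := fun c (p : Bool × Bool) => c ^^ (p.1 && p.2)) (env := .nil) (T := 50) (N := M)
      (p := xorP (.tail ▷ .tail) (.cond (.tail ▷ .head ▷ .head) (.tail ▷ .head ▷ .tail) .nil))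
      (l := u.zip v) (b := false) (fun _ => True)
      (by simp; omega) trivial (fun _ _ _ _ => trivial) (fun c a _ _ => by
        refine Does.mono (Does.free rfl ?_) (by decide : _ ≤ 50)
        rcases a with ⟨a, b⟩
        cases a <;> cases b <;> cases c <;> rfl)
    rw [foldl_dotB, Bool.false_xor] at h2
    exact Does.mono (Does.comp (Does.comp h1 (Does.free rfl rfl)) h2) le_rfl
  case left =>
    fun_prop

/-- Equality test for bit strings of the same length. -/
def eqP : Prog :=
  zipP ▷ .cons .nil (.cons trueP .id) ▷
    foldP (.cond (.tail ▷ .tail) (notP (xorP (.tail ▷ .head ▷ .head) (.tail ▷ .head ▷ .tail))) .nil)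

theorem foldl_eq (u v : List Bool) (h : u.length = v.length) (c : Bool) :
    (u.zip v).foldl (fun c p => c && !(p.1 ^^ p.2)) c = (c && decide (u = v)) := by
  induction u generalizing v c with
  | nil => cases v <;> simp_all
  | cons a u ih =>
    cases v with
    | nil => simp at h
    | cons b v =>
      simp only [List.length_cons, add_left_inj] at h
      simp only [List.zip_cons_cons, List.foldl_cons, ih v h, List.cons.injEq, Bool.decide_and]
      cases a <;> cases b <;> cases c <;> simp

theorem eqP_spec : ∃ c, IsPoly c ∧ ∀ (M : ℕ) (u v : List Bool), u.length ≤ M →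
    u.length = v.length →
    Does eqP (.cons (encBits u) (encBits v)) (encBool (decide (u = v))) (c M) := by
  apply Exists.intro
  apply And.intro
  case right =>
    intro M u v hM hl
    have h1 := Does.zip (encA := encBool) (encB := encBool) hM hl.le
    have h2 := Does.fold (encA := encPair encBool encBool) (encB := encBool)
      (f := fun c (p : Bool × Bool) => c && !(p.1 ^^ p.2)) (env := .nil) (T := 50) (N := M)
      (p := .cond (.tail ▷ .tail)
        (notP (xorP (.tail ▷ .head ▷ .head) (.tail ▷ .head ▷ .tail))) .nil)
      (l := u.zip v) (b := true) (fun _ => True)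
      (by simp; omega) trivial (fun _ _ _ _ => trivial) (fun c a _ _ => by
        refine Does.mono (Does.free rfl ?_) (by decide : _ ≤ 50)
        rcases a with ⟨a, b⟩
        cases a <;> cases b <;> cases c <;> rfl)
    rw [foldl_eq u v hl, Bool.true_and] at h2
    exact Does.mono (Does.comp (Does.comp h1 (Does.free rfl rfl)) h2) le_rfl
  case left =>
    fun_prop

/-! ### Integers in two's complement -/

/-- The `W` low-order bits of the integer `z` in two's complement. -/
def bz : ℕ → ℤ → List Bool
  | 0, _ => []
  | W + 1, z => decide (z % 2 = 1) :: bz W (z / 2)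

/-- Encoding of integers modulo `2 ^ W`. -/
abbrev encZ (W : ℕ) (z : ℤ) : Data := encBits (bz W z)

@[simp] theorem length_bz (W : ℕ) (z : ℤ) : (bz W z).length = W := by
  induction W generalizing z with
  | zero => rfl
  | succ W ih => simp [bz, ih]

/-- A full adder. -/
def adder (c : Bool) (p : Bool × Bool) : Bool × Bool :=
  ((p.1 ^^ p.2) ^^ c, (p.1 && p.2) || (p.1 && c) || (p.2 && c))

theorem mapAcc_adder (W : ℕ) (a b : ℤ) (c : Bool) :
    (mapAcc adder c ((bz W a).zip (bz W b))).1 = bz W (a + b + if c then 1 else 0) := by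
  induction W generalizing a b c with
  | zero => rfl
  | succ W ih =>
    simp only [bz, List.zip_cons_cons, mapAcc, ih]
    rcases Int.emod_two_eq_zero_or_one a with ha | ha <;>
    rcases Int.emod_two_eq_zero_or_one b with hb | hb <;>
    cases c <;> simp only [adder, ha, hb] <;> congr 1 <;>
    first
      | (simp; omega)
      | (congr 1; simp; omega)

/-- Addition of integers. -/
def addP : Prog :=
  zipP ▷ .cons .nil (.cons .nil .id) ▷
    mapAccP (.cons
      (xorP (xorP (.tail ▷ .head ▷ .head) (.tail ▷ .head ▷ .tail)) (.tail ▷ .tail))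
      (majP (.tail ▷ .head ▷ .head) (.tail ▷ .head ▷ .tail) (.tail ▷ .tail))) ▷ .head

theorem addP_spec : ∃ c, IsPoly c ∧ ∀ (M W : ℕ) (a b : ℤ), W ≤ M →
    Does addP (.cons (encZ W a) (encZ W b)) (encZ W (a + b)) (c M) := by
  apply Exists.intro
  apply And.intro
  case right =>
    intro M W a b hM
    have h1 := Does.zip (encA := encBool) (encB := encBool) (l := bz W a) (l' := bz W b) (N := M)
      (by simpa) (by simp)
    have h2 := Does.mapAcc (encA := encPair encBool encBool) (encB := encBool) (encS := encBool)
      (f := adder) (env := .nil) (T := 100) (N := M)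
      (p := .cons
      (xorP (xorP (.tail ▷ .head ▷ .head) (.tail ▷ .head ▷ .tail)) (.tail ▷ .tail))
      (majP (.tail ▷ .head ▷ .head) (.tail ▷ .head ▷ .tail) (.tail ▷ .tail)))
      (l := (bz W a).zip (bz W b)) (s := false) (fun _ => True)
      (by simpa) trivial (fun _ _ _ _ => trivial) (fun c a _ _ => by
        refine Does.mono (Does.free rfl ?_) (by decide : _ ≤ 100)
        rcases a with ⟨a, b⟩
        cases a <;> cases b <;> cases c <;> rfl)
    have e := mapAcc_adder W a b false
    simp only [Bool.false_eq_true, if_false, add_zero] at e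
    rw [show encZ W (a + b) = encBits _ from congrArg encBits e.symm]
    exact Does.mono (Does.comp (Does.comp (Does.comp h1 (Does.free rfl rfl)) h2)
      (Does.free rfl rfl)) le_rfl
  case left =>
    fun_prop

/-- One digit of a negation. -/
def negDigit (c a : Bool) : Bool × Bool := (!a ^^ c, !a && c)

theorem mapAcc_negDigit (W : ℕ) (a : ℤ) (c : Bool) :
    (mapAcc negDigit c (bz W a)).1 = bz W (-a - 1 + if c then 1 else 0) := by
  induction W generalizing a c with
  | zero => rfl
  | succ W ih =>
    simp only [bz, mapAcc, ih]
    rcases Int.emod_two_eq_zero_or_one a with ha | ha <;>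
    cases c <;> simp only [negDigit, ha] <;> congr 1 <;>
    first
      | (simp; omega)
      | (congr 1; simp; omega)

/-- Negation of integers. -/
def negP : Prog :=
  .cons .nil (.cons trueP .id) ▷
    mapAccP (.cons (xorP (notP (.tail ▷ .head)) (.tail ▷ .tail))
      (.cond (.tail ▷ .head) .nil (.tail ▷ .tail))) ▷ .head

theorem negP_spec : ∃ c, IsPoly c ∧ ∀ (M W : ℕ) (a : ℤ), W ≤ M →
    Does negP (encZ W a) (encZ W (-a)) (c M) := by
  apply Exists.intro
  apply And.intro
  case right =>
    intro M W a hM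
    have h2 := Does.mapAcc (encA := encBool) (encB := encBool) (encS := encBool)
      (f := negDigit) (env := .nil) (T := 100) (N := M)
      (p := .cons (xorP (notP (.tail ▷ .head)) (.tail ▷ .tail))
        (.cond (.tail ▷ .head) .nil (.tail ▷ .tail)))
      (l := bz W a) (s := true) (fun _ => True)
      (by simpa) trivial (fun _ _ _ _ => trivial) (fun c a _ _ => by
        refine Does.mono (Does.free rfl ?_) (by decide : _ ≤ 100)
        cases a <;> cases c <;> rfl)
    have e := mapAcc_negDigit W a true
    rw [if_pos rfl, sub_add_cancel] at e
    rw [show encZ W (-a) = encBits _ from congrArg encBits e.symm]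
    exact Does.comp (Does.call (a := .cons .nil (.cons trueP .id)) rfl h2) (Does.free rfl rfl)
  case left =>
    fun_prop

/-- The sign bit in two's complement. -/
def msb (W : ℕ) (z : ℤ) : Bool := (bz W z).foldl (fun _ b => b) false

/-- The sign bit is correct for integers in range. -/
theorem msb_eq (W : ℕ) (z : ℤ) (h : |z| < 2 ^ W) : msb (W + 1) z = decide (z < 0) := by
  have key : ∀ (W : ℕ) (z : ℤ) (c : Bool), -2 ^ W ≤ z → z < 2 ^ W →
      (bz (W + 1) z).foldl (fun _ b => b) c = decide (z < 0) := by
    intro W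
    induction W with
    | zero =>
      intro z c h h'
      have : z = 0 ∨ z = -1 := by rw [pow_zero] at h h'; omega
      rcases this with rfl | rfl <;> simp [bz]
    | succ W ih =>
      intro z c h h'
      rw [pow_succ] at h h'
      rw [bz, List.foldl_cons, ih _ _ (by omega) (by omega)]
      exact decide_eq_decide.2 (by omega)
  rw [abs_lt] at h
  exact key W z false h.1.le h.2

/-- Program for `msb`. -/
def msbP : Prog := .cons .nil (.cons .nil .id) ▷ foldP (.tail ▷ .head)

theorem msbP_spec : ∃ c, IsPoly c ∧ ∀ (M W : ℕ) (a : ℤ), W ≤ M →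
    Does msbP (encZ W a) (encBool (msb W a)) (c M) := by
  apply Exists.intro
  apply And.intro
  case right =>
    intro M W a hM
    have h2 := Does.fold (encA := encBool) (encB := encBool)
      (f := fun _ b => b) (env := .nil) (T := 10) (N := M)
      (p := .tail ▷ .head)
      (l := bz W a) (b := false) (fun _ => True)
      (by simpa) trivial (fun _ _ _ _ => trivial) (fun c a _ _ =>
        Does.mono (Does.free rfl rfl) (by decide : _ ≤ 10))
    exact Does.call (a := .cons .nil (.cons .nil .id)) rfl h2
  case left =>
    fun_prop

/-- The absolute value computed with the sign bit. -/
def absW (W : ℕ) (z : ℤ) : ℤ := if msb W z then -z else z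

theorem absW_eq (W : ℕ) (z : ℤ) (h : |z| < 2 ^ W) : absW (W + 1) z = |z| := by
  rw [absW, msb_eq W z h]
  by_cases hz : z < 0
  · simp [hz, abs_of_neg hz]
  · simp [hz, abs_of_nonneg (not_lt.1 hz)]

/-- Program for `absW`. -/
def absP : Prog := .cond msbP negP .id

theorem absP_spec : ∃ c, IsPoly c ∧ ∀ (M W : ℕ) (a : ℤ), W ≤ M →
    Does absP (encZ W a) (encZ W (absW W a)) (c M) := by
  obtain ⟨c₁, hc₁, h₁⟩ := msbP_spec
  obtain ⟨c₂, hc₂, h₂⟩ := negP_spec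
  refine ⟨fun M => c₁ M + (c₂ M + 1) + 1, ?_, fun M W a hM => ?_⟩
  · fun_prop
  · refine Does.ite (h₁ M W a hM) (fun h => ?_) (fun h => ?_)
    · rw [absW, if_pos h]
      exact (h₂ M W a hM).mono (by omega)
    · rw [absW, if_neg (by simp [h])]
      exact (Does.free (p := .id) rfl rfl).mono (by simp only [Prog.sz]; omega)

/-- Comparison computed with the sign bit of the difference. -/
def ltP : Prog := .cons .head (.tail ▷ negP) ▷ addP ▷ msbP

theorem ltP_spec : ∃ c, IsPoly c ∧ ∀ (M W : ℕ) (a b : ℤ), W ≤ M →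
    Does ltP (.cons (encZ W a) (encZ W b)) (encBool (msb W (a - b))) (c M) := by
  obtain ⟨c₁, hc₁, h₁⟩ := msbP_spec
  obtain ⟨c₂, hc₂, h₂⟩ := negP_spec
  obtain ⟨c₃, hc₃, h₃⟩ := addP_spec
  apply Exists.intro
  apply And.intro
  case right =>
    intro M W a b hM
    exact Does.comp (Does.comp (Does.cons (Does.free (p := .head) rfl rfl)
      (Does.call (a := .tail) rfl (h₂ M W b hM))) (h₃ M W a (-b) hM)) (h₁ M W (a + -b) hM)
  case left =>
    fun_prop

/-! ### Vectors of integers -/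

/-- Encoding of vectors of integers. -/
abbrev encV (W : ℕ) (v : List ℤ) : Data := encList (encZ W) v

/-- Sum of vectors. -/
def vadd (u v : List ℤ) : List ℤ := List.zipWith (fun a b => a + b) u v

/-- Program for `vadd`. -/
def vaddP : Prog := zipP ▷ .cons .nil .id ▷ mapP (.tail ▷ addP)

theorem vaddP_spec : ∃ c, IsPoly c ∧ ∀ (M W : ℕ) (u v : List ℤ), W ≤ M → u.length ≤ M →
    u.length = v.length → Does vaddP (.cons (encV W u) (encV W v)) (encV W (vadd u v)) (c M) := by
  obtain ⟨c₁, hc₁, h₁⟩ := addP_spec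
  apply Exists.intro
  apply And.intro
  case right =>
    intro M W u v hW hM hl
    have h1 := Does.zip (encA := encZ W) (encB := encZ W) hM hl.le
    have h2 := Does.map (encA := encPair (encZ W) (encZ W)) (encB := encZ W)
      (f := fun p : ℤ × ℤ => p.1 + p.2) (env := .nil) (N := M) (l := u.zip v)
      (by simp; omega) (fun a _ => Does.call (a := .tail) rfl (h₁ M W a.1 a.2 hW))
    have e : vadd u v = (u.zip v).map (fun p : ℤ × ℤ => p.1 + p.2) := by
      rw [vadd, List.zip, List.map_zipWith]
    rw [e]
    exact Does.mono (Does.comp (Does.comp h1 (Does.free rfl rfl)) h2) le_rfl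
  case left =>
    fun_prop

/-- Negation of vectors. -/
def vneg (u : List ℤ) : List ℤ := u.map fun a => -a

/-- Program for `vneg`. -/
def vnegP : Prog := .cons .nil .id ▷ mapP (.tail ▷ negP)

theorem vnegP_spec : ∃ c, IsPoly c ∧ ∀ (M W : ℕ) (u : List ℤ), W ≤ M → u.length ≤ M →
    Does vnegP (encV W u) (encV W (vneg u)) (c M) := by
  obtain ⟨c₁, hc₁, h₁⟩ := negP_spec
  apply Exists.intro
  apply And.intro
  case right =>
    intro M W u hW hM
    have h2 := Does.map (encA := encZ W) (encB := encZ W)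
      (f := fun a : ℤ => -a) (env := .nil) (N := M) (l := u)
      hM (fun a _ => Does.call (a := .tail) rfl (h₁ M W a hW))
    exact Does.mono (Does.comp (Does.free rfl rfl) h2) le_rfl
  case left =>
    fun_prop

/-! ### Natural numbers in unary and in binary -/

/-- Unary numbers, as strings of zero bits. -/
abbrev un (m : ℕ) : Data := encBits (List.replicate m false)

theorem Does.unAdd (a b N : ℕ) (h : a ≤ N) :
    Does appendP (.cons (un a) (un b)) (un (a + b)) (N * 80 + 60) := by
  have := Does.append (encA := encBool) (l := List.replicate a false)
    (l' := List.replicate b false) (N := N) (by simpa)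
  rwa [List.replicate_append_replicate] at this

/-- Product of unary numbers. -/
def unMulP : Prog := .cons .tail (.cons .nil .head) ▷ foldP (.cons .head (.tail ▷ .tail) ▷ appendP)

theorem unMulP_spec : ∃ c, IsPoly c ∧ ∀ (M a b : ℕ), a ≤ M → b ≤ M →
    Does unMulP (.cons (un a) (un b)) (un (a * b)) (c M) := by
  apply Exists.intro
  apply And.intro
  case right =>
    intro M a b ha hb
    have h := Does.fold (encA := encBool) (encB := un) (f := fun s _ => b + s) (env := un b)
      (l := List.replicate a false) (b := 0) (N := M) (fun _ => True) (by simpa) trivial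
      (fun _ _ _ _ => trivial)
      (fun s _ _ _ => Does.call (a := .cons .head (.tail ▷ .tail)) rfl (Does.unAdd b s M hb))
    have e : ∀ s, (List.replicate a false).foldl (fun s _ => b + s) s = a * b + s := by
      clear h ha
      induction a with
      | zero => simp
      | succ a ih =>
        intro s
        rw [List.replicate_succ, List.foldl_cons, ih]
        ring
    rw [e, add_zero] at h
    exact Does.call (a := .cons .tail (.cons .nil .head)) rfl h
  case left =>
    fun_prop

theorem IsPoly.comp_poly {c : ℕ → ℕ} (hc : IsPoly c) (p : Polynomial ℕ) :
    IsPoly fun m => c (p.eval m) := by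
  obtain ⟨q, hq⟩ := hc
  exact ⟨q.comp p, fun m => by simpa using hq (p.eval m)⟩

@[fun_prop]
theorem IsPoly.eval (p : Polynomial ℕ) : IsPoly fun m => p.eval m := ⟨p, fun _ => le_rfl⟩

theorem exists_unConstP (a : ℕ) : ∃ p : Prog, p.loopFree = true ∧ ∀ x, p.ev x = un a := by
  induction a with
  | zero => exact ⟨.nil, rfl, fun _ => rfl⟩
  | succ a ih =>
    obtain ⟨p, hp, he⟩ := ih
    exact ⟨.cons .nil p, by simpa [Prog.loopFree] using hp, fun x => by simp [Prog.ev, he]; rfl⟩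

/-- Polynomials can be evaluated in unary in polynomial time. -/
theorem exists_unPolyP (b : Polynomial ℕ) : ∃ p : Prog, ∃ c, IsPoly c ∧ ∀ n,
    Does p (un n) (un (b.eval n)) (c n) := by
  induction b using Polynomial.induction_on with
  | C a =>
    obtain ⟨p, hp, he⟩ := exists_unConstP a
    refine ⟨p, fun _ => p.sz, IsPoly.const _, fun n => Does.free hp ?_⟩
    rw [he, Polynomial.eval_C]
  | add f g hf hg =>
    obtain ⟨p, c, hc, hp⟩ := hf
    obtain ⟨q, d, hd, hq⟩ := hg
    refine ⟨.cons p q ▷ appendP, fun n => (c n + d n + 1) + (f.eval n * 80 + 60) + 1, ?_,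
      fun n => ?_⟩
    · fun_prop
    · rw [Polynomial.eval_add]
      exact Does.comp (Does.cons (hp n) (hq n)) (Does.unAdd _ _ _ le_rfl)
  | monomial n a ih =>
    obtain ⟨p, c, hc, hp⟩ := ih
    obtain ⟨d, hd, hm⟩ := unMulP_spec
    refine ⟨.cons p .id ▷ unMulP,
      fun m => (c m + 1 + 1) + d ((Polynomial.C a * Polynomial.X ^ n + Polynomial.X).eval m) + 1,
      ?_, fun m => ?_⟩
    · exact ((((hc.add (.const _)).add (.const _))).add (hd.comp_poly _)).add (.const _)
    · have e : (Polynomial.C a * Polynomial.X ^ (n + 1)).eval m =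
          (Polynomial.C a * Polynomial.X ^ n).eval m * m := by
        simp [pow_succ, mul_assoc]
      rw [e]
      refine Does.comp (Does.cons (hp m) (Does.free (p := .id) rfl rfl)) (hm _ _ _ ?_ ?_)
      · rw [Polynomial.eval_add]; omega
      · rw [Polynomial.eval_add, Polynomial.eval_X]; omega

/-- Truncated subtraction of unary numbers: `(a, b)` gives `b - a`. -/
def unSubP : Prog := .cons .nil (.cons .tail .head) ▷ foldP (.tail ▷ .tail ▷ .tail)

theorem unSubP_spec : ∃ c, IsPoly c ∧ ∀ (M a b : ℕ), a ≤ M →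
    Does unSubP (.cons (un a) (un b)) (un (b - a)) (c M) := by
  apply Exists.intro
  apply And.intro
  case right =>
    intro M a b ha
    have h := Does.fold (encA := encBool) (encB := un) (f := fun s _ => s - 1) (env := .nil)
      (l := List.replicate a false) (b := b) (N := M) (p := .tail ▷ .tail ▷ .tail) (T := 10)
      (fun _ => True) (by simpa) trivial
      (fun _ _ _ _ => trivial)
      (fun s _ _ _ => by
        refine Does.mono (Does.free rfl ?_) (by decide : _ ≤ 10)
        cases s <;> rfl)
    have e : (List.replicate a false).foldl (fun s _ => s - 1) b = b - a := by
      clear h ha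
      induction a generalizing b with
      | zero => simp
      | succ a ih =>
        rw [List.replicate_succ, List.foldl_cons, ih]
        omega
    rw [e] at h
    exact Does.call (a := .cons .nil (.cons .tail .head)) rfl h
  case left =>
    fun_prop

/-- Conversion of binary to unary numbers. -/
def unaryP : Prog :=
  revP ▷ .cons .nil (.cons .nil .id) ▷
    foldP (.cons (.cond (.tail ▷ .head) (.cons .nil (.tail ▷ .tail)) (.tail ▷ .tail))
      (.tail ▷ .tail) ▷ appendP)

theorem foldl_bits (m : ℕ) :
    m.bits.reverse.foldl (fun v b => (if b then v + 1 else v) + v) 0 = m := by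
  induction m using Nat.binaryRec' with
  | zero => simp
  | bit b n h ih =>
    rw [Nat.bits_append_bit n b h, List.reverse_cons, List.foldl_append, ih]
    cases b <;> simp [Nat.bit] <;> omega

theorem le_foldl_bits (l : List Bool) (v : ℕ) :
    v ≤ l.foldl (fun v b => (if b then v + 1 else v) + v) v := by
  induction l generalizing v with
  | nil => simp
  | cons b l ih =>
    refine le_trans ?_ (ih _)
    cases b <;> simp

theorem Does.unary (m N : ℕ) (h : m.bits.length ≤ N) :
    Does unaryP (encNat m) (un m) (N * (m * 80 + 300) + 100) := by
  have h1 := Does.rev (encA := encBool) h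
  have h2 := Does.fold_prefix (encA := encBool) (encB := un) (N := N) (l := m.bits.reverse)
    (env := .nil) (b := 0) (T := m * 80 + 200)
    (p := .cons (.cond (.tail ▷ .head) (.cons .nil (.tail ▷ .tail)) (.tail ▷ .tail))
      (.tail ▷ .tail) ▷ appendP)
    (f := fun v b => (if b then v + 1 else v) + v) (by simpa) (fun pre b hpre => by
      obtain ⟨post, hpost⟩ := hpre
      set v := pre.foldl (fun v b => (if b then v + 1 else v) + v) 0 with hv
      have hle : (if b then v + 1 else v) ≤ m := by
        have := le_foldl_bits post ((if b then v + 1 else v) + v)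
        have e : (pre ++ [b] ++ post).foldl (fun v b => (if b then v + 1 else v) + v) 0 = m := by
          rw [hpost, foldl_bits]
        rw [List.foldl_append, List.foldl_append, ← hv] at e
        simp only [List.foldl_cons, List.foldl_nil] at e
        omega
      refine Does.mono (Does.comp (Does.free (y := .cons (un (if b then v + 1 else v)) (un v))
        rfl ?_) (Does.unAdd _ v m hle)) ?_
      · cases b <;> rfl
      · simp only [Prog.sz]
        omega)
  rw [foldl_bits] at h2
  refine Does.mono (Does.comp (Does.comp h1 (Does.free rfl rfl)) h2) ?_
  simp only [Prog.sz]
  have : N * (m * 80 + 300) = N * (m * 80 + 200 + 30) + N * 40 + N * 30 := by ring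
  omega

/-- The binary successor. -/
def incB : Bool → List Bool → List Bool
  | false, l => l
  | true, [] => [true]
  | true, false :: l => true :: l
  | true, true :: l => false :: incB true l

theorem incB_bits (m : ℕ) : incB true m.bits = (m + 1).bits := by
  induction m using Nat.binaryRec' with
  | zero => rfl
  | bit b n h ih =>
    rw [Nat.bits_append_bit n b h]
    cases b
    · have e : Nat.bit false n + 1 = Nat.bit true n := by simp [Nat.bit]
      rw [incB, e, Nat.bits_append_bit n true (fun _ => rfl)]
    · have e : Nat.bit true n + 1 = Nat.bit false (n + 1) := by simp [Nat.bit]; omega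
      rw [incB, ih, e, Nat.bits_append_bit (n + 1) false (fun h => by omega)]

theorem mapAcc_incB (c : Bool) (l : List Bool) :
    incB c l = (mapAcc (fun c a => (a ^^ c, a && c)) c l).1 ++
      if (mapAcc (fun c a => (a ^^ c, a && c)) c l).2 then [true] else [] := by
  induction l generalizing c with
  | nil => cases c <;> rfl
  | cons a l ih =>
    simp only [mapAcc]
    have h0 := ih false
    have h1 := ih true
    simp only [incB] at h0
    cases a <;> cases c <;> simp [incB, ← h0, ← h1]

/-- Successor of binary numbers. -/
def incP : Prog :=
  .cons .nil (.cons trueP .id) ▷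
    mapAccP (.cons (xorP (.tail ▷ .head) (.tail ▷ .tail))
      (.cond (.tail ▷ .head) (.tail ▷ .tail) .nil)) ▷
    .cons .head (.cond .tail (.cons trueP .nil) .nil) ▷ appendP

theorem Does.inc (m N : ℕ) (h : m.bits.length ≤ N) :
    Does incP (encNat m) (encNat (m + 1)) (N * 300 + 300) := by
  have h2 := Does.mapAcc (encA := encBool) (encB := encBool) (encS := encBool)
    (f := fun c a => (a ^^ c, a && c)) (env := .nil) (T := 50) (N := N)
    (p := .cons (xorP (.tail ▷ .head) (.tail ▷ .tail))
      (.cond (.tail ▷ .head) (.tail ▷ .tail) .nil))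
    (l := m.bits) (s := true) (fun _ => True)
    h trivial (fun _ _ _ _ => trivial) (fun c a _ _ => by
      refine Does.mono (Does.free rfl ?_) (by decide : _ ≤ 50)
      cases a <;> cases c <;> rfl)
  have h3 := Does.append (encA := encBool)
    (l := (SparseHadamard.mapAcc (fun c a => (a ^^ c, a && c)) true m.bits).1)
    (l' := if (SparseHadamard.mapAcc (fun c a => (a ^^ c, a && c)) true m.bits).2 then [true]
      else []) (N := N) (by rwa [length_mapAcc])
  rw [← mapAcc_incB, incB_bits] at h3
  refine Does.mono (Does.comp (Does.comp (Does.call (a := .cons .nil (.cons trueP .id)) rfl h2)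
    (Does.free (y := .cons (encBits (SparseHadamard.mapAcc _ true m.bits).1)
      (encBits (if (SparseHadamard.mapAcc (fun c a => (a ^^ c, a && c)) true m.bits).2 then [true]
      else []))) rfl ?_)) h3) ?_
  · generalize SparseHadamard.mapAcc (fun c a => (a ^^ c, a && c)) true m.bits = q
    rcases q with ⟨q, c⟩
    cases c <;> rfl
  · simp only [Prog.sz, trueP]
    omega

/-! ### Costs linear in the length of a list -/

/-- Functions of `M` and `N` bounded by `N` times a polynomial in `M`. -/
def IsLin (c : ℕ → ℕ → ℕ) : Prop := ∃ q, IsPoly q ∧ ∀ M N, 1 ≤ N → c M N ≤ N * q M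

theorem IsLin.of_poly {c : ℕ → ℕ} (hc : IsPoly c) : IsLin fun M _ => c M :=
  ⟨c, hc, fun _ _ hN => Nat.le_mul_of_pos_left _ hN⟩

theorem IsLin.self : IsLin fun _ N => N := ⟨fun _ => 1, by fun_prop, fun _ _ _ => by simp⟩

theorem IsLin.add {c d : ℕ → ℕ → ℕ} (hc : IsLin c) (hd : IsLin d) :
    IsLin fun M N => c M N + d M N := by
  obtain ⟨p, hp, hc⟩ := hc
  obtain ⟨q, hq, hd⟩ := hd
  exact ⟨fun M => p M + q M, by fun_prop, fun M N hN => by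
    rw [mul_add]; exact Nat.add_le_add (hc M N hN) (hd M N hN)⟩

theorem IsLin.poly_mul {c : ℕ → ℕ} {d : ℕ → ℕ → ℕ} (hc : IsPoly c) (hd : IsLin d) :
    IsLin fun M N => c M * d M N := by
  obtain ⟨q, hq, hd⟩ := hd
  exact ⟨fun M => c M * q M, by fun_prop, fun M N hN => by
    rw [mul_left_comm]; exact Nat.mul_le_mul_left _ (hd M N hN)⟩

theorem IsLin.mul_poly {c : ℕ → ℕ} {d : ℕ → ℕ → ℕ} (hd : IsLin d) (hc : IsPoly c) :
    IsLin fun M N => d M N * c M := by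
  simpa only [mul_comm] using IsLin.poly_mul hc hd

theorem IsLin.mul_const {c : ℕ → ℕ → ℕ} (hc : IsLin c) {a : ℕ} (ha : 1 ≤ a) :
    IsLin fun M N => c M (a * N) := by
  obtain ⟨q, hq, hc⟩ := hc
  refine ⟨fun M => a * q M, by fun_prop, fun M N hN => ?_⟩
  refine (hc M (a * N) (Nat.mul_pos ha hN)).trans (le_of_eq ?_)
  ring

/-! ### Radix sort -/

/-- One pass of radix sort: `rem` is the part of the sorting key not yet looked at; the items whose
next bit is `1` come first. -/
def radixPass {α : Type} (l : List (List Bool × α)) : List (List Bool × α) :=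
  (l.filter fun p => p.1.headD false).map (fun p => (p.1.tail, p.2)) ++
    (l.filter fun p => !p.1.headD false).map (fun p => (p.1.tail, p.2))

theorem length_radixPass {α : Type} (l : List (List Bool × α)) :
    (radixPass l).length = l.length := by
  induction l with
  | nil => rfl
  | cons a l ih =>
    simp only [radixPass, List.length_append, List.length_map] at ih ⊢
    cases h : a.1.headD false <;>
      simp [-List.headD_eq_head?_getD, h] <;> omega

theorem length_iterate_radixPass {α : Type} (m : ℕ) (l : List (List Bool × α)) :
    (radixPass^[m] l).length = l.length := by
  induction m generalizing l with
  | zero => rfl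
  | succ m ih => rw [Function.iterate_succ_apply, ih, length_radixPass]

/-- Program for `radixPass`. -/
def radixPassP : Prog :=
  .cons .nil (.cons (.cons .nil .nil) .id) ▷
    foldP (.cond (.tail ▷ .head ▷ .head ▷ .head)
      (.cons (.cons (.cons (.tail ▷ .head ▷ .head ▷ .tail) (.tail ▷ .head ▷ .tail))
        (.tail ▷ .tail ▷ .head)) (.tail ▷ .tail ▷ .tail))
      (.cons (.tail ▷ .tail ▷ .head) (.cons
        (.cons (.tail ▷ .head ▷ .head ▷ .tail) (.tail ▷ .head ▷ .tail))
        (.tail ▷ .tail ▷ .tail)))) ▷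
    .cons (.cons .nil .tail ▷ revAppendP) .head ▷ revAppendP

theorem Does.radixPass {α : Type} {encA : α → Data} {l : List (List Bool × α)} {N : ℕ}
    (hl : l.length ≤ N) :
    Does radixPassP (encList (encPair encBits encA) l)
      (encList (encPair encBits encA) (radixPass l)) (N * 300 + 100) := by
  have h1 := Does.fold (encA := encPair encBits encA)
    (encB := encPair (encList (encPair encBits encA)) (encList (encPair encBits encA)))
    (f := fun b a => if a.1.headD false then ((a.1.tail, a.2) :: b.1, b.2)
      else (b.1, (a.1.tail, a.2) :: b.2)) (env := .nil) (l := l) (b := ([], [])) (T := 100)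
    (p := .cond (.tail ▷ .head ▷ .head ▷ .head)
      (.cons (.cons (.cons (.tail ▷ .head ▷ .head ▷ .tail) (.tail ▷ .head ▷ .tail))
        (.tail ▷ .tail ▷ .head)) (.tail ▷ .tail ▷ .tail))
      (.cons (.tail ▷ .tail ▷ .head) (.cons
        (.cons (.tail ▷ .head ▷ .head ▷ .tail) (.tail ▷ .head ▷ .tail))
        (.tail ▷ .tail ▷ .tail))))
    (fun _ => True) hl trivial (fun _ _ _ _ => trivial) (fun b a _ _ => by
      refine Does.mono (Does.free rfl ?_) (by decide : _ ≤ 100)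
      rcases a with ⟨k, a⟩
      rcases k with _ | ⟨c, k⟩
      · rfl
      · cases c <;> rfl)
  have e : ∀ (l o z : List (List Bool × α)), l.foldl (fun b a =>
      if a.1.headD false then ((a.1.tail, a.2) :: b.1, b.2)
      else (b.1, (a.1.tail, a.2) :: b.2)) (o, z) =
      (((l.filter fun p => p.1.headD false).map (fun p => (p.1.tail, p.2))).reverse ++ o,
        ((l.filter fun p => !p.1.headD false).map (fun p => (p.1.tail, p.2))).reverse ++ z) := by
    intro l
    induction l with
    | nil => intro o z; rfl
    | cons a l ih =>
      intro o z
      rw [List.foldl_cons]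
      cases h : a.1.headD false
      · rw [if_neg (by simp), ih]
        simp [-List.headD_eq_head?_getD, h]
      · rw [if_pos rfl, ih]
        simp [-List.headD_eq_head?_getD, h]
  rw [e, List.append_nil, List.append_nil] at h1
  have hlen := length_radixPass l
  rw [SparseHadamard.radixPass, List.length_append] at hlen
  have h2 := Does.revAppend (encA := encPair encBits encA) (acc := []) (N := N)
    (l := ((l.filter fun p => !p.1.headD false).map (fun p => (p.1.tail, p.2))).reverse)
    (by rw [List.length_reverse]; omega)
  rw [List.reverse_reverse, List.append_nil] at h2
  have h3 := Does.revAppend (encA := encPair encBits encA) (N := N)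
    (acc := (l.filter fun p => !p.1.headD false).map (fun p => (p.1.tail, p.2)))
    (l := ((l.filter fun p => p.1.headD false).map (fun p => (p.1.tail, p.2))).reverse)
    (by rw [List.length_reverse]; omega)
  rw [List.reverse_reverse] at h3
  refine Does.mono (Does.comp (Does.comp (Does.call
    (a := .cons .nil (.cons (.cons .nil .nil) .id)) rfl h1)
    (Does.cons (Does.call (a := .cons .nil .tail) rfl h2) (Does.free (p := .head) rfl rfl))) h3) ?_
  simp only [Prog.sz]
  omega

/-- Several passes of radix sort: the input is the number of passes in unary and the list. -/
def radixP : Prog := .cons .nil (.cons .tail .head) ▷ foldP (.tail ▷ .tail ▷ radixPassP)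

theorem foldl_replicate {β : Type} (f : β → β) (m : ℕ) (b : β) :
    (List.replicate m false).foldl (fun b _ => f b) b = f^[m] b := by
  induction m generalizing b with
  | zero => rfl
  | succ m ih => rw [List.replicate_succ, List.foldl_cons, ih, Function.iterate_succ_apply]

theorem radixP_spec : ∃ c, IsLin c ∧ ∀ (M N : ℕ), 1 ≤ N → ∀ (m : ℕ) (α : Type)
    (encA : α → Data) (l : List (List Bool × α)), m ≤ M → l.length ≤ N →
    Does radixP (.cons (un m) (encList (encPair encBits encA) l))
      (encList (encPair encBits encA) (radixPass^[m] l)) (c M N) := by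
  apply Exists.intro
  apply And.intro
  case right =>
    intro M N hN m α encA l hm hl
    have h := Does.fold (encA := encBool) (encB := encList (encPair encBits encA)) (N := M)
      (f := fun b _ => radixPass b) (b := l) (l := List.replicate m false) (env := .nil)
      (p := .tail ▷ .tail ▷ radixPassP) (fun b => b.length ≤ N) (by simpa) hl
      (fun b _ _ hb => by rwa [length_radixPass])
      (fun b _ _ hb => Does.call (a := .tail ▷ .tail) rfl (Does.radixPass hb))
    rw [foldl_replicate] at h
    exact Does.mono (Does.call (a := .cons .nil (.cons .tail .head)) rfl h) le_rfl
  case left =>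
    repeat' first
      | assumption
      | exact IsLin.self
      | exact IsLin.of_poly (by fun_prop)
      | refine IsLin.add ?_ ?_
      | refine IsLin.poly_mul (by fun_prop) ?_

/-! ### Lists of items -/

/-- An item contributes a vector of integers at a key; a key may occur in several items. -/
abbrev Item : Type := List Bool × List ℤ

/-- Encoding of items. -/
abbrev encItem (W : ℕ) : Item → Data := encPair encBits (encV W)

/-- Encoding of lists of items. -/
abbrev encItems (W : ℕ) (l : List Item) : Data := encList (encItem W) l

/-- The keys have length `r` and the vectors have length `m`. -/
def HasDims (r m : ℕ) (l : List Item) : Prop := ∀ p ∈ l, p.1.length = r ∧ p.2.length = m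

/-- Add an item in front of a list, merging it with the first item if the keys agree. -/
def mergeStep (acc : List Item) (a : Item) : List Item :=
  match acc with
  | [] => [a]
  | b :: t => if a.1 = b.1 then (a.1, vadd a.2 b.2) :: t else a :: b :: t

theorem mergeStep_hasDims {r m : ℕ} {acc : List Item} {a : Item} (h : HasDims r m acc)
    (ha : a.1.length = r ∧ a.2.length = m) : HasDims r m (mergeStep acc a) := by
  cases acc with
  | nil => simpa [mergeStep, HasDims] using ha
  | cons b t =>
    have hb := h b (by simp)
    have ht : HasDims r m t := fun p hp => h p (by simp [hp])
    rw [mergeStep]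
    split_ifs
    · intro p hp
      rcases List.mem_cons.1 hp with rfl | hp
      · exact ⟨ha.1, by simp [vadd, ha.2, hb.2]⟩
      · exact ht p hp
    · intro p hp
      rcases List.mem_cons.1 hp with rfl | hp
      · exact ha
      · exact h p hp

/-- Collect the items of a list by key: sort by key and merge neighbours with the same key. -/
def aggregate (r : ℕ) (l : List Item) : List Item :=
  ((radixPass^[r] (l.map fun p => (p.1, p))).map Prod.snd).foldl mergeStep []

/-- Program for `mergeStep`. -/
def mergeStepP : Prog :=
  .cond (.tail ▷ .tail)
    (.cond (.cons (.tail ▷ .head ▷ .head) (.tail ▷ .tail ▷ .head ▷ .head) ▷ eqP)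
      (.cons (.cons (.tail ▷ .head ▷ .head)
        (.cons (.tail ▷ .head ▷ .tail) (.tail ▷ .tail ▷ .head ▷ .tail) ▷ vaddP))
        (.tail ▷ .tail ▷ .tail))
      .tail)
    (.cons (.tail ▷ .head) .nil)

theorem mergeStepP_spec : ∃ c, IsPoly c ∧ ∀ (M W r m : ℕ) (env : Data) (acc : List Item) (a : Item),
    W ≤ M → r ≤ M → m ≤ M → HasDims r m acc → a.1.length = r ∧ a.2.length = m →
    Does mergeStepP (.cons env (.cons (encItem W a) (encItems W acc)))
      (encItems W (mergeStep acc a)) (c M) := by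
  obtain ⟨c₁, hc₁, h₁⟩ := eqP_spec
  obtain ⟨c₂, hc₂, h₂⟩ := vaddP_spec
  refine ⟨fun M => c₁ M + c₂ M + 200, by fun_prop, fun M W r m env acc a hW hr hm hacc ha => ?_⟩
  cases acc with
  | nil =>
    refine Does.mono (Does.cond_false (Does.free rfl rfl) (Does.free rfl rfl)) ?_
    simp only [Prog.sz]
    omega
  | cons b t =>
    have hb := hacc b (by simp)
    refine Does.mono (Does.cond_true (u := encItem W b) (v := encItems W t) (Does.free rfl rfl)
      (Does.ite (T := c₂ M + 60)
      (Does.call rfl (h₁ M a.1 b.1 (by omega) (by omega))) (fun h => ?_) (fun h => ?_))) ?_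
    · rw [mergeStep, if_pos (of_decide_eq_true h)]
      refine Does.mono (Does.cons (Does.cons (Does.free rfl rfl)
        (Does.call rfl (h₂ M W a.2 b.2 hW (by omega) (by omega)))) (Does.free rfl rfl)) ?_
      simp only [Prog.sz]
      omega
    · rw [mergeStep, if_neg (of_decide_eq_false h)]
      exact Does.mono (Does.free rfl rfl) (by simp only [Prog.sz]; omega)
    · simp only [Prog.sz]
      omega

theorem iterate_radixPass_subset {α : Type} (m : ℕ) (l : List (List Bool × α)) :
    ∀ p ∈ radixPass^[m] l, ∃ q ∈ l, q.2 = p.2 := by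
  induction m generalizing l with
  | zero => exact fun p hp => ⟨p, hp, rfl⟩
  | succ m ih =>
    intro p hp
    rw [Function.iterate_succ_apply] at hp
    obtain ⟨q, hq, hqp⟩ := ih _ p hp
    simp only [radixPass, List.mem_append, List.mem_map, List.mem_filter] at hq
    rcases hq with ⟨s, hs, rfl⟩ | ⟨s, hs, rfl⟩
    · exact ⟨s, hs.1, hqp⟩
    · exact ⟨s, hs.1, hqp⟩

/-- Program for `aggregate`: the input is the length of the keys in unary and the list. -/
def aggregateP : Prog :=
  .cons .head (.cons .nil .tail ▷ mapP (.cons (.tail ▷ .head) .tail)) ▷ radixP ▷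
    .cons .nil .id ▷ mapP (.tail ▷ .tail) ▷ .cons .nil (.cons .nil .id) ▷ foldP mergeStepP

theorem aggregateP_spec : ∃ c, IsLin c ∧ ∀ (M N : ℕ), 1 ≤ N → ∀ (W r m : ℕ) (l : List Item),
    W ≤ M → r ≤ M → m ≤ M → l.length ≤ N → HasDims r m l →
    Does aggregateP (.cons (un r) (encItems W l)) (encItems W (aggregate r l)) (c M N) := by
  obtain ⟨c₁, hc₁, h₁⟩ := radixP_spec
  obtain ⟨c₂, hc₂, h₂⟩ := mergeStepP_spec
  apply Exists.intro
  apply And.intro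
  case right =>
    intro M N hN W r m l hW hr hm hl hd
    have e1 := Does.map (encA := encItem W) (encB := encPair encBits (encItem W)) (env := .nil)
      (f := fun p : Item => (p.1, p)) (l := l) (p := .cons (.tail ▷ .head) .tail) (T := 10)
      hl (fun a _ => Does.mono (Does.free rfl rfl) (by decide))
    have e2 := h₁ M N hN r Item (encItem W) (l.map fun p => (p.1, p)) hr (by simpa)
    have e3 := Does.map (encA := encPair encBits (encItem W)) (encB := encItem W) (env := .nil)
      (f := Prod.snd) (l := radixPass^[r] (l.map fun p => (p.1, p)))
      (p := .tail ▷ .tail) (T := 10) (N := N)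
      (by simpa [length_iterate_radixPass] using hl)
      (fun a _ => Does.mono (Does.free rfl rfl) (by decide))
    have hd' : HasDims r m ((radixPass^[r] (l.map fun p => (p.1, p))).map Prod.snd) := by
      intro p hp
      obtain ⟨q, hq, rfl⟩ := List.mem_map.1 hp
      obtain ⟨s, hs, hsq⟩ := iterate_radixPass_subset _ _ q hq
      obtain ⟨t, ht, rfl⟩ := List.mem_map.1 hs
      rw [← hsq]
      exact hd t ht
    have e4 := Does.fold (encA := encItem W) (encB := encItems W) (env := .nil)
      (f := mergeStep) (b := []) (N := N)
      (l := (radixPass^[r] (l.map fun p => (p.1, p))).map Prod.snd)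
      (HasDims r m) (by simpa [length_iterate_radixPass] using hl) (fun p hp => by simp at hp)
      (fun b a ha hb => mergeStep_hasDims hb (hd' a ha))
      (fun b a ha hb => h₂ M W r m .nil b a hW hr hm hb (hd' a ha))
    exact Does.mono (Does.comp (Does.comp (Does.comp (Does.comp (Does.comp (Does.cons
      (Does.free rfl rfl) (Does.call rfl e1)) e2) (Does.free rfl rfl)) e3)
      (Does.free rfl rfl)) e4) le_rfl
  case left =>
    repeat' first
      | assumption
      | exact IsLin.self
      | exact IsLin.of_poly (by fun_prop)
      | refine IsLin.add ?_ ?_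
      | refine IsLin.poly_mul (by fun_prop) ?_
      | refine IsLin.mul_poly ?_ (by fun_prop)

/-- The first `k` elements of a list, in reverse order: the input is `k` in unary and the list. -/
def takeP : Prog :=
  .cons .nil (.cons (.cons .tail .nil) .head) ▷
    foldP (.cond (.tail ▷ .tail ▷ .head)
      (.cons (.tail ▷ .tail ▷ .head ▷ .tail)
        (.cons (.tail ▷ .tail ▷ .head ▷ .head) (.tail ▷ .tail ▷ .tail)))
      (.tail ▷ .tail)) ▷ .tail

theorem Does.take {α : Type} {encA : α → Data} {l : List α} {k N : ℕ} (hk : k ≤ N) :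
    Does takeP (.cons (un k) (encList encA l)) (encList encA (l.take k).reverse)
      (N * 100 + 50) := by
  have h := Does.fold (encA := encBool) (encB := encPair (encList encA) (encList encA))
    (f := fun (b : List α × List α) _ => match b.1 with
      | [] => b
      | a :: t => (t, a :: b.2)) (env := .nil) (b := (l, [])) (T := 60) (N := N)
    (l := List.replicate k false)
    (p := .cond (.tail ▷ .tail ▷ .head)
      (.cons (.tail ▷ .tail ▷ .head ▷ .tail)
        (.cons (.tail ▷ .tail ▷ .head ▷ .head) (.tail ▷ .tail ▷ .tail)))
      (.tail ▷ .tail)) (fun _ => True) (by simpa) trivial (fun _ _ _ _ => trivial)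
    (fun b a _ _ => by
      refine Does.mono (Does.free rfl ?_) (by decide : _ ≤ 60)
      rcases b with ⟨_ | ⟨c, t⟩, b⟩ <;> rfl)
  have e : ∀ (k : ℕ) (l acc : List α), (List.replicate k false).foldl
      (fun (b : List α × List α) _ => match b.1 with
        | [] => b
        | a :: t => (t, a :: b.2)) (l, acc) = (l.drop k, (l.take k).reverse ++ acc) := by
    intro k
    induction k with
    | zero => intro l acc; rfl
    | succ k ih =>
      intro l acc
      rw [List.replicate_succ, List.foldl_cons]
      cases l with
      | nil => simpa using ih [] acc
      | cons a l => simp [ih]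
  rw [e, List.append_nil] at h
  refine Does.mono (Does.comp (Does.call rfl h) (Does.free rfl rfl)) ?_
  simp only [Prog.sz]
  omega

/-- The `k` items with the largest first entries in absolute value. -/
def topk (W k : ℕ) (l : List Item) : List Item :=
  (((radixPass^[W] (l.map fun p => (bz W (absW W (p.2.headD 0)), p))).take k).reverse).map Prod.snd

/-- Program for `topk`: the input is `(k, W, l)`, the numbers in unary. -/
def topkP : Prog :=
  .cons .head (.cons (.tail ▷ .head) (.cons .nil (.tail ▷ .tail) ▷
    mapP (.cons (.tail ▷ .tail ▷ .head ▷ absP) .tail)) ▷ radixP) ▷ takeP ▷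
    .cons .nil .id ▷ mapP (.tail ▷ .tail)

theorem topkP_spec : ∃ c, IsLin c ∧ ∀ (M N : ℕ), 1 ≤ N → ∀ (W r k : ℕ) (l : List Item),
    W ≤ M → k ≤ N → l.length ≤ N → HasDims r 1 l →
    Does topkP (.cons (un k) (.cons (un W) (encItems W l))) (encItems W (topk W k l))
      (c M N) := by
  obtain ⟨c₁, hc₁, h₁⟩ := radixP_spec
  obtain ⟨c₂, hc₂, h₂⟩ := absP_spec
  apply Exists.intro
  apply And.intro
  case right =>
    intro M N hN W r k l hW hk hl hd
    have e1 := Does.map (encA := encItem W) (encB := encPair encBits (encItem W)) (env := .nil)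
      (f := fun p : Item => (bz W (absW W (p.2.headD 0)), p)) (l := l)
      (p := .cons (.tail ▷ .tail ▷ .head ▷ absP) .tail) (T := c₂ M + 10)
      hl (fun a ha => by
        refine Does.mono (Does.cons (Does.call (a := .tail ▷ .tail ▷ .head) rfl ?_)
          (Does.free (p := .tail) rfl rfl)) (?_ : _ + c₂ M + 1 + _ + 1 ≤ _)
        · have hv := (hd a ha).2
          rcases a with ⟨k, _ | ⟨v, t⟩⟩
          · simp at hv
          · exact h₂ M W v hW
        · simp only [Prog.sz]; omega)
    have e2 := h₁ M N hN W Item (encItem W)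
      (l.map fun p => (bz W (absW W (p.2.headD 0)), p)) hW (by simpa)
    have e3 := Does.take (encA := encPair encBits (encItem W)) (k := k) (N := N)
      (l := radixPass^[W] (l.map fun p => (bz W (absW W (p.2.headD 0)), p))) hk
    have e4 := Does.map (encA := encPair encBits (encItem W)) (encB := encItem W) (env := .nil)
      (f := Prod.snd)
      (l := ((radixPass^[W] (l.map fun p => (bz W (absW W (p.2.headD 0)), p))).take k).reverse)
      (p := .tail ▷ .tail) (T := 10) (N := N)
      (by simp; omega)
      (fun a _ => Does.mono (Does.free rfl rfl) (by decide))
    exact Does.mono (Does.comp (Does.comp (Does.comp (Does.cons (Does.free rfl rfl)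
      (Does.comp (Does.cons (Does.free rfl rfl) (Does.call rfl e1)) e2)) e3)
      (Does.free rfl rfl)) e4) le_rfl
  case left =>
    repeat' first
      | assumption
      | exact IsLin.self
      | exact IsLin.of_poly (by fun_prop)
      | refine IsLin.add ?_ ?_
      | refine IsLin.poly_mul (by fun_prop) ?_
      | refine IsLin.mul_poly ?_ (by fun_prop)

/-! ### Correctness of sorting and aggregation -/

/-- The number with given binary digits, least significant digit first. -/
def valB : List Bool → ℕ
  | [] => 0
  | b :: l => b.toNat + 2 * valB l

theorem valB_lt (l : List Bool) : valB l < 2 ^ l.length := by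
  induction l with
  | nil => simp [valB]
  | cons b l ih =>
    have := Bool.toNat_le b
    simp only [valB, List.length_cons, pow_succ]
    omega

theorem valB_injective {u v : List Bool} (h : u.length = v.length) (h' : valB u = valB v) :
    u = v := by
  induction u generalizing v with
  | nil => cases v <;> simp_all
  | cons a u ih =>
    cases v with
    | nil => simp at h
    | cons b v =>
      simp only [valB] at h'
      have ha := Bool.toNat_le a
      have hb := Bool.toNat_le b
      have hab : a.toNat = b.toNat := by omega
      have hab' : a = b := by cases a <;> cases b <;> simp_all
      rw [ih (by simpa using h) (by omega), hab']

theorem valB_take_succ (l : List Bool) (j : ℕ) :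
    valB (l.take (j + 1)) = valB (l.take j) + 2 ^ j * ((l.drop j).headD false).toNat := by
  induction l generalizing j with
  | nil => simp [valB]
  | cons b l ih =>
    cases j with
    | zero => simp [valB]
    | succ j =>
      have := ih j
      simp only [List.take_succ_cons, valB, List.drop_succ_cons] at this ⊢
      rw [this]
      ring

theorem radixPass_perm {α : Type} (l : List (List Bool × α)) :
    ((radixPass l).map Prod.snd).Perm (l.map Prod.snd) := by
  have h := (List.filter_append_perm (fun p : List Bool × α => p.1.headD false) l).map Prod.snd
  refine List.Perm.trans (List.Perm.of_eq ?_) h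
  simp only [radixPass, List.map_append, List.map_map]
  rfl

theorem iterate_radixPass_perm {α : Type} (m : ℕ) (l : List (List Bool × α)) :
    ((radixPass^[m] l).map Prod.snd).Perm (l.map Prod.snd) := by
  induction m generalizing l with
  | zero => rfl
  | succ m ih =>
    rw [Function.iterate_succ_apply]
    exact (ih _).trans (radixPass_perm l)

/-- After `j` passes the list is sorted, in descending order, by the `j` low-order bits. -/
theorem iterate_radixPass_sorted {α : Type} (key : α → List Bool) (l : List (List Bool × α))
    (hl : ∀ p ∈ l, p.1 = key p.2) (j : ℕ) :
    (∀ p ∈ radixPass^[j] l, p.1 = (key p.2).drop j) ∧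
      (radixPass^[j] l).Pairwise fun a b =>
        valB ((key b.2).take j) ≤ valB ((key a.2).take j) := by
  induction j with
  | zero => exact ⟨by simpa using hl, by simp [List.pairwise_iff_forall_sublist]⟩
  | succ j ih =>
    obtain ⟨h1, h2⟩ := ih
    rw [Function.iterate_succ_apply']
    generalize radixPass^[j] l = l' at h1 h2
    refine ⟨fun p hp => ?_, ?_⟩
    · have aux : ∀ q ∈ l', q.1.tail = (key q.2).drop (j + 1) := fun q hq => by
        rw [h1 q hq, List.tail_drop]
      simp only [radixPass, List.mem_append, List.mem_map, List.mem_filter] at hp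
      rcases hp with ⟨q, ⟨hq, _⟩, rfl⟩ | ⟨q, ⟨hq, _⟩, rfl⟩ <;> exact aux q hq
    · have same : ∀ c : Bool, (l'.filter fun p => p.1.headD false == c).Pairwise fun a b =>
          valB ((key b.2).take (j + 1)) ≤ valB ((key a.2).take (j + 1)) := by
        intro c
        refine ((h2.filter _).imp_of_mem ?_)
        intro a b ha hb hab
        simp only [List.mem_filter, beq_iff_eq] at ha hb
        rw [valB_take_succ, valB_take_succ, ← h1 a ha.1, ← h1 b hb.1, ha.2, hb.2]
        omega
      have s1 := same true
      have s0 := same false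
      simp only [beq_true, beq_false] at s1 s0
      rw [radixPass, List.pairwise_append]
      refine ⟨List.pairwise_map.2 s1, List.pairwise_map.2 s0, ?_⟩
      intro a ha b hb
      simp only [List.mem_map, List.mem_filter, Bool.not_eq_true'] at ha hb
      obtain ⟨a, ⟨ha, ha'⟩, rfl⟩ := ha
      obtain ⟨b, ⟨hb, hb'⟩, rfl⟩ := hb
      simp only
      rw [valB_take_succ, valB_take_succ, ← h1 a ha, ← h1 b hb, ha', hb']
      have := valB_lt ((key b.2).take j)
      have h2j : 2 ^ ((key b.2).take j).length ≤ 2 ^ j :=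
        Nat.pow_le_pow_right (by norm_num) (by simp)
      simp only [Bool.toNat_true, Bool.toNat_false]
      omega

theorem radixSort_sorted {α : Type} (key : α → List Bool) (m : ℕ) (l : List α)
    (hl : ∀ a ∈ l, (key a).length = m) :
    ((radixPass^[m] (l.map fun a => (key a, a))).map Prod.snd).Pairwise fun a b =>
      valB (key b) ≤ valB (key a) := by
  have h := iterate_radixPass_sorted key (l.map fun a => (key a, a)) (by simp) m
  rw [List.pairwise_map]
  refine h.2.imp_of_mem ?_
  intro a b ha hb hab
  have aux : ∀ p ∈ radixPass^[m] (l.map fun a => (key a, a)), (key p.2).take m = key p.2 := by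
    intro p hp
    obtain ⟨q, hq, hqp⟩ := iterate_radixPass_subset _ _ p hp
    obtain ⟨s, hs, rfl⟩ := List.mem_map.1 hq
    rw [List.take_of_length_le]
    rw [← hqp, hl s hs]
  rwa [aux a ha, aux b hb] at hab

theorem radixSort_perm {α : Type} (key : α → List Bool) (m : ℕ) (l : List α) :
    ((radixPass^[m] (l.map fun a => (key a, a))).map Prod.snd).Perm l := by
  refine (iterate_radixPass_perm _ _).trans (List.Perm.of_eq ?_)
  simp [List.map_map, Function.comp_def]

/-- The `b`-th entry of the vector that a list of items describes at a key. -/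
def evalAt (l : List Item) (k : List Bool) (b : ℕ) : ℤ :=
  (l.map fun p => if p.1 = k then p.2.getD b 0 else 0).sum

@[simp] theorem evalAt_nil (k : List Bool) (b : ℕ) : evalAt [] k b = 0 := rfl

@[simp] theorem evalAt_cons (p : Item) (l : List Item) (k : List Bool) (b : ℕ) :
    evalAt (p :: l) k b = (if p.1 = k then p.2.getD b 0 else 0) + evalAt l k b := by
  simp [evalAt]

@[simp] theorem evalAt_append (l l' : List Item) (k : List Bool) (b : ℕ) :
    evalAt (l ++ l') k b = evalAt l k b + evalAt l' k b := by
  simp [evalAt]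

theorem evalAt_perm {l l' : List Item} (h : l.Perm l') (k : List Bool) (b : ℕ) :
    evalAt l k b = evalAt l' k b := (h.map _).sum_eq

theorem getD_vadd (u v : List ℤ) (h : u.length = v.length) (b : ℕ) :
    (vadd u v).getD b 0 = u.getD b 0 + v.getD b 0 := by
  induction u generalizing v b with
  | nil => cases v <;> simp_all [vadd]
  | cons a u ih =>
    cases v with
    | nil => simp at h
    | cons c v =>
      cases b with
      | zero => simp [vadd]
      | succ b => simpa [vadd] using ih v (by simpa using h) b

theorem evalAt_mergeStep {r m : ℕ} {acc : List Item} {a : Item} (h : HasDims r m acc)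
    (ha : a.1.length = r ∧ a.2.length = m) (k : List Bool) (b : ℕ) :
    evalAt (mergeStep acc a) k b = evalAt (a :: acc) k b := by
  cases acc with
  | nil => rfl
  | cons c t =>
    have hc := h c (by simp)
    rw [mergeStep]
    split_ifs with hac
    · rw [evalAt_cons, evalAt_cons, evalAt_cons, getD_vadd _ _ (ha.2.trans hc.2.symm), hac]
      split_ifs <;> ring
    · rfl

theorem HasDims.perm {r m : ℕ} {l l' : List Item} (h : HasDims r m l) (hp : l'.Perm l) :
    HasDims r m l' := fun p hp' => h p (hp.subset hp')

theorem foldl_mergeStep {r m : ℕ} (l acc : List Item) (hl : HasDims r m l)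
    (hacc : HasDims r m acc) : HasDims r m (l.foldl mergeStep acc) ∧
      (l.foldl mergeStep acc).length ≤ l.length + acc.length ∧
      ∀ k b, evalAt (l.foldl mergeStep acc) k b = evalAt l k b + evalAt acc k b := by
  induction l generalizing acc with
  | nil => exact ⟨hacc, by simp, by simp⟩
  | cons a l ih =>
    have ha := hl a (by simp)
    obtain ⟨h1, h2, h3⟩ := ih (mergeStep acc a) (fun p hp => hl p (by simp [hp]))
      (mergeStep_hasDims hacc ha)
    have hlen : (mergeStep acc a).length ≤ acc.length + 1 := by
      cases acc with
      | nil => simp [mergeStep]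
      | cons c t => rw [mergeStep]; split_ifs <;> simp
    refine ⟨h1, ?_, fun k b => ?_⟩
    · simp only [List.foldl_cons, List.length_cons]
      omega
    · rw [List.foldl_cons, h3, evalAt_mergeStep hacc ha, evalAt_cons, evalAt_cons]
      ring

/-- Merging a sorted list leaves at most one item per key. -/
theorem foldl_mergeStep_sorted {r m : ℕ} (l acc : List Item) (hl : HasDims r m l)
    (hacc : HasDims r m acc) (hs : l.Pairwise fun a b => valB b.1 ≤ valB a.1)
    (hs' : acc.Pairwise fun a b => valB a.1 < valB b.1)
    (hh : ∀ a ∈ l, ∀ b ∈ acc, valB a.1 ≤ valB b.1) :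
    (l.foldl mergeStep acc).Pairwise fun a b => valB a.1 < valB b.1 := by
  induction l generalizing acc with
  | nil => exact hs'
  | cons a l ih =>
    have ha := hl a (by simp)
    rw [List.pairwise_cons] at hs
    have hl' : HasDims r m l := fun p hp => hl p (by simp [hp])
    refine ih _ hl' (mergeStep_hasDims hacc ha) hs.2 ?_ ?_
    · cases acc with
      | nil => simp [mergeStep]
      | cons b t =>
        have hb := hacc b (by simp)
        rw [List.pairwise_cons] at hs'
        rw [mergeStep]
        split_ifs with hab
        · rw [List.pairwise_cons]
          exact ⟨by simpa [hab] using hs'.1, hs'.2⟩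
        · have hlt : valB a.1 < valB b.1 := lt_of_le_of_ne (hh a (by simp) b (by simp))
            fun h => hab (valB_injective (ha.1.trans hb.1.symm) h)
          rw [List.pairwise_cons, List.pairwise_cons]
          refine ⟨fun c hc => ?_, hs'⟩
          rcases List.mem_cons.1 hc with rfl | hc
          · exact hlt
          · exact hlt.trans (hs'.1 c hc)
    · intro c hc b hb
      have hca := hs.1 c hc
      cases acc with
      | nil =>
        simp only [mergeStep, List.mem_singleton] at hb
        rwa [hb]
      | cons d t =>
        rw [mergeStep] at hb
        split_ifs at hb with had
        · rcases List.mem_cons.1 hb with rfl | hb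
          · exact hca
          · exact hh c (by simp [hc]) b (by simp [hb])
        · rcases List.mem_cons.1 hb with rfl | hb
          · exact hca
          · exact hh c (by simp [hc]) b hb

section aggregate

variable {r m : ℕ} {l : List Item}

theorem aggregate_hasDims (h : HasDims r m l) : HasDims r m (aggregate r l) :=
  (foldl_mergeStep _ _ (h.perm (radixSort_perm (fun p : Item => p.1) r l))
    (fun p hp => by simp at hp)).1

theorem length_aggregate_le (h : HasDims r m l) : (aggregate r l).length ≤ l.length := by
  have hp := radixSort_perm (fun p : Item => p.1) r l
  have := (foldl_mergeStep _ [] (h.perm hp) (fun p hp => by simp at hp)).2.1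
  rw [hp.length_eq] at this
  exact this

theorem evalAt_aggregate (h : HasDims r m l) (k : List Bool) (b : ℕ) :
    evalAt (aggregate r l) k b = evalAt l k b := by
  have hp := radixSort_perm (fun p : Item => p.1) r l
  have := (foldl_mergeStep _ [] (h.perm hp) (fun p hp => by simp at hp)).2.2 k b
  rw [evalAt_perm hp, evalAt_nil, add_zero] at this
  exact this

theorem aggregate_pairwise (h : HasDims r m l) :
    (aggregate r l).Pairwise fun a b => valB a.1 < valB b.1 :=
  foldl_mergeStep_sorted _ _ (h.perm (radixSort_perm (fun p : Item => p.1) r l))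
    (fun p hp => by simp at hp)
    (radixSort_sorted (fun p : Item => p.1) r l fun p hp => (h p hp).1) .nil (by simp)

theorem aggregate_nodup (h : HasDims r m l) : ((aggregate r l).map Prod.fst).Nodup := by
  rw [List.Nodup, List.pairwise_map]
  exact (aggregate_pairwise h).imp fun {a b} hab hne => by rw [hne] at hab; exact lt_irrefl _ hab

theorem length_aggregate_le_two_pow (h : HasDims r m l) : (aggregate r l).length ≤ 2 ^ r := by
  have h1 : ((aggregate r l).map fun p => valB p.1).Nodup := by
    rw [List.Nodup, List.pairwise_map]
    exact (aggregate_pairwise h).imp fun hab => hab.ne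
  have h2 := List.toFinset_card_of_nodup h1
  rw [List.length_map] at h2
  rw [← h2, ← Finset.card_range (2 ^ r)]
  refine Finset.card_le_card fun v hv => ?_
  simp only [List.mem_toFinset, List.mem_map] at hv
  obtain ⟨p, hp, rfl⟩ := hv
  rw [Finset.mem_range, ← (aggregate_hasDims h p hp).1]
  exact valB_lt _

end aggregate

/-- The finite set of bit strings of a given length. -/
def keys : ℕ → Finset (List Bool)
  | 0 => {[]}
  | n + 1 => (keys n).image (List.cons false) ∪ (keys n).image (List.cons true)

@[simp] theorem mem_keys {n : ℕ} {k : List Bool} : k ∈ keys n ↔ k.length = n := by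
  induction n generalizing k with
  | zero => simp [keys]
  | succ n ih =>
    simp only [keys, Finset.mem_union, Finset.mem_image, ih]
    cases k with
    | nil => simp
    | cons b k => cases b <;> simp

theorem sum_keys_succ {β : Type} [AddCommMonoid β] (n : ℕ) (f : List Bool → β) :
    ∑ k ∈ keys (n + 1), f k = ∑ k ∈ keys n, (f (false :: k) + f (true :: k)) := by
  rw [keys, Finset.sum_union, Finset.sum_image, Finset.sum_image, Finset.sum_add_distrib]
  · exact fun _ _ _ _ h => (List.cons.inj h).2
  · exact fun _ _ _ _ h => (List.cons.inj h).2
  · rw [Finset.disjoint_left]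
    intro k h h'
    simp only [Finset.mem_image] at h h'
    obtain ⟨a, _, rfl⟩ := h
    obtain ⟨b, _, hb⟩ := h'
    simp at hb

theorem card_keys (n : ℕ) : (keys n).card = 2 ^ n := by
  induction n with
  | zero => rfl
  | succ n ih =>
    have := sum_keys_succ n (fun _ => 1)
    rw [Finset.sum_const, Finset.sum_const, ih] at this
    simp only [smul_eq_mul, mul_one] at this
    rw [this]
    ring

/-- A sum over items with distinct keys is a sum over keys. -/
theorem sum_map_eq_sum_keys {r m : ℕ} {l : List Item} (h : HasDims r m l)
    (hn : (l.map Prod.fst).Nodup) (b : ℕ) (g : List Bool → ℤ → ℤ)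
    (hg : ∀ k, g k 0 = 0) :
    (l.map fun p => g p.1 (p.2.getD b 0)).sum = ∑ k ∈ keys r, g k (evalAt l k b) := by
  induction l with
  | nil => simp [hg]
  | cons p l ih =>
    rw [List.map_cons, List.nodup_cons] at hn
    have hp := h p (by simp)
    have hz : evalAt l p.1 b = 0 := by
      have : ∀ q ∈ l, q.1 ≠ p.1 := fun q hq hqp => hn.1 (hqp ▸ List.mem_map_of_mem hq)
      unfold evalAt
      refine List.sum_eq_zero fun x hx => ?_
      obtain ⟨q, hq, rfl⟩ := List.mem_map.1 hx
      rw [if_neg (this q hq)]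
    rw [List.map_cons, List.sum_cons, ih (fun q hq => h q (by simp [hq])) hn.2,
      ← Finset.add_sum_erase _ _ (mem_keys.2 hp.1),
      ← Finset.add_sum_erase (keys r) (fun k => g k (evalAt (p :: l) k b)) (mem_keys.2 hp.1), hz, hg,
      evalAt_cons, if_pos rfl, hz, zero_add, add_zero]
    congr 1
    refine Finset.sum_congr rfl fun k hk => ?_
    rw [evalAt_cons, if_neg (Ne.symm (Finset.ne_of_mem_erase hk)), zero_add]

/-- If the keys are distinct, every item holds the value at its key. -/
theorem evalAt_of_mem {l : List Item} (hn : (l.map Prod.fst).Nodup) {p : Item} (hp : p ∈ l)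
    (b : ℕ) : evalAt l p.1 b = p.2.getD b 0 := by
  induction l with
  | nil => simp at hp
  | cons q l ih =>
    rw [List.map_cons, List.nodup_cons] at hn
    rw [evalAt_cons]
    rcases List.mem_cons.1 hp with rfl | hp
    · rw [if_pos rfl, add_eq_left]
      refine List.sum_eq_zero fun x hx => ?_
      obtain ⟨q, hq, rfl⟩ := List.mem_map.1 hx
      rw [if_neg]
      exact fun h => hn.1 (h ▸ List.mem_map_of_mem hq)
    · rw [ih hn.2 hp, if_neg, zero_add]
      exact fun h => hn.1 (h ▸ List.mem_map_of_mem hp)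

/-- A list of items vanishes at keys that do not occur in it. -/
theorem evalAt_of_notMem {l : List Item} {k : List Bool} (hk : k ∉ l.map Prod.fst) (b : ℕ) :
    evalAt l k b = 0 := by
  refine List.sum_eq_zero fun x hx => ?_
  obtain ⟨q, hq, rfl⟩ := List.mem_map.1 hx
  rw [if_neg]
  rintro rfl
  exact hk (List.mem_map_of_mem hq)

/-! ### The recovery procedure -/

/-- The zero vector over `𝔽₂`. -/
abbrev zeros (r : ℕ) : List Bool := List.replicate r false

/-- The value at `i` of the linear map whose matrix has the given columns; `z` is the zero vector
of the target space. -/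
def hashB (z : List Bool) (cols : List (List Bool)) (i : List Bool) : List Bool :=
  (cols.zip i).foldl (fun acc p => if p.2 then vxor acc p.1 else acc) z

/-- Encoding of a matrix by its columns. -/
abbrev encCols (cols : List (List Bool)) : Data := encList encBits cols

/-- Program for `hashB`: the input is `(z, cols, i)`. -/
def hashP : Prog :=
  .cons .nil (.cons .head (.tail ▷ zipP)) ▷
    foldP (.cond (.tail ▷ .head ▷ .tail) (.cons (.tail ▷ .tail) (.tail ▷ .head ▷ .head) ▷ vxorP)
      (.tail ▷ .tail))

theorem length_foldl_vxor {r : ℕ} (l : List (List Bool × Bool)) (z : List Bool)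
    (hl : ∀ p ∈ l, p.1.length = r) (hz : z.length = r) :
    (l.foldl (fun acc p => if p.2 then vxor acc p.1 else acc) z).length = r := by
  induction l generalizing z with
  | nil => exact hz
  | cons p l ih =>
    refine ih _ (fun q hq => hl q (by simp [hq])) ?_
    have := hl p (by simp)
    dsimp only
    split_ifs <;> simp [vxor, hz, this]

theorem length_hashB {r : ℕ} {z : List Bool} {cols : List (List Bool)} {i : List Bool}
    (hz : z.length = r) (hc : ∀ c ∈ cols, c.length = r) : (hashB z cols i).length = r :=
  length_foldl_vxor _ _ (fun p hp => hc p.1 (List.of_mem_zip hp).1) hz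

theorem hashP_spec : ∃ c, IsPoly c ∧ ∀ (M r : ℕ) (z : List Bool) (cols : List (List Bool))
    (i : List Bool), r ≤ M → cols.length ≤ M → z.length = r → (∀ c ∈ cols, c.length = r) →
    cols.length = i.length →
    Does hashP (.cons (encBits z) (.cons (encCols cols) (encBits i)))
      (encBits (hashB z cols i)) (c M) := by
  obtain ⟨c₁, hc₁, h₁⟩ := vxorP_spec
  apply Exists.intro
  apply And.intro
  case right =>
    intro M r z cols i hr hM hz hc hl
    have e1 := Does.zip (encA := encBits) (encB := encBool) hM hl.le
    have e2 := Does.fold (encA := encPair encBits encBool) (encB := encBits) (env := .nil)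
      (f := fun acc (p : List Bool × Bool) => if p.2 then vxor acc p.1 else acc) (b := z)
      (l := cols.zip i) (N := M) (T := c₁ M + 50)
      (p := .cond (.tail ▷ .head ▷ .tail) (.cons (.tail ▷ .tail) (.tail ▷ .head ▷ .head) ▷ vxorP)
      (.tail ▷ .tail)) (fun b => b.length = r) (by simp; omega) hz
      (fun b a ha hb => by
        have := hc a.1 (List.of_mem_zip ha).1
        split_ifs <;> simp [vxor, hb, this])
      (fun b a ha hb => by
        have := hc a.1 (List.of_mem_zip ha).1
        refine Does.mono (Does.ite (b := a.2) (T := c₁ M + 20) (Does.free rfl rfl)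
          (fun h => ?_) (fun h => ?_)) ?_
        · rw [if_pos h]
          exact Does.mono (Does.call rfl (h₁ M b a.1 (by omega) (by omega)))
            (by simp only [Prog.sz]; omega)
        · rw [if_neg (by simp [h])]
          exact Does.mono (Does.free rfl rfl) (by simp only [Prog.sz]; omega)
        · simp only [Prog.sz]
          omega)
    exact Does.mono (Does.comp (Does.cons (Does.free rfl rfl) (Does.cons (Does.free rfl rfl)
      (Does.call rfl e1))) e2) le_rfl
  case left => fun_prop

/-- What an entry `v` of the signal at the position `i` subtracts from the measurements: the bucket
of `i` loses `v` and, for every bit `b` of `i`, it loses `(-1) ^ b * v`. -/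
def contrib (r : ℕ) (cols : List (List Bool)) (p : Item) : Item :=
  (hashB (zeros r) cols p.1, (false :: p.1).map fun b => if b then p.2.headD 0 else -p.2.headD 0)

/-- Program for `contrib`: the input is `(r, cols, p)`. -/
def contribP : Prog :=
  .cons (.cons .head (.cons (.tail ▷ .head) (.tail ▷ .tail ▷ .head)) ▷ hashP)
    (.cons (.cons (.tail ▷ .tail ▷ .tail ▷ .head) (.tail ▷ .tail ▷ .tail ▷ .head ▷ negP))
      (.cons .nil (.tail ▷ .tail ▷ .head)) ▷ mapP (.cond .tail (.head ▷ .head) (.head ▷ .tail)))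

/-- A matrix with `n` columns of length `r`. -/
def IsMat (n r : ℕ) (cols : List (List Bool)) : Prop :=
  cols.length = n ∧ ∀ c ∈ cols, c.length = r

theorem contribP_spec : ∃ c, IsPoly c ∧ ∀ (M W n r : ℕ) (cols : List (List Bool)) (p : Item),
    W ≤ M → n ≤ M → r ≤ M → IsMat n r cols → p.1.length = n ∧ p.2.length = 1 →
    Does contribP (.cons (un r) (.cons (encCols cols) (encItem W p)))
      (encItem W (contrib r cols p)) (c M) := by
  obtain ⟨c₁, hc₁, h₁⟩ := hashP_spec
  obtain ⟨c₂, hc₂, h₂⟩ := negP_spec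
  apply Exists.intro
  apply And.intro
  case right =>
    intro M W n r cols p hW hn hr hc hp
    rcases p with ⟨i, _ | ⟨v, _ | ⟨_, _⟩⟩⟩
    · simp at hp
    · have e1 := h₁ M r (zeros r) cols i hr (by rw [hc.1]; exact hn) (by simp) hc.2
        (by rw [hc.1, hp.1])
      have e2 := Does.map (encA := encBool) (encB := encZ W)
        (f := fun b => if b then v else -v) (l := false :: i) (N := M + 1) (T := 20)
        (env := .cons (encZ W v) (encZ W (-v)))
        (p := .cond .tail (.head ▷ .head) (.head ▷ .tail))
        (by have := hp.1; simp at this ⊢; omega)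
        (fun a _ => by
          refine Does.mono (Does.free rfl ?_) (by decide : _ ≤ 20)
          cases a <;> rfl)
      exact Does.mono (Does.cons (Does.call rfl e1) (Does.comp (Does.cons (Does.cons
        (Does.free (y := encZ W v) rfl rfl) (Does.call rfl (h₂ M W v hW))) (Does.free rfl rfl)) e2))
        le_rfl
    · simp at hp
  case left => fun_prop

theorem contrib_hasDims {n r : ℕ} {cols : List (List Bool)} {p : Item} (hc : IsMat n r cols)
    (hp : p.1.length = n) :
    (contrib r cols p).1.length = r ∧ (contrib r cols p).2.length = n + 1 :=
  ⟨length_hashB (by simp) hc.2, by simp [contrib, hp]⟩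

/-- A matrix together with measurements. -/
abbrev Meas : Type := List (List Bool) × List Item

/-- Encoding of matrices with measurements. -/
abbrev encMeas (W : ℕ) : Meas → Data := encPair encCols (encItems W)

/-- The measurements of the difference of the signal and `x`. -/
def resid (r : ℕ) (m : Meas) (x : List Item) : List Item :=
  aggregate r (x.foldl (fun acc p => contrib r m.1 p :: acc) m.2)

/-- Program for `resid`: the input is `(r, m, x)`. -/
def residP : Prog :=
  .cons .head (.cons (.cons .head (.tail ▷ .head ▷ .head))
    (.cons (.tail ▷ .head ▷ .tail) (.tail ▷ .tail)) ▷
    foldP (.cons (.cons (.head ▷ .head) (.cons (.head ▷ .tail) (.tail ▷ .head)) ▷ contribP)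
      (.tail ▷ .tail))) ▷ aggregateP

/-- The dimensions of a matrix with measurements. -/
def IsMeas (n r N : ℕ) (m : Meas) : Prop :=
  IsMat n r m.1 ∧ HasDims r (n + 1) m.2 ∧ m.2.length ≤ N

/-- The dimensions of a list of entries of a signal. -/
def IsSig (n N : ℕ) (x : List Item) : Prop := HasDims n 1 x ∧ x.length ≤ N

theorem foldl_cons_map {α β : Type} (f : α → β) (l : List α) (acc : List β) :
    l.foldl (fun acc p => f p :: acc) acc = (l.map f).reverse ++ acc := by
  induction l generalizing acc with
  | nil => rfl
  | cons a l ih => simp [ih]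

theorem foldl_contrib {n r N : ℕ} {m : Meas} {x : List Item} (hm : IsMeas n r N m)
    (hx : IsSig n N x) :
    HasDims r (n + 1) (x.foldl (fun acc p => contrib r m.1 p :: acc) m.2) ∧
      (x.foldl (fun acc p => contrib r m.1 p :: acc) m.2).length ≤ 2 * N := by
  rw [foldl_cons_map]
  refine ⟨fun p hp => ?_, ?_⟩
  · simp only [List.mem_append, List.mem_reverse, List.mem_map] at hp
    rcases hp with ⟨q, hq, rfl⟩ | hp
    · exact contrib_hasDims hm.1 (hx.1 q hq).1
    · exact hm.2.1 p hp
  · have := hm.2.2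
    have := hx.2
    simp
    omega

theorem resid_hasDims {n r N : ℕ} {m : Meas} {x : List Item} (hm : IsMeas n r N m)
    (hx : IsSig n N x) : HasDims r (n + 1) (resid r m x) ∧ (resid r m x).length ≤ 2 * N :=
  ⟨aggregate_hasDims (foldl_contrib hm hx).1,
    (length_aggregate_le (foldl_contrib hm hx).1).trans (foldl_contrib hm hx).2⟩

theorem residP_spec : ∃ c, IsLin c ∧ ∀ (M N : ℕ), 1 ≤ N → ∀ (W n r : ℕ) (m : Meas)
    (x : List Item), W ≤ M → n + 1 ≤ M → r ≤ M → IsMeas n r N m → IsSig n N x →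
    Does residP (.cons (un r) (.cons (encMeas W m) (encItems W x)))
      (encItems W (resid r m x)) (c M N) := by
  obtain ⟨c₁, hc₁, h₁⟩ := contribP_spec
  obtain ⟨c₂, hc₂, h₂⟩ := aggregateP_spec
  have hc₂' := hc₂.mul_const (a := 2) (by norm_num)
  apply Exists.intro
  apply And.intro
  case right =>
    intro M N hN W n r m x hW hn hr hm hx
    have e1 := Does.fold (encA := encItem W) (encB := encItems W)
      (f := fun acc p => contrib r m.1 p :: acc) (b := m.2) (l := x) (N := N)
      (env := .cons (un r) (encCols m.1)) (p := .cons (.cons (.head ▷ .head)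
        (.cons (.head ▷ .tail) (.tail ▷ .head)) ▷ contribP) (.tail ▷ .tail)) (T := c₁ M + 40)
      (fun _ => True) hx.2 trivial
      (fun _ _ _ _ => trivial) (fun b a ha _ => by
        refine Does.mono (Does.cons (Does.call rfl
          (h₁ M W n r m.1 a hW (by omega) hr hm.1 (hx.1 a ha))) (Does.free rfl rfl)) ?_
        simp only [Prog.sz]
        omega)
    have e2 := h₂ M (2 * N) (by omega) W r (n + 1)
      (x.foldl (fun acc p => contrib r m.1 p :: acc) m.2) hW hr hn (foldl_contrib hm hx).2
      (foldl_contrib hm hx).1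
    exact Does.mono (Does.comp (Does.cons (Does.free rfl rfl) (Does.call rfl e1)) e2) le_rfl
  case left =>
    repeat' first
      | assumption
      | exact IsLin.self
      | exact IsLin.of_poly (by fun_prop)
      | refine IsLin.add ?_ ?_
      | refine IsLin.poly_mul (by fun_prop) ?_
      | refine IsLin.mul_poly ?_ (by fun_prop)

/-- Guess the position of the dominating entry of a bucket from the signs of its measurements. -/
def decodeItem (W : ℕ) (p : Item) : Item :=
  (p.2.tail.map fun f => msb W (p.2.headD 0) ^^ msb W f, [p.2.headD 0])

/-- Program for `decodeItem`: the input is an environment and an item. -/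
def decodeP : Prog :=
  .cons (.cons (.tail ▷ .tail ▷ .head ▷ msbP) (.tail ▷ .tail ▷ .tail) ▷
    mapP (.cons .head (.tail ▷ msbP) ▷ xorP .head .tail)) (.cons (.tail ▷ .tail ▷ .head) .nil)

theorem decodeP_spec : ∃ c, IsPoly c ∧ ∀ (M W r n : ℕ) (env : Data) (p : Item), W ≤ M → n ≤ M →
    p.1.length = r ∧ p.2.length = n + 1 →
    Does decodeP (.cons env (encItem W p)) (encItem W (decodeItem W p)) (c M) := by
  obtain ⟨c₁, hc₁, h₁⟩ := msbP_spec
  apply Exists.intro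
  apply And.intro
  case right =>
    intro M W r n env p hW hn hp
    rcases p with ⟨i, _ | ⟨v, t⟩⟩
    · simp at hp
    · have e := Does.map (encA := encZ W) (encB := encBool)
        (f := fun f => msb W v ^^ msb W f) (l := t) (N := M) (T := c₁ M + 40)
        (env := encBool (msb W v)) (p := .cons .head (.tail ▷ msbP) ▷ xorP .head .tail)
        (by have := hp.2; simp at this; omega)
        (fun a _ => by
          refine Does.mono (Does.comp (Does.cons (Does.free (y := encBool (msb W v)) rfl rfl)
            (Does.call rfl (h₁ M W a hW)))
            (Does.free (y := encBool (msb W v ^^ msb W a)) rfl ?_)) ?_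
          · cases msb W v <;> cases msb W a <;> rfl
          · simp only [Prog.sz, xorP, notP, trueP]; omega)
      exact Does.mono (Does.cons (Does.comp (Does.cons (Does.call rfl (h₁ M W v hW))
        (Does.free rfl rfl)) e) (Does.free rfl rfl)) le_rfl
  case left => fun_prop

/-- The improved approximation obtained from one matrix. -/
def cand (W k n r : ℕ) (m : Meas) (x : List Item) : List Item :=
  topk W k (aggregate n (x ++ (resid r m x).map (decodeItem W)))

/-- Encoding of the parameters of the recovery procedure. -/
def encEnv (W k n r : ℕ) : Data := .cons (un r) (.cons (un n) (.cons (un k) (un W)))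

/-- Program for `cand`: the input is `(parameters, m, x)`. -/
def candP : Prog :=
  .cons (.head ▷ .tail ▷ .tail ▷ .head) (.cons (.head ▷ .tail ▷ .tail ▷ .tail)
    (.cons (.head ▷ .tail ▷ .head) (.cons (.tail ▷ .tail)
      (.cons .nil (.cons (.head ▷ .head) .tail ▷ residP) ▷ mapP decodeP) ▷ appendP) ▷
      aggregateP)) ▷ topkP

theorem candInput_hasDims {W n r N : ℕ} {m : Meas} {x : List Item} (hm : IsMeas n r N m)
    (hx : IsSig n N x) : HasDims n 1 (x ++ (resid r m x).map (decodeItem W)) ∧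
      (x ++ (resid r m x).map (decodeItem W)).length ≤ 3 * N := by
  refine ⟨fun p hp => ?_, ?_⟩
  · rcases List.mem_append.1 hp with hp | hp
    · exact hx.1 p hp
    · obtain ⟨q, hq, rfl⟩ := List.mem_map.1 hp
      have := ((resid_hasDims hm hx).1 q hq).2
      exact ⟨by simp [decodeItem, this], rfl⟩
  · have := hx.2
    have := (resid_hasDims hm hx).2
    simp
    omega

theorem topk_isSig {W k n N : ℕ} {l : List Item} (hl : HasDims n 1 l) (hk : k ≤ N) :
    IsSig n N (topk W k l) := by
  refine ⟨fun p hp => ?_, ?_⟩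
  · simp only [topk, List.mem_map, List.mem_reverse] at hp
    obtain ⟨q, hq, rfl⟩ := hp
    obtain ⟨s, hs, hsq⟩ := iterate_radixPass_subset _ _ q (List.mem_of_mem_take hq)
    obtain ⟨t, ht, rfl⟩ := List.mem_map.1 hs
    rw [← hsq]
    exact hl t ht
  · simp [topk, hk]

theorem cand_isSig {W k n r N : ℕ} {m : Meas} {x : List Item} (hk : k ≤ N) (hm : IsMeas n r N m)
    (hx : IsSig n N x) : IsSig n N (cand W k n r m x) :=
  topk_isSig (aggregate_hasDims (candInput_hasDims hm hx).1) hk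

theorem candP_spec : ∃ c, IsLin c ∧ ∀ (M N : ℕ), 1 ≤ N → ∀ (W k n r : ℕ) (m : Meas)
    (x : List Item), W ≤ M → n + 1 ≤ M → r ≤ M → k ≤ N → IsMeas n r N m → IsSig n N x →
    Does candP (.cons (encEnv W k n r) (.cons (encMeas W m) (encItems W x)))
      (encItems W (cand W k n r m x)) (c M N) := by
  obtain ⟨c₁, hc₁, h₁⟩ := residP_spec
  obtain ⟨c₂, hc₂, h₂⟩ := decodeP_spec
  obtain ⟨c₃, hc₃, h₃⟩ := aggregateP_spec
  obtain ⟨c₄, hc₄, h₄⟩ := topkP_spec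
  have hc₃' := hc₃.mul_const (a := 3) (by norm_num)
  have hc₄' := hc₄.mul_const (a := 3) (by norm_num)
  apply Exists.intro
  apply And.intro
  case right =>
    intro M N hN W k n r m x hW hn hr hk hm hx
    have hd := resid_hasDims hm hx
    have e1 := h₁ M N hN W n r m x hW hn hr hm hx
    have e2 := Does.map (encA := encItem W) (encB := encItem W) (env := .nil) (p := decodeP)
      (f := decodeItem W) (N := 2 * N) hd.2
      (fun a ha => h₂ M W r n .nil a hW (by omega) (hd.1 a ha))
    have e3 := Does.append (encA := encItem W) (l' := (resid r m x).map (decodeItem W)) hx.2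
    have hd' := candInput_hasDims (W := W) hm hx
    have e4 := h₃ M (3 * N) (by omega) W n 1 _ hW (by omega) (by omega) hd'.2 hd'.1
    have e5 := h₄ M (3 * N) (by omega) W n k _ hW (by omega)
      ((length_aggregate_le hd'.1).trans hd'.2) (aggregate_hasDims hd'.1)
    exact Does.mono (Does.comp (Does.cons (Does.free rfl rfl) (Does.cons (Does.free rfl rfl)
      (Does.comp (Does.cons (Does.free rfl rfl) (Does.comp (Does.cons (Does.free rfl rfl)
      (Does.comp (Does.cons (Does.free rfl rfl) (Does.call rfl e1)) e2)) e3)) e4))) e5) le_rfl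
  case left =>
    repeat' first
      | assumption
      | exact IsLin.self
      | exact IsLin.of_poly (by fun_prop)
      | refine IsLin.add ?_ ?_
      | refine IsLin.poly_mul (by fun_prop) ?_
      | refine IsLin.mul_poly ?_ (by fun_prop)

/-- Add the `ℓ₁` norm of the residual measurements for one matrix. -/
def normStep (W r : ℕ) (x : List Item) (acc : ℤ) (m : Meas) : ℤ :=
  (resid r m x).foldl (fun acc p => absW W (p.2.headD 0) + acc) acc

/-- Program for `normStep`: the input is `((parameters, x), m, acc)`. -/
def normStepP : Prog :=
  .cons .nil (.cons (.tail ▷ .tail)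
    (.cons (.head ▷ .head ▷ .head) (.cons (.tail ▷ .head) (.head ▷ .tail)) ▷ residP)) ▷
    foldP (.cons (.tail ▷ .head ▷ .tail ▷ .head ▷ absP) (.tail ▷ .tail) ▷ addP)

theorem normStepP_spec : ∃ c, IsLin c ∧ ∀ (M N : ℕ), 1 ≤ N → ∀ (W k n r : ℕ) (m : Meas)
    (x : List Item) (acc : ℤ), W ≤ M → n + 1 ≤ M → r ≤ M → IsMeas n r N m → IsSig n N x →
    Does normStepP (.cons (.cons (encEnv W k n r) (encItems W x))
      (.cons (encMeas W m) (encZ W acc))) (encZ W (normStep W r x acc m)) (c M N) := by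
  obtain ⟨c₁, hc₁, h₁⟩ := residP_spec
  obtain ⟨c₂, hc₂, h₂⟩ := absP_spec
  obtain ⟨c₃, hc₃, h₃⟩ := addP_spec
  apply Exists.intro
  apply And.intro
  case right =>
    intro M N hN W k n r m x acc hW hn hr hm hx
    have hd := resid_hasDims hm hx
    have e1 := h₁ M N hN W n r m x hW hn hr hm hx
    have e2 := Does.fold (encA := encItem W) (encB := encZ W) (env := .nil) (b := acc)
      (p := .cons (.tail ▷ .head ▷ .tail ▷ .head ▷ absP) (.tail ▷ .tail) ▷ addP)
      (f := fun acc p => absW W (p.2.headD 0) + acc) (N := 2 * N) (l := resid r m x)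
      (T := c₂ M + c₃ M + 40) (fun _ => True) hd.2 trivial (fun _ _ _ _ => trivial)
      (fun b a ha _ => by
        have hv := (hd.1 a ha).2
        rcases a with ⟨i, _ | ⟨v, t⟩⟩
        · simp at hv
        · refine Does.mono (Does.comp (Does.cons (Does.call rfl (h₂ M W v hW))
            (Does.free (y := encZ W b) rfl rfl)) (h₃ M W (absW W v) b hW)) ?_
          simp only [Prog.sz]
          omega)
    exact Does.mono (Does.comp (Does.cons (Does.free rfl rfl) (Does.cons (Does.free rfl rfl)
      (Does.call rfl e1))) e2) le_rfl
  case left =>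
    repeat' first
      | assumption
      | exact IsLin.self
      | exact IsLin.of_poly (by fun_prop)
      | refine IsLin.add ?_ ?_
      | refine IsLin.poly_mul (by fun_prop) ?_
      | refine IsLin.mul_poly ?_ (by fun_prop)

/-- The `ℓ₁` norm of the residual measurements. -/
def normW (W r : ℕ) (ms : List Meas) (x : List Item) : ℤ := ms.foldl (normStep W r x) 0

/-- Program for `normW`: the input is `(parameters, ms, x)`. -/
def normP : Prog :=
  .cons (.cons .head (.tail ▷ .tail)) (.cons (.head ▷ .tail ▷ .tail ▷ .tail) (.tail ▷ .head)) ▷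
    foldP normStepP

theorem bz_zero (W : ℕ) : bz W 0 = List.replicate W false := by
  induction W with
  | zero => rfl
  | succ W ih => simp [bz, ih, List.replicate_succ]

theorem normP_spec : ∃ c, IsLin c ∧ ∀ (M N : ℕ), 1 ≤ N → ∀ (W k n r D : ℕ) (ms : List Meas)
    (x : List Item), W ≤ M → n + 1 ≤ M → r ≤ M → 1 ≤ D → ms.length ≤ D →
    (∀ m ∈ ms, IsMeas n r N m) → IsSig n N x →
    Does normP (.cons (encEnv W k n r) (.cons (encList (encMeas W) ms) (encItems W x)))
      (encZ W (normW W r ms x)) (D * c M N) := by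
  obtain ⟨c₁, hc₁, h₁⟩ := normStepP_spec
  refine ⟨fun M N => c₁ M N + 100, hc₁.add (.of_poly (by fun_prop)),
    fun M N hN W k n r D ms x hW hn hr hD hms hm hx => ?_⟩
  have e := Does.fold (encA := encMeas W) (encB := encZ W)
    (env := .cons (encEnv W k n r) (encItems W x)) (b := 0)
    (f := normStep W r x) (N := D) (l := ms) (fun _ => True) hms trivial (fun _ _ _ _ => trivial)
    (fun b a ha _ => h₁ M N hN W k n r a x b hW hn hr (hm a ha) hx)
  rw [encZ, bz_zero] at e
  refine Does.mono (Does.call rfl e) ?_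
  simp only [Prog.sz]
  have : D * (c₁ M N + 100) = D * (c₁ M N + 30) + D * 70 := by ring
  omega

/-- Keep the better one of the best approximation so far and of the one obtained from `m`. -/
def roundStep (W k n r : ℕ) (ms : List Meas) (x : List Item) (best : ℤ × List Item) (m : Meas) :
    ℤ × List Item :=
  if msb W (normW W r ms (cand W k n r m x) - best.1) then
    (normW W r ms (cand W k n r m x), cand W k n r m x) else best

/-- Program for `roundStep`: the input is `((parameters, ms, x), m, best)`. -/
def roundStepP : Prog :=
  letP (.cons (.head ▷ .head) (.cons (.tail ▷ .head) (.head ▷ .tail ▷ .tail))) candP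
    (letP (.cons (.head ▷ .head ▷ .head) (.cons (.head ▷ .head ▷ .tail ▷ .head) .tail)) normP
      (.cond (.cons .tail (.head ▷ .head ▷ .tail ▷ .tail ▷ .head) ▷ ltP)
        (.cons .tail (.head ▷ .tail)) (.head ▷ .head ▷ .tail ▷ .tail)))

theorem roundStepP_spec : ∃ c, IsLin c ∧ ∀ (M N : ℕ), 1 ≤ N → ∀ (W k n r D : ℕ) (ms : List Meas)
    (x : List Item) (m : Meas) (best : ℤ × List Item), W ≤ M → n + 1 ≤ M → r ≤ M → 1 ≤ D →
    k ≤ N → ms.length ≤ D → (∀ m ∈ ms, IsMeas n r N m) → m ∈ ms → IsSig n N x →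
    Does roundStepP (.cons (.cons (encEnv W k n r) (.cons (encList (encMeas W) ms) (encItems W x)))
      (.cons (encMeas W m) (encPair (encZ W) (encItems W) best)))
      (encPair (encZ W) (encItems W) (roundStep W k n r ms x best m)) (D * c M N) := by
  obtain ⟨c₁, hc₁, h₁⟩ := candP_spec
  obtain ⟨c₂, hc₂, h₂⟩ := normP_spec
  obtain ⟨c₃, hc₃, h₃⟩ := ltP_spec
  refine ⟨fun M N => c₁ M N + c₂ M N + c₃ M + 200,
    ((hc₁.add hc₂).add (.of_poly hc₃)).add (.of_poly (by fun_prop)),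
    fun M N hN W k n r D ms x m best hW hn hr hD hk hms hm hmm hx => ?_⟩
  have e1 := h₁ M N hN W k n r m x hW hn hr hk (hm m hmm) hx
  have e2 := h₂ M N hN W k n r D ms (cand W k n r m x) hW hn hr hD hms hm
    (cand_isSig hk (hm m hmm) hx)
  have e3 := h₃ M W (normW W r ms (cand W k n r m x)) best.1 hW
  refine Does.mono (Does.letP rfl e1 (Does.letP rfl e2 (Does.ite (T := 30)
    (Does.call rfl e3) (fun h => ?_) (fun h => ?_)))) ?_
  · rw [roundStep, if_pos h]
    exact Does.mono (Does.free rfl rfl) (by decide)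
  · rw [roundStep, if_neg (by simp [h])]
    exact Does.mono (Does.free rfl rfl) (by decide)
  · simp only [Prog.sz]
    have : D * (c₁ M N + c₂ M N + c₃ M + 200) =
      D * c₁ M N + D * c₂ M N + D * c₃ M + D * 200 := by ring
    have := Nat.mul_le_mul_right (c₁ M N) hD
    have := Nat.mul_le_mul_right (c₃ M) hD
    omega

/-- One round: try all matrices. -/
def round (W k n r : ℕ) (ms : List Meas) (best : ℤ × List Item) : ℤ × List Item :=
  ms.foldl (roundStep W k n r ms best.2) best

theorem roundStep_isSig {W k n r N : ℕ} {ms : List Meas} {x : List Item} {m : Meas}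
    {best : ℤ × List Item} (hk : k ≤ N) (hm : IsMeas n r N m) (hx : IsSig n N x)
    (hb : IsSig n N best.2) : IsSig n N (roundStep W k n r ms x best m).2 := by
  rw [roundStep]
  split_ifs
  · exact cand_isSig hk hm hx
  · exact hb

theorem round_isSig {W k n r N : ℕ} {ms : List Meas} {best : ℤ × List Item} (hk : k ≤ N)
    (hm : ∀ m ∈ ms, IsMeas n r N m) (hb : IsSig n N best.2) :
    IsSig n N (round W k n r ms best).2 := by
  rw [round]
  generalize hx : best.2 = x
  rw [hx] at hb
  have : ∀ (ms' : List Meas) (best : ℤ × List Item), (∀ m ∈ ms', IsMeas n r N m) →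
      IsSig n N best.2 → IsSig n N (ms'.foldl (roundStep W k n r ms x) best).2 := by
    intro ms'
    induction ms' with
    | nil => exact fun best _ h => h
    | cons m ms' ih =>
      exact fun best h h' => ih _ (fun q hq => h q (by simp [hq]))
        (roundStep_isSig hk (h m (by simp)) hb h')
  exact this ms best hm (hx ▸ hb)

/-- Program for `round`: the input is `((parameters, ms), nothing, best)`. -/
def roundP : Prog :=
  .cons (.cons (.head ▷ .head) (.cons (.head ▷ .tail) (.tail ▷ .tail ▷ .tail)))
    (.cons (.tail ▷ .tail) (.head ▷ .tail)) ▷ foldP roundStepP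

/-- The recovery procedure: the approximation after `s` rounds. -/
def recover (W k n r : ℕ) (ms : List Meas) (s : ℕ) : List Item :=
  ((round W k n r ms)^[s] (normW W r ms [], [])).2

theorem recover_isSig {W k n r N s : ℕ} {ms : List Meas} (hk : k ≤ N)
    (hm : ∀ m ∈ ms, IsMeas n r N m) : IsSig n N (recover W k n r ms s) := by
  rw [recover]
  induction s with
  | zero => exact ⟨fun p hp => by simp at hp, by simp⟩
  | succ s ih =>
    rw [Function.iterate_succ_apply']
    exact round_isSig hk hm ih

/-- Program for `recover`: the input is `((parameters, ms), s)`. -/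
def recoverP : Prog :=
  .cons .head (.cons (.cons (.cons (.head ▷ .head) (.cons (.head ▷ .tail) .nil) ▷ normP) .nil)
    .tail) ▷ foldP roundP ▷ .tail

theorem recoverP_spec : ∃ c, IsLin c ∧ ∀ (M N : ℕ), 1 ≤ N → ∀ (W k n r D s : ℕ) (ms : List Meas),
    W ≤ M → n + 1 ≤ M → r ≤ M → s ≤ M → 1 ≤ D → k ≤ N → ms.length ≤ D →
    (∀ m ∈ ms, IsMeas n r N m) →
    Does recoverP (.cons (.cons (encEnv W k n r) (encList (encMeas W) ms)) (un s))
      (encItems W (recover W k n r ms s)) (D ^ 2 * c M N) := by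
  obtain ⟨c₁, hc₁, h₁⟩ := roundStepP_spec
  obtain ⟨c₂, hc₂, h₂⟩ := normP_spec
  refine ⟨fun M N => M * (c₁ M N + 150) + c₂ M N + 100, ?_,
    fun M N hN W k n r D s ms hW hn hr hs hD hk hms hm => ?_⟩
  · exact ((IsLin.poly_mul (by fun_prop) (hc₁.add (.of_poly (by fun_prop)))).add hc₂).add
      (.of_poly (by fun_prop))
  · have e2 := h₂ M N hN W k n r D ms [] hW hn hr hD hms hm ⟨fun p hp => by simp at hp, by simp⟩
    have e := Does.fold (encA := encBool) (encB := encPair (encZ W) (encItems W)) (N := M)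
      (env := .cons (encEnv W k n r) (encList (encMeas W) ms)) (l := List.replicate s false)
      (b := (normW W r ms [], [])) (f := fun b _ => round W k n r ms b)
      (T := D ^ 2 * (c₁ M N + 100)) (p := roundP)
      (fun b => IsSig n N b.2) (by simpa) ⟨fun p hp => by simp at hp, by simp⟩
      (fun b _ _ hb => round_isSig hk hm hb)
      (fun b _ _ hb => by
        have e1 := Does.fold (encA := encMeas W) (encB := encPair (encZ W) (encItems W)) (N := D)
          (env := .cons (encEnv W k n r) (.cons (encList (encMeas W) ms) (encItems W b.2)))
          (b := b) (l := ms) (f := roundStep W k n r ms b.2) (T := D * c₁ M N)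
          (fun _ => True) hms trivial (fun _ _ _ _ => trivial)
          (fun b' a ha _ => h₁ M N hN W k n r D ms b.2 a b' hW hn hr hD hk hms hm ha hb)
        refine Does.mono (Does.call rfl e1) ?_
        simp only [Prog.sz]
        have h1 : D * (D * c₁ M N + 30) = D ^ 2 * c₁ M N + 30 * D := by ring
        have h2 : D ^ 2 * (c₁ M N + 100) = D ^ 2 * c₁ M N + 100 * D ^ 2 := by ring
        have h3 : D ≤ D ^ 2 := Nat.le_self_pow (by norm_num) D
        omega)
    rw [foldl_replicate] at e
    refine Does.mono (Does.comp (Does.comp (Does.cons (Does.free rfl rfl) (Does.cons (Does.cons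
      (Does.call rfl e2) (Does.free rfl rfl)) (Does.free rfl rfl))) e) (Does.free rfl rfl)) ?_
    simp only [Prog.sz]
    have h2 : D ≤ D ^ 2 := Nat.le_self_pow (by norm_num) D
    have h3 := Nat.mul_le_mul_right (c₂ M N) h2
    have h4 : D ^ 2 * (M * (c₁ M N + 150) + c₂ M N + 100) =
      M * (D ^ 2 * (c₁ M N + 100)) + 50 * (M * D ^ 2) + D ^ 2 * c₂ M N + 100 * D ^ 2 := by ring
    have h5 : M * (D ^ 2 * (c₁ M N + 100) + 30) = M * (D ^ 2 * (c₁ M N + 100)) + 30 * M := by ring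
    have h6 : M ≤ M * D ^ 2 := Nat.le_mul_of_pos_right _ (by omega)
    omega

/-! ### Expanders and the geometry of `ℓ₁` -/

section geometry

variable {ι κ τ : Type} [DecidableEq κ] [Fintype τ]

/-- The `ℓ₁` norm of `f` on the finite set `U`. -/
def norm1 (U : Finset ι) (f : ι → ℤ) : ℤ := ∑ i ∈ U, |f i|

/-- The maps `H t` do not lose more than a fraction of `1 / 32` of the pairs `(i, t)`, for `i` in
a set of at most `K` elements, to collisions. -/
def IsExpander (U : Finset ι) (K : ℕ) (H : τ → ι → κ) : Prop :=
  ∀ S ⊆ U, S.card ≤ K →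
    31 * (Fintype.card τ * S.card) ≤ 32 * ∑ t, (S.image (H t)).card

/-- The indices that `H t` maps to `z`. -/
def bucket (U : Finset ι) (H : ι → κ) (z : κ) : Finset ι := U.filter fun i => H i = z

/-- The largest absolute value in a bucket. -/
def bucketMax (U : Finset ι) (H : ι → κ) (v : ι → ℤ) (z : κ) : ℕ :=
  (bucket U H z).sup fun i => (v i).natAbs

/-- The `ℓ₁` norm of all bucket sums. -/
def normBuckets (U : Finset ι) (Z : Finset κ) (H : τ → ι → κ) (f : ι → ℤ) : ℤ :=
  ∑ t, ∑ z ∈ Z, |∑ i ∈ bucket U (H t) z, f i|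

theorem sum_bucket (U : Finset ι) (Z : Finset κ) (H : ι → κ) (hH : ∀ i ∈ U, H i ∈ Z)
    (f : ι → ℤ) : ∑ z ∈ Z, ∑ i ∈ bucket U H z, f i = ∑ i ∈ U, f i :=
  Finset.sum_fiberwise_of_maps_to hH f

theorem norm1_add_le (U : Finset ι) (f g : ι → ℤ) :
    norm1 U (fun i => f i + g i) ≤ norm1 U f + norm1 U g := by
  rw [norm1, norm1, norm1, ← Finset.sum_add_distrib]
  exact Finset.sum_le_sum fun i _ => abs_add_le _ _

theorem norm1_nonneg (U : Finset ι) (f : ι → ℤ) : 0 ≤ norm1 U f :=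
  Finset.sum_nonneg fun _ _ => abs_nonneg _

theorem norm1_sub_le (U : Finset ι) (f g h : ι → ℤ) :
    norm1 U (fun i => f i - h i) ≤ norm1 U (fun i => f i - g i) + norm1 U (fun i => g i - h i) := by
  refine le_trans (le_of_eq ?_) (norm1_add_le _ _ _)
  simp

theorem norm1_neg (U : Finset ι) (f g : ι → ℤ) :
    norm1 U (fun i => f i - g i) = norm1 U fun i => g i - f i :=
  Finset.sum_congr rfl fun _ _ => abs_sub_comm _ _

theorem normBuckets_le (U : Finset ι) (Z : Finset κ) (H : τ → ι → κ)
    (hH : ∀ t, ∀ i ∈ U, H t i ∈ Z) (f : ι → ℤ) :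
    normBuckets U Z H f ≤ Fintype.card τ * norm1 U f := by
  have : ∀ t, ∑ z ∈ Z, |∑ i ∈ bucket U (H t) z, f i| ≤ norm1 U f := fun t => by
    rw [norm1, ← sum_bucket U Z (H t) (hH t)]
    exact Finset.sum_le_sum fun z _ => Finset.abs_sum_le_sum_abs _ _
  refine (Finset.sum_le_sum fun t _ => this t).trans ?_
  simp

/-- For a vector with small support, most of its mass consists of entries that are the largest
ones in their buckets. This follows by applying the expansion property to all superlevel sets. -/
theorem IsExpander.le_sum_bucketMax {U : Finset ι} {Z : Finset κ} {K : ℕ} {H : τ → ι → κ}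
    (hE : IsExpander U K H) (hH : ∀ t, ∀ i ∈ U, H t i ∈ Z) {v : ι → ℤ} {S : Finset ι}
    (hS : S.card ≤ K) (hv : ∀ i ∈ U, i ∉ S → v i = 0) :
    31 * (Fintype.card τ * norm1 U v) ≤ 32 * ∑ t, ∑ z ∈ Z, (bucketMax U (H t) v z : ℤ) := by
  classical
  -- Layer cake: a natural number `a ≤ B` is the number of the levels `θ < B` with `θ < a`. So both
  -- sides are sums over `θ` of cardinalities for the superlevel set `L θ`.
  set B := U.sup fun i => (v i).natAbs with hB
  have layer : ∀ a ≤ B, a = ∑ θ ∈ Finset.range B, if θ < a then 1 else 0 := by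
    intro a ha
    rw [← Finset.sum_filter, Finset.sum_const, smul_eq_mul, mul_one]
    have : (Finset.range B).filter (fun θ => θ < a) = Finset.range a := by
      ext θ
      simp only [Finset.mem_filter, Finset.mem_range]
      omega
    rw [this, Finset.card_range]
  set L : ℕ → Finset ι := fun θ => U.filter fun i => θ < (v i).natAbs with hL
  have h1 : ∑ i ∈ U, (v i).natAbs = ∑ θ ∈ Finset.range B, (L θ).card := by
    rw [Finset.sum_congr rfl fun i hi => layer _ (Finset.le_sup (f := fun i => (v i).natAbs) hi),
      Finset.sum_comm]
    refine Finset.sum_congr rfl fun θ _ => ?_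
    rw [← Finset.sum_filter, Finset.sum_const, smul_eq_mul, mul_one]
  have h2 : ∀ t, ∑ z ∈ Z, bucketMax U (H t) v z =
      ∑ θ ∈ Finset.range B, ((L θ).image (H t)).card := by
    intro t
    have hle : ∀ z ∈ Z, bucketMax U (H t) v z ≤ B := fun z _ =>
      Finset.sup_mono (Finset.filter_subset _ _)
    rw [Finset.sum_congr rfl fun z hz => layer _ (hle z hz), Finset.sum_comm]
    refine Finset.sum_congr rfl fun θ _ => ?_
    rw [← Finset.sum_filter, Finset.sum_const, smul_eq_mul, mul_one]
    congr 1
    ext z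
    simp only [Finset.mem_filter, bucketMax, bucket, Finset.lt_sup_iff, Finset.mem_image, hL]
    constructor
    · rintro ⟨_, i, ⟨hi, hz⟩, h⟩
      exact ⟨i, ⟨hi, h⟩, hz⟩
    · rintro ⟨i, ⟨hi, h⟩, hz⟩
      exact ⟨hz ▸ hH t i hi, i, ⟨hi, hz⟩, h⟩
  have h3 : 31 * (Fintype.card τ * ∑ i ∈ U, (v i).natAbs) ≤
      32 * ∑ t, ∑ z ∈ Z, bucketMax U (H t) v z := by
    rw [h1, Finset.sum_congr rfl fun t _ => h2 t, Finset.sum_comm, Finset.mul_sum, Finset.mul_sum,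
      Finset.mul_sum]
    refine Finset.sum_le_sum fun θ _ => hE _ (Finset.filter_subset _ _) ?_
    refine (Finset.card_le_card fun i hi => ?_).trans hS
    by_contra his
    simp only [hL, Finset.mem_filter] at hi
    rw [hv i hi.1 his] at hi
    simp at hi
  have h4 : norm1 U v = ((∑ i ∈ U, (v i).natAbs : ℕ) : ℤ) := by
    rw [norm1]
    push_cast
    exact Finset.sum_congr rfl fun i _ => by simp
  rw [h4]
  exact_mod_cast h3

/-- The lower bound of the restricted isometry property in `ℓ₁`. -/
theorem IsExpander.le_normBuckets {U : Finset ι} {Z : Finset κ} {K : ℕ} {H : τ → ι → κ}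
    (hE : IsExpander U K H) (hH : ∀ t, ∀ i ∈ U, H t i ∈ Z) {v : ι → ℤ} {S : Finset ι}
    (hS : S.card ≤ K) (hv : ∀ i ∈ U, i ∉ S → v i = 0) :
    15 * (Fintype.card τ * norm1 U v) ≤ 16 * normBuckets U Z H v := by
  classical
  have h := hE.le_sum_bucketMax hH hS hv
  have hb : ∀ t, ∀ z ∈ Z, 2 * (bucketMax U (H t) v z : ℤ) ≤
      |∑ i ∈ bucket U (H t) z, v i| + ∑ i ∈ bucket U (H t) z, |v i| := by
    intro t z _
    -- The sum of a bucket is at least its largest entry minus all the others.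
    rcases (bucket U (H t) z).eq_empty_or_nonempty with h0 | hne
    · simp [bucketMax, h0]
    · obtain ⟨i, hi, him⟩ := Finset.exists_mem_eq_sup _ hne fun i => (v i).natAbs
      rw [bucketMax, him, Int.natCast_natAbs, ← Finset.add_sum_erase _ _ hi,
        ← Finset.add_sum_erase _ (fun i => |v i|) hi]
      have h1 := Finset.abs_sum_le_sum_abs v ((bucket U (H t) z).erase i)
      have h2 := abs_sub_abs_le_abs_sub (v i) (-∑ j ∈ (bucket U (H t) z).erase i, v j)
      rw [abs_neg, sub_neg_eq_add] at h2
      linarith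
  have h1 : 2 * ∑ t, ∑ z ∈ Z, (bucketMax U (H t) v z : ℤ) ≤
      normBuckets U Z H v + Fintype.card τ * norm1 U v := by
    have : ∀ t, 2 * ∑ z ∈ Z, (bucketMax U (H t) v z : ℤ) ≤
        ∑ z ∈ Z, |∑ i ∈ bucket U (H t) z, v i| + norm1 U v := by
      intro t
      rw [norm1, ← sum_bucket U Z (H t) (hH t), Finset.mul_sum, ← Finset.sum_add_distrib]
      exact Finset.sum_le_sum fun z hz => hb t z hz
    rw [Finset.mul_sum]
    refine (Finset.sum_le_sum fun t _ => this t).trans (le_of_eq ?_)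
    rw [Finset.sum_add_distrib, normBuckets]
    simp
  linarith

variable [DecidableEq ι]

/-- The difference between a vector and the vector that has the bucket sum of every bucket `z` at
the position `dec z`, where `dec` finds the position of any entry that outweighs the rest of its
bucket. -/
theorem norm1_sub_decode_le {U : Finset ι} {Z : Finset κ} {H : ι → κ} (hH : ∀ i ∈ U, H i ∈ Z)
    {w : ι → ℤ} (dec : κ → ι)
    (hdec : ∀ z ∈ Z, ∀ i ∈ bucket U H z, ∑ j ∈ (bucket U H z).erase i, |w j| < |w i| → dec z = i)
    (v e : ι → ℤ) (hw : ∀ i, w i = v i + e i) :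
    norm1 U (fun j => w j - ∑ z ∈ Z, if dec z = j then ∑ i ∈ bucket U H z, w i else 0) ≤
      4 * (norm1 U v - ∑ z ∈ Z, (bucketMax U H v z : ℤ) + norm1 U e) := by
  set F : κ → ℤ := fun z => ∑ i ∈ bucket U H z, w i with hF
  -- The triangle inequality separates the buckets.
  have hsplit : norm1 U (fun j => w j - ∑ z ∈ Z, if dec z = j then F z else 0) ≤
      ∑ z ∈ Z, ∑ j ∈ U, |(if H j = z then w j else 0) - if dec z = j then F z else 0| := by
    rw [Finset.sum_comm, norm1]
    refine Finset.sum_le_sum fun j hj => ?_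
    have : w j = ∑ z ∈ Z, if H j = z then w j else 0 := by
      rw [Finset.sum_ite_eq, if_pos (hH j hj)]
    calc |w j - ∑ z ∈ Z, if dec z = j then F z else 0|
        = |∑ z ∈ Z, ((if H j = z then w j else 0) - if dec z = j then F z else 0)| := by
          rw [Finset.sum_sub_distrib, ← this]
      _ ≤ _ := Finset.abs_sum_le_sum_abs _ _
  have hbucket : ∀ z ∈ Z, ∀ i ∈ bucket U H z,
      ∑ j ∈ U, |(if H j = z then w j else 0) - if dec z = j then F z else 0| ≤
        4 * ∑ j ∈ (bucket U H z).erase i, |w j| := by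
    intro z hz i hi
    have hFi : F z - w i = ∑ j ∈ (bucket U H z).erase i, w j := by
      simp only [hF]
      rw [← Finset.add_sum_erase _ _ hi]
      ring
    have hR := Finset.abs_sum_le_sum_abs w ((bucket U H z).erase i)
    rw [← hFi] at hR
    have hiU : i ∈ U := (Finset.mem_filter.1 hi).1
    have hiz : H i = z := (Finset.mem_filter.1 hi).2
    have hsum : ∑ j ∈ U, |if H j = z then w j else 0| =
        |w i| + ∑ j ∈ (bucket U H z).erase i, |w j| := by
      rw [Finset.add_sum_erase _ (fun j => |w j|) hi, bucket, Finset.sum_filter]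
      exact Finset.sum_congr rfl fun j _ => by split_ifs <;> simp
    -- If `i` dominates its bucket, then it is found, and only the other entries contribute, twice:
    -- as they are and as the error of the bucket sum. Otherwise `|w i|` is itself bounded by them.
    rcases lt_or_ge (∑ j ∈ (bucket U H z).erase i, |w j|) |w i| with hlt | hge
    · have hd := hdec z hz i hi hlt
      rw [← Finset.add_sum_erase _ _ hiU] at hsum ⊢
      rw [if_pos hiz] at hsum ⊢
      rw [if_pos hd]
      have : ∑ j ∈ U.erase i, |(if H j = z then w j else 0) - if dec z = j then F z else 0| =
          ∑ j ∈ U.erase i, |if H j = z then w j else 0| := by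
        refine Finset.sum_congr rfl fun j hj => ?_
        have hne : dec z ≠ j := by rw [hd]; exact (Finset.ne_of_mem_erase hj).symm
        rw [if_neg hne, sub_zero]
      rw [this]
      have h1 := abs_sub_comm (w i) (F z)
      have h0 : 0 ≤ ∑ j ∈ (bucket U H z).erase i, |w j| := Finset.sum_nonneg fun _ _ => abs_nonneg _
      linarith
    · have hF' : |F z| ≤ |w i| + ∑ j ∈ (bucket U H z).erase i, |w j| := by
        have := abs_add_le (w i) (F z - w i)
        rw [add_sub_cancel] at this
        linarith
      have h2 : ∑ j ∈ U, |if dec z = j then F z else 0| ≤ |F z| := by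
        have : ∀ j ∈ U, |if dec z = j then F z else 0| = if dec z = j then |F z| else 0 :=
          fun j _ => by split_ifs <;> simp
        rw [Finset.sum_congr rfl this, Finset.sum_ite_eq]
        split_ifs
        · exact le_rfl
        · exact abs_nonneg _
      have h3 : ∑ j ∈ U, |(if H j = z then w j else 0) - if dec z = j then F z else 0| ≤
          ∑ j ∈ U, |if H j = z then w j else 0| + ∑ j ∈ U, |if dec z = j then F z else 0| := by
        rw [← Finset.sum_add_distrib]
        exact Finset.sum_le_sum fun j _ => abs_sub _ _
      linarith
  have hz : ∀ z ∈ Z, ∑ j ∈ U, |(if H j = z then w j else 0) - if dec z = j then F z else 0| ≤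
      4 * (∑ j ∈ bucket U H z, |v j| - bucketMax U H v z + ∑ j ∈ bucket U H z, |e j|) := by
    intro z hz
    rcases (bucket U H z).eq_empty_or_nonempty with h0 | hne
    · have hFz : F z = 0 := by simp [hF, h0]
      have : ∀ j ∈ U, |(if H j = z then w j else 0) - if dec z = j then F z else 0| = 0 := by
        intro j hj
        have : H j ≠ z := fun h => by
          have : j ∈ bucket U H z := Finset.mem_filter.2 ⟨hj, h⟩
          rw [h0] at this
          simp at this
        rw [if_neg this, hFz]
        simp
      rw [Finset.sum_congr rfl this]
      simp [bucketMax, h0]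
    · obtain ⟨i, hi, him⟩ := Finset.exists_mem_eq_sup _ hne fun i => (v i).natAbs
      refine (hbucket z hz i hi).trans ?_
      rw [bucketMax, him, Int.natCast_natAbs, ← Finset.add_sum_erase _ (fun j => |v j|) hi,
        ← Finset.add_sum_erase _ (fun j => |e j|) hi]
      have h1 : ∑ j ∈ (bucket U H z).erase i, |w j| ≤ ∑ j ∈ (bucket U H z).erase i, |v j| +
          ∑ j ∈ (bucket U H z).erase i, |e j| := by
        rw [← Finset.sum_add_distrib]
        exact Finset.sum_le_sum fun j _ => by rw [hw j]; exact abs_add_le _ _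
      have h2 := abs_nonneg (e i)
      linarith
  refine (hsplit.trans (Finset.sum_le_sum hz)).trans (le_of_eq ?_)
  rw [← Finset.mul_sum, Finset.sum_add_distrib, Finset.sum_sub_distrib, sum_bucket U Z H hH,
    sum_bucket U Z H hH]
  rfl

/-- `J` consists of the positions of `k` largest entries of `u` on `U`, or contains all nonzero
entries. -/
def IsTop (U : Finset ι) (k : ℕ) (u : ι → ℤ) (J : Finset ι) : Prop :=
  J ⊆ U ∧ J.card ≤ k ∧ ((∀ j ∈ U, j ∉ J → u j = 0) ∨
    J.card = k ∧ ∀ i ∈ J, ∀ j ∈ U, j ∉ J → |u j| ≤ |u i|)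

/-- Restriction to the largest entries is a best sparse approximation. -/
theorem IsTop.norm1_le {U : Finset ι} {k : ℕ} {u : ι → ℤ} {J S : Finset ι} (hJ : IsTop U k u J)
    (hS : S.card ≤ k) {y : ι → ℤ} (hy : ∀ i ∈ U, i ∉ S → y i = 0) :
    norm1 U (fun i => u i - if i ∈ J then u i else 0) ≤ norm1 U fun i => u i - y i := by
  classical
  obtain ⟨hJU, hJk, hJ⟩ := hJ
  have h1 : norm1 U (fun i => u i - if i ∈ J then u i else 0) = ∑ i ∈ U \ J, |u i| := by
    rw [norm1, ← Finset.sum_sdiff hJU, Finset.sum_eq_zero (s := J), add_zero]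
    · exact Finset.sum_congr rfl fun i hi => by rw [if_neg (Finset.mem_sdiff.1 hi).2, sub_zero]
    · intro i hi
      rw [if_pos hi, sub_self, abs_zero]
  have h2 : ∑ i ∈ U \ S, |u i| ≤ norm1 U fun i => u i - y i := by
    rw [norm1]
    refine le_trans (le_of_eq ?_) (Finset.sum_le_sum_of_subset_of_nonneg
      (Finset.sdiff_subset (s := U) (t := S)) fun _ _ _ => abs_nonneg _)
    refine Finset.sum_congr rfl fun i hi => ?_
    rw [Finset.mem_sdiff] at hi
    rw [hy i hi.1 hi.2, sub_zero]
  refine h1.le.trans (le_trans ?_ h2)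
  rcases hJ with hJ | ⟨hJk', hJ⟩
  · rw [Finset.sum_eq_zero]
    · exact Finset.sum_nonneg fun _ _ => abs_nonneg _
    · intro i hi
      rw [Finset.mem_sdiff] at hi
      rw [hJ i hi.1 hi.2, abs_zero]
  · have e1 : U \ J = (U \ (J ∪ S)) ∪ ((U ∩ S) \ J) := by
      ext i
      simp only [Finset.mem_sdiff, Finset.mem_union, Finset.mem_inter]
      tauto
    have e2 : U \ S = (U \ (J ∪ S)) ∪ (J \ S) := by
      ext i
      have := @hJU i
      simp only [Finset.mem_sdiff, Finset.mem_union]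
      tauto
    rw [e1, e2, Finset.sum_union, Finset.sum_union]
    · refine add_le_add_right ?_ _
      have hcard : ((U ∩ S) \ J).card ≤ (J \ S).card := by
        have a1 : ((U ∩ S) \ J).card ≤ (S \ J).card :=
          Finset.card_le_card (Finset.sdiff_subset_sdiff Finset.inter_subset_right le_rfl)
        have a2 := Finset.card_sdiff_add_card_inter S J
        have a3 := Finset.card_sdiff_add_card_inter J S
        rw [Finset.inter_comm] at a3
        omega
      obtain ⟨T, hT, hTc⟩ := Finset.exists_subset_card_eq hcard
      refine le_trans ?_ (Finset.sum_le_sum_of_subset_of_nonneg hT fun _ _ _ => abs_nonneg _)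
      have hbij := Finset.equivOfCardEq hTc.symm
      rw [← Finset.sum_coe_sort, ← Finset.sum_coe_sort T, ← hbij.sum_comp]
      refine Finset.sum_le_sum fun i _ => ?_
      have hi := i.2
      rw [Finset.mem_sdiff, Finset.mem_inter] at hi
      exact hJ _ (Finset.mem_sdiff.1 (hT (hbij i).2)).1 _ hi.1.1 hi.2
    · rw [Finset.disjoint_left]
      intro i hi hi'
      simp only [Finset.mem_sdiff, Finset.mem_union] at hi hi'
      tauto
    · rw [Finset.disjoint_left]
      intro i hi hi'
      simp only [Finset.mem_sdiff, Finset.mem_union, Finset.mem_inter] at hi hi'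
      tauto

/-- One round of recovery roughly halves the error: the best of the candidates `c t`, as measured
by the bucket sums, is a good approximation because the candidates are good on average. -/
theorem IsExpander.round_le {U : Finset ι} {Z : Finset κ} {k : ℕ} {H : τ → ι → κ} [Nonempty τ]
    (hE : IsExpander U (2 * k) H) (hH : ∀ t, ∀ i ∈ U, H t i ∈ Z) {X x : ι → ℤ}
    {S A : Finset ι} (hS : S.card ≤ k) (hA : A.card ≤ k) (hx : ∀ i ∈ U, i ∉ A → x i = 0)
    (dec : τ → κ → ι)
    (hdec : ∀ t, ∀ z ∈ Z, ∀ i ∈ bucket U (H t) z,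
      ∑ j ∈ (bucket U (H t) z).erase i, |X j - x j| < |X i - x i| → dec t z = i)
    (u : τ → ι → ℤ) (hu : ∀ t, ∀ j ∈ U, u t j = x j + ∑ z ∈ Z,
      if dec t z = j then ∑ i ∈ bucket U (H t) z, (X i - x i) else 0)
    (J : τ → Finset ι) (hJ : ∀ t, IsTop U k (u t) (J t)) {x' : ι → ℤ} {A' : Finset ι}
    (hA' : A'.card ≤ k) (hx' : ∀ i ∈ U, i ∉ A' → x' i = 0)
    (hbest : ∀ t, normBuckets U Z H (fun i => X i - x' i) ≤
      normBuckets U Z H fun i => X i - if i ∈ J t then u t i else 0) :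
    2 * norm1 U (fun i => X i - x' i) ≤ norm1 U (fun i => X i - x i) +
      24 * norm1 U fun i => if i ∈ S then 0 else X i := by
  classical
  set e : ι → ℤ := fun i => if i ∈ S then 0 else X i with he
  set XS : ι → ℤ := fun i => if i ∈ S then X i else 0 with hXS
  have hXe : ∀ i, X i = XS i + e i := fun i => by simp only [he, hXS]; split_ifs <;> simp
  have hsupp : ∀ (y : ι → ℤ) (B : Finset ι), (∀ i ∈ U, i ∉ B → y i = 0) →
      ∀ i ∈ U, i ∉ S ∪ B → XS i - y i = 0 := by
    intro y B hy i hi hiS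
    rw [Finset.mem_union, not_or] at hiS
    rw [hy i hi hiS.2]
    simp [hXS, hiS.1]
  have hcard : ∀ B : Finset ι, B.card ≤ k → (S ∪ B).card ≤ 2 * k := fun B hB =>
    (Finset.card_union_le _ _).trans (by omega)
  have htail : ∀ y : ι → ℤ, norm1 U (fun i => XS i - y i) ≤ norm1 U (fun i => X i - y i) +
      norm1 U e := by
    intro y
    have := norm1_sub_le U XS X y
    have h2 : norm1 U (fun i => XS i - X i) = norm1 U e := by
      rw [norm1_neg]
      exact Finset.sum_congr rfl fun i _ => by dsimp only; rw [hXe i]; simp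
    linarith
  -- If all candidates were worse than this, the sum over `t` of the bounds of `norm1_sub_decode_le`
  -- would contradict the expansion property: the maxima of the buckets leave out at most `1 / 32`
  -- of the mass on average.
  have hgood : ∃ t, 8 * norm1 U (fun j => X j - u t j) ≤
      norm1 U (fun i => XS i - x i) + 32 * norm1 U e := by
    by_contra! hcon
    have h1 : ∀ t, norm1 U (fun j => X j - u t j) ≤ 4 * (norm1 U (fun i => XS i - x i) -
        ∑ z ∈ Z, (bucketMax U (H t) (fun i => XS i - x i) z : ℤ) + norm1 U e) := by
      intro t
      refine le_trans (le_of_eq ?_) (norm1_sub_decode_le (hH t) (dec t) (hdec t)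
        (fun i => XS i - x i) e (fun i => by rw [hXe i]; ring))
      refine Finset.sum_congr rfl fun j hj => ?_
      dsimp only
      rw [hu t j hj]
      congr 1
      ring
    have h2 := hE.le_sum_bucketMax hH (hcard A hA) (hsupp x A hx)
    have h3 : ∑ t : τ, (norm1 U (fun i => XS i - x i) + 32 * norm1 U e) <
        ∑ t, 8 * norm1 U (fun j => X j - u t j) :=
      Finset.sum_lt_sum_of_nonempty Finset.univ_nonempty fun t _ => hcon t
    have h4 := Finset.sum_le_sum fun t (_ : t ∈ Finset.univ) =>
      mul_le_mul_of_nonneg_left (h1 t) (by norm_num : (0 : ℤ) ≤ 8)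
    simp only [← Finset.mul_sum, Finset.sum_add_distrib, Finset.sum_sub_distrib, Finset.sum_const,
      Finset.card_univ, nsmul_eq_mul] at h3 h4
    linarith
  obtain ⟨t, ht⟩ := hgood
  set c : ι → ℤ := fun i => if i ∈ J t then u t i else 0 with hc
  have h1 := htail x
  have h2 := htail (u t)
  -- Truncation at most doubles the error, up to the tail, because `XS` is `k`-sparse as well.
  have h3 : norm1 U (fun i => X i - c i) ≤ 2 * norm1 U (fun i => X i - u t i) + norm1 U e := by
    have a1 := norm1_sub_le U X (u t) c
    have a2 := (hJ t).norm1_le hS (y := XS) (fun i _ hi => by simp [hXS, hi])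
    rw [norm1_neg U (u t) XS] at a2
    linarith
  -- The bucket sums compare `x'` with the good candidate `c`: the lower bound applies to
  -- `XS - x'`, which is `2 k`-sparse, and the upper bound to all vectors.
  have h4 : normBuckets U Z H (fun i => XS i - x' i) ≤
      normBuckets U Z H (fun i => X i - x' i) + Fintype.card τ * norm1 U e := by
    refine le_trans ?_ (add_le_add_right (normBuckets_le U Z H hH e) _)
    rw [normBuckets, normBuckets, normBuckets, ← Finset.sum_add_distrib]
    refine Finset.sum_le_sum fun t _ => ?_
    rw [← Finset.sum_add_distrib]
    refine Finset.sum_le_sum fun z _ => ?_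
    have : ∑ i ∈ bucket U (H t) z, (XS i - x' i) =
        ∑ i ∈ bucket U (H t) z, (X i - x' i) - ∑ i ∈ bucket U (H t) z, e i := by
      rw [← Finset.sum_sub_distrib]
      exact Finset.sum_congr rfl fun i _ => by rw [hXe i]; ring
    rw [this]
    exact abs_sub _ _
  have h5 := hE.le_normBuckets hH (hcard A' hA') (hsupp x' A' hx')
  have h6 := normBuckets_le U Z H hH fun i => X i - c i
  have h7 := hbest t
  have h8 : norm1 U (fun i => X i - x' i) ≤ norm1 U (fun i => XS i - x' i) + norm1 U e := by
    have := norm1_sub_le U X XS x'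
    have h2 : norm1 U (fun i => X i - XS i) = norm1 U e :=
      Finset.sum_congr rfl fun i _ => by dsimp only; rw [hXe i]; simp
    linarith
  have hD : (0 : ℤ) < Fintype.card τ := by exact_mod_cast Fintype.card_pos
  have h9 : 15 * norm1 U (fun i => XS i - x' i) ≤
      16 * norm1 U (fun i => X i - c i) + 16 * norm1 U e := by
    have : (Fintype.card τ : ℤ) * (15 * norm1 U (fun i => XS i - x' i)) ≤
        Fintype.card τ * (16 * norm1 U (fun i => X i - c i) + 16 * norm1 U e) := by linarith
    exact le_of_mul_le_mul_left this hD
  have h10 := norm1_nonneg U e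
  have h11 := norm1_nonneg U fun i => X i - x i
  linarith

end geometry

/-! ### Correctness of the recovery procedure -/

/-- The sign `(-1) ^ b'`, where `b'` is the bit at the position `b` of `0, i`. -/
def signAt (i : List Bool) (b : ℕ) : ℤ := if (false :: i).getD b false then -1 else 1

@[simp] theorem signAt_zero (i : List Bool) : signAt i 0 = 1 := rfl

theorem abs_signAt (i : List Bool) (b : ℕ) : |signAt i b| = 1 := by
  rw [signAt]
  split_ifs <;> simp

/-- The hash function given by a matrix. -/
abbrev hashOf (r : ℕ) (m : Meas) (i : List Bool) : List Bool := hashB (zeros r) m.1 i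

/-- `m` holds the bucket sums of `X` and of its sign modulations. -/
def Measures (n r : ℕ) (X : List Bool → ℤ) (m : Meas) : Prop :=
  ∀ z ∈ keys r, ∀ b ≤ n, evalAt m.2 z b = ∑ i ∈ bucket (keys n) (hashOf r m) z, signAt i b * X i

theorem hashOf_mem {n r N : ℕ} {m : Meas} (hm : IsMeas n r N m) (i : List Bool) :
    hashOf r m i ∈ keys r := mem_keys.2 (length_hashB (by simp) hm.1.2)

theorem getD_contrib {n r : ℕ} {cols : List (List Bool)} {p : Item} (hp : p.1.length = n)
    {b : ℕ} (hb : b ≤ n) : (contrib r cols p).2.getD b 0 = -(signAt p.1 b * p.2.getD 0 0) := by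
  have hlt : b < (false :: p.1).length := by simp [hp]; omega
  have h0 : p.2.headD 0 = p.2.getD 0 0 := by cases p.2 <;> rfl
  rw [contrib, signAt, List.getD_eq_getElem _ _ (by simpa using hlt), List.getElem_map,
    List.getD_eq_getElem _ _ hlt, ← h0]
  cases (false :: p.1)[b] <;> simp

theorem evalAt_contribs {n r : ℕ} {m : Meas} {x : List Item}
    (hx : HasDims n 1 x) {z : List Bool} {b : ℕ} (hb : b ≤ n) :
    evalAt (x.map (contrib r m.1)) z b =
      -∑ i ∈ bucket (keys n) (hashOf r m) z, signAt i b * evalAt x i 0 := by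
  induction x with
  | nil => simp
  | cons p x ih =>
    have hp := hx p (by simp)
    rw [List.map_cons, evalAt_cons, ih fun q hq => hx q (by simp [hq]), getD_contrib hp.1 hb]
    simp only [evalAt_cons, mul_add, Finset.sum_add_distrib, neg_add]
    congr 1
    have h1 : ∀ i ∈ bucket (keys n) (hashOf r m) z,
        signAt i b * (if p.1 = i then p.2.getD 0 0 else 0) =
          if p.1 = i then signAt p.1 b * p.2.getD 0 0 else 0 := by
      intro i _
      split_ifs with h
      · rw [h]
      · simp
    rw [Finset.sum_congr rfl h1, Finset.sum_ite_eq]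
    have h2 : p.1 ∈ bucket (keys n) (hashOf r m) z ↔ (contrib r m.1 p).1 = z := by
      rw [bucket, Finset.mem_filter, mem_keys]
      exact and_iff_right hp.1
    simp only [h2]
    split_ifs <;> simp

theorem evalAt_resid {n r N : ℕ} {X : List Bool → ℤ} {m : Meas} (hm : IsMeas n r N m)
    (hX : Measures n r X m) {x : List Item} (hx : IsSig n N x) {z : List Bool} (hz : z ∈ keys r)
    {b : ℕ} (hb : b ≤ n) : evalAt (resid r m x) z b =
      ∑ i ∈ bucket (keys n) (hashOf r m) z, signAt i b * (X i - evalAt x i 0) := by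
  rw [resid, evalAt_aggregate (foldl_contrib hm hx).1, foldl_cons_map, evalAt_append,
    evalAt_perm (List.reverse_perm _), evalAt_contribs hx.1 hb, hX z hz b hb]
  simp only [mul_sub, Finset.sum_sub_distrib]
  ring

theorem resid_nodup {n r N : ℕ} {m : Meas} (hm : IsMeas n r N m) {x : List Item}
    (hx : IsSig n N x) : ((resid r m x).map Prod.fst).Nodup :=
  aggregate_nodup (foldl_contrib hm hx).1

theorem abs_sum_bucket_le {n : ℕ} (H : List Bool → List Bool) (z : List Bool)
    (w : List Bool → ℤ) (b : ℕ) :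
    |∑ i ∈ bucket (keys n) H z, signAt i b * w i| ≤ norm1 (keys n) w := by
  refine (Finset.abs_sum_le_sum_abs _ _).trans ?_
  rw [norm1]
  refine le_trans (le_of_eq (Finset.sum_congr rfl fun i _ => ?_))
    (Finset.sum_le_sum_of_subset_of_nonneg (Finset.filter_subset _ _) fun _ _ _ => abs_nonneg _)
  rw [abs_mul, abs_signAt, one_mul]

theorem headD_eq_getD (v : List ℤ) : v.headD 0 = v.getD 0 0 := by cases v <;> rfl

section

variable {n r N W k : ℕ} {X : List Bool → ℤ} {m : Meas} {x : List Item}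

theorem normStep_eq (hm : IsMeas n r N m) (hX : Measures n r X m) (hx : IsSig n N x)
    (hW : norm1 (keys n) (fun i => X i - evalAt x i 0) < 2 ^ W) (acc : ℤ) :
    normStep (W + 1) r x acc m =
      acc + ∑ z ∈ keys r, |∑ i ∈ bucket (keys n) (hashOf r m) z, (X i - evalAt x i 0)| := by
  have h1 : ∀ p ∈ resid r m x, absW (W + 1) (p.2.headD 0) = |p.2.getD 0 0| := by
    intro p hp
    have hk := mem_keys.2 ((resid_hasDims hm hx).1 p hp).1
    rw [headD_eq_getD, absW_eq]
    rw [← evalAt_of_mem (resid_nodup hm hx) hp, evalAt_resid hm hX hx hk (Nat.zero_le _)]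
    exact (abs_sum_bucket_le _ _ _ _).trans_lt hW
  have h2 : ∀ (l : List Item) (acc : ℤ), (∀ p ∈ l, absW (W + 1) (p.2.headD 0) = |p.2.getD 0 0|) →
      l.foldl (fun acc p => absW (W + 1) (p.2.headD 0) + acc) acc =
        acc + (l.map fun p => |p.2.getD 0 0|).sum := by
    intro l
    induction l with
    | nil => simp
    | cons p l ih =>
      intro acc h
      rw [List.foldl_cons, ih _ fun q hq => h q (by simp [hq]), h p (by simp), List.map_cons,
        List.sum_cons]
      ring
  rw [normStep, h2 _ _ h1, sum_map_eq_sum_keys (resid_hasDims hm hx).1 (resid_nodup hm hx) 0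
    (fun _ v => |v|) (by simp)]
  congr 1
  refine Finset.sum_congr rfl fun z hz => ?_
  rw [evalAt_resid hm hX hx hz (Nat.zero_le _)]
  simp

theorem normW_eq {ms : List Meas} (hm : ∀ m ∈ ms, IsMeas n r N m)
    (hX : ∀ m ∈ ms, Measures n r X m) (hx : IsSig n N x)
    (hW : norm1 (keys n) (fun i => X i - evalAt x i 0) < 2 ^ W) :
    normW (W + 1) r ms x = normBuckets (keys n) (keys r)
      (fun t : Fin ms.length => hashOf r ms[t]) fun i => X i - evalAt x i 0 := by
  have h : ∀ (ms' : List Meas) (acc : ℤ), (∀ m ∈ ms', m ∈ ms) →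
      ms'.foldl (normStep (W + 1) r x) acc = acc + (ms'.map fun m => ∑ z ∈ keys r,
        |∑ i ∈ bucket (keys n) (hashOf r m) z, (X i - evalAt x i 0)|).sum := by
    intro ms'
    induction ms' with
    | nil => simp
    | cons m ms' ih =>
      intro acc h
      have hmm := h m (by simp)
      rw [List.foldl_cons, ih _ fun q hq => h q (by simp [hq]),
        normStep_eq (hm m hmm) (hX m hmm) hx hW, List.map_cons, List.sum_cons]
      ring
  rw [normW, h ms 0 fun _ h => h, zero_add, normBuckets, ← Fin.sum_univ_fun_getElem]
  rfl

/-- The position decoded from a bucket. -/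
def decodeAt (W n : ℕ) (R : List Item) (z : List Bool) : List Bool :=
  (List.range n).map fun b => msb W (evalAt R z 0) ^^ msb W (evalAt R z (b + 1))

theorem decodeItem_eq (hm : IsMeas n r N m) (hx : IsSig n N x) {p : Item}
    (hp : p ∈ resid r m x) : decodeItem W p = (decodeAt W n (resid r m x) p.1, [p.2.getD 0 0]) := by
  have hl := ((resid_hasDims hm hx).1 p hp).2
  rw [decodeItem, headD_eq_getD, decodeAt]
  refine Prod.ext ?_ rfl
  refine List.ext_getElem (by simp [hl]) fun b h1 h2 => ?_
  simp only [List.length_map, List.length_range] at h2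
  rw [List.getElem_map, List.getElem_map, List.getElem_range, List.getElem_tail,
    evalAt_of_mem (resid_nodup hm hx) hp, evalAt_of_mem (resid_nodup hm hx) hp,
    List.getD_eq_getElem _ _ (by omega : b + 1 < p.2.length)]

theorem evalAt_decoded (hm : IsMeas n r N m) (hX : Measures n r X m) (hx : IsSig n N x)
    (j : List Bool) :
    evalAt (x ++ (resid r m x).map (decodeItem W)) j 0 = evalAt x j 0 + ∑ z ∈ keys r,
      if decodeAt W n (resid r m x) z = j then
        ∑ i ∈ bucket (keys n) (hashOf r m) z, (X i - evalAt x i 0) else 0 := by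
  rw [evalAt_append]
  congr 1
  have h1 : evalAt ((resid r m x).map (decodeItem W)) j 0 = ((resid r m x).map fun p =>
      if decodeAt W n (resid r m x) p.1 = j then p.2.getD 0 0 else 0).sum := by
    rw [evalAt, List.map_map]
    congr 1
    refine List.map_congr_left fun p hp => ?_
    rw [Function.comp_apply, decodeItem_eq hm hx hp]
    rfl
  rw [h1, sum_map_eq_sum_keys (resid_hasDims hm hx).1 (resid_nodup hm hx) 0
    (fun z v => if decodeAt W n (resid r m x) z = j then v else 0) (by simp)]
  refine Finset.sum_congr rfl fun z hz => ?_
  rw [evalAt_resid hm hX hx hz (Nat.zero_le _)]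
  simp

/-- An entry that outweighs the rest of its bucket dictates the signs of the measurements of the
bucket, so that its position is decoded correctly. -/
theorem decodeAt_eq (hm : IsMeas n r N m) (hX : Measures n r X m) (hx : IsSig n N x)
    (hW : norm1 (keys n) (fun i => X i - evalAt x i 0) < 2 ^ W) {z : List Bool} (hz : z ∈ keys r)
    {i : List Bool} (hi : i ∈ bucket (keys n) (hashOf r m) z)
    (hdom : ∑ j ∈ (bucket (keys n) (hashOf r m) z).erase i, |X j - evalAt x j 0| <
      |X i - evalAt x i 0|) : decodeAt (W + 1) n (resid r m x) z = i := by
  set w : List Bool → ℤ := fun i => X i - evalAt x i 0 with hw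
  have hin : i.length = n := mem_keys.1 (Finset.mem_filter.1 hi).1
  have hsign : ∀ b ≤ n, msb (W + 1) (evalAt (resid r m x) z b) = decide (signAt i b * w i < 0) := by
    intro b hb
    rw [evalAt_resid hm hX hx hz hb, msb_eq _ _ ((abs_sum_bucket_le _ _ _ _).trans_lt hW),
      ← Finset.add_sum_erase _ _ hi]
    have h1 : |∑ j ∈ (bucket (keys n) (hashOf r m) z).erase i, signAt j b * w j| <
        |signAt i b * w i| := by
      refine (Finset.abs_sum_le_sum_abs _ _).trans_lt ?_
      rw [abs_mul, abs_signAt, one_mul]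
      refine lt_of_le_of_lt (le_of_eq (Finset.sum_congr rfl fun j _ => ?_)) hdom
      rw [abs_mul, abs_signAt, one_mul]
    refine decide_eq_decide.2 ?_
    change signAt i b * w i + ∑ j ∈ (bucket (keys n) (hashOf r m) z).erase i, signAt j b * w j < 0 ↔
      signAt i b * w i < 0
    generalize ∑ j ∈ (bucket (keys n) (hashOf r m) z).erase i, signAt j b * w j = s at h1
    generalize signAt i b * w i = a at h1
    rw [abs_lt] at h1
    rcases abs_cases a with h | h <;> constructor <;> intro h' <;> omega
  have hwi : w i ≠ 0 := by
    intro h0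
    have h1 := Finset.sum_nonneg fun j (_ : j ∈ (bucket (keys n) (hashOf r m) z).erase i) =>
      abs_nonneg (w j)
    change _ < |w i| at hdom
    rw [h0, abs_zero] at hdom
    exact absurd (h1.trans_lt hdom) (lt_irrefl _)
  rw [decodeAt]
  refine List.ext_getElem (by simp [hin]) fun b h1 h2 => ?_
  rw [List.getElem_map, List.getElem_range, hsign 0 (Nat.zero_le _), hsign (b + 1) (by omega),
    signAt_zero, signAt, List.getD_cons_succ, List.getD_eq_getElem _ _ h2]
  rcases lt_or_gt_of_ne hwi with h | h
  · cases i[b] <;> simp [h, h.le]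
  · cases i[b] <;> simp [h, h.le]

theorem valB_bz (W : ℕ) (z : ℤ) (h0 : 0 ≤ z) (h : z < 2 ^ W) : (valB (bz W z) : ℤ) = z := by
  induction W generalizing z with
  | zero =>
    rw [pow_zero] at h
    have : z = 0 := by omega
    simp [bz, valB, this]
  | succ W ih =>
    rw [pow_succ] at h
    have := ih (z / 2) (by omega) (by omega)
    simp only [bz, valB]
    push_cast
    rw [this]
    rcases Int.emod_two_eq_zero_or_one z with h | h <;> simp [h] <;> omega

theorem topk_eq {l : List Item} (hl : HasDims n 1 l) (hn : (l.map Prod.fst).Nodup)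
    (hW : ∀ p ∈ l, |p.2.getD 0 0| < 2 ^ W) :
    ∃ J, IsTop (keys n) k (fun i => evalAt l i 0) J ∧
      ∀ i, evalAt (topk (W + 1) k l) i 0 = if i ∈ J then evalAt l i 0 else 0 := by
  set key : Item → List Bool := fun p => bz (W + 1) (absW (W + 1) (p.2.headD 0)) with hkey
  set s := (radixPass^[W + 1] (l.map fun p => (key p, p))).map Prod.snd with hs
  have hperm : s.Perm l := radixSort_perm key (W + 1) l
  have hsort : s.Pairwise fun a b => |b.2.getD 0 0| ≤ |a.2.getD 0 0| := by
    refine (radixSort_sorted key (W + 1) l fun a _ => length_bz _ _).imp_of_mem ?_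
    intro a b ha hb hab
    have hv : ∀ p ∈ s, (valB (key p) : ℤ) = |p.2.getD 0 0| := by
      intro p hp
      have := hW p (hperm.subset hp)
      simp only [hkey]
      rw [headD_eq_getD, absW_eq _ _ this, valB_bz _ _ (abs_nonneg _)]
      exact this.trans (pow_lt_pow_right₀ (by norm_num) (Nat.lt_succ_self _))
    rw [← hv a ha, ← hv b hb]
    exact_mod_cast hab
  have hsn : (s.map Prod.fst).Nodup := (hperm.map Prod.fst).nodup_iff.2 hn
  have hdims : HasDims n 1 s := hl.perm hperm
  have htop : (topk (W + 1) k l).Perm (s.take k) := by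
    rw [topk, List.map_reverse, List.map_take]
    exact List.reverse_perm _
  have hev : ∀ i, evalAt l i 0 = evalAt s i 0 := fun i => (evalAt_perm hperm i 0).symm
  have hsplit := List.take_append_drop k s
  have htn : ((s.take k).map Prod.fst).Nodup := by
    rw [List.map_take]
    exact hsn.sublist (List.take_sublist _ _)
  have hcard : ((s.take k).map Prod.fst).toFinset.card = min k s.length := by
    rw [List.toFinset_card_of_nodup htn]
    simp
  have hmem : ∀ i, i ∈ ((s.take k).map Prod.fst).toFinset ↔ ∃ p ∈ s.take k, p.1 = i := by
    intro i
    rw [List.mem_toFinset, List.mem_map]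
  refine ⟨((s.take k).map Prod.fst).toFinset, ⟨?_, by omega, ?_⟩, ?_⟩
  · intro i hi
    obtain ⟨p, hp, rfl⟩ := (hmem i).1 hi
    exact mem_keys.2 (hdims p (List.mem_of_mem_take hp)).1
  · rcases le_or_gt s.length k with hk | hk
    · refine Or.inl fun j _ hj => ?_
      rw [List.take_of_length_le hk, List.mem_toFinset] at hj
      simp only [hev]
      exact evalAt_of_notMem hj 0
    · refine Or.inr ⟨by omega, fun i hi j _ hj => ?_⟩
      obtain ⟨p, hp, rfl⟩ := (hmem i).1 hi
      simp only [hev]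
      rw [evalAt_of_mem hsn (List.mem_of_mem_take hp)]
      by_cases hjs : j ∈ s.map Prod.fst
      · obtain ⟨q, hq, rfl⟩ := List.mem_map.1 hjs
        rw [evalAt_of_mem hsn hq]
        rw [← hsplit, List.mem_append] at hq
        rcases hq with hq | hq
        · exact absurd ((hmem _).2 ⟨q, hq, rfl⟩) hj
        · rw [← hsplit, List.pairwise_append] at hsort
          exact hsort.2.2 p hp q hq
      · rw [evalAt_of_notMem hjs, abs_zero]
        exact abs_nonneg _
  · intro i
    rw [evalAt_perm htop, hev]
    split_ifs with hi
    · obtain ⟨p, hp, rfl⟩ := (hmem i).1 hi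
      rw [evalAt_of_mem htn hp, evalAt_of_mem hsn (List.mem_of_mem_take hp)]
    · refine evalAt_of_notMem (fun h => hi ?_) 0
      rwa [List.mem_toFinset]

theorem norm1_sum_ite_le {κ : Type} (U : Finset (List Bool)) (Z : Finset κ)
    (dec : κ → List Bool) (F : κ → ℤ) :
    norm1 U (fun j => ∑ z ∈ Z, if dec z = j then F z else 0) ≤ ∑ z ∈ Z, |F z| := by
  rw [norm1]
  refine (Finset.sum_le_sum fun j _ => Finset.abs_sum_le_sum_abs _ _).trans ?_
  rw [Finset.sum_comm]
  refine Finset.sum_le_sum fun z _ => ?_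
  have : ∀ j ∈ U, |if dec z = j then F z else 0| = if dec z = j then |F z| else 0 :=
    fun j _ => by split_ifs <;> simp
  rw [Finset.sum_congr rfl this, Finset.sum_ite_eq]
  split_ifs
  · exact le_rfl
  · exact abs_nonneg _

/-- The candidate consists of the largest entries of the current approximation plus the decoded
residual, and its size is under control. -/
theorem cand_eq (hm : IsMeas n r N m) (hX : Measures n r X m) (hx : IsSig n N x)
    (hW : norm1 (keys n) X + 2 * norm1 (keys n) (fun i => X i - evalAt x i 0) < 2 ^ W) :
    ∃ J, IsTop (keys n) k
        (fun i => evalAt (x ++ (resid r m x).map (decodeItem (W + 1))) i 0) J ∧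
      (∀ i, evalAt (cand (W + 1) k n r m x) i 0 =
        if i ∈ J then evalAt (x ++ (resid r m x).map (decodeItem (W + 1))) i 0 else 0) ∧
      norm1 (keys n) (fun i => X i - evalAt (cand (W + 1) k n r m x) i 0) ≤
        2 * norm1 (keys n) X + 2 * norm1 (keys n) fun i => X i - evalAt x i 0 := by
  have hd := (candInput_hasDims (W := W + 1) hm hx).1
  set l := x ++ (resid r m x).map (decodeItem (W + 1)) with hl
  set u : List Bool → ℤ := fun i => evalAt l i 0 with hu
  have hnorm : norm1 (keys n) u ≤
      norm1 (keys n) X + 2 * norm1 (keys n) (fun i => X i - evalAt x i 0) := by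
    have h1 : norm1 (keys n) u ≤ norm1 (keys n) (fun i => evalAt x i 0) +
        norm1 (keys n) (fun i => X i - evalAt x i 0) := by
      have e : u = fun j => evalAt x j 0 + ∑ z ∈ keys r,
          if decodeAt (W + 1) n (resid r m x) z = j then
          ∑ i ∈ bucket (keys n) (hashOf r m) z, (X i - evalAt x i 0) else 0 :=
        funext fun j => evalAt_decoded hm hX hx j
      rw [e]
      refine (norm1_add_le _ _ _).trans (add_le_add_right ((norm1_sum_ite_le _ _ _ _).trans ?_) _)
      have := normBuckets_le (τ := Unit) (keys n) (keys r) (fun _ => hashOf r m)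
        (fun _ i _ => hashOf_mem hm i) (fun i => X i - evalAt x i 0)
      simpa [normBuckets] using this
    have h2 : norm1 (keys n) (fun i => evalAt x i 0) ≤ norm1 (keys n) X +
        norm1 (keys n) (fun i => X i - evalAt x i 0) := by
      have := norm1_add_le (keys n) X (fun i => -(X i - evalAt x i 0))
      refine le_trans (le_of_eq ?_) (this.trans (le_of_eq ?_))
      · simp
      · congr 1
        exact Finset.sum_congr rfl fun i _ => abs_neg _
    linarith
  have hag : ∀ i b, evalAt (aggregate n l) i b = evalAt l i b := fun i b => evalAt_aggregate hd i b
  obtain ⟨J, hJ, hJe⟩ := topk_eq (k := k) (W := W) (aggregate_hasDims hd) (aggregate_nodup hd)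
    (fun p hp => by
      rw [← evalAt_of_mem (aggregate_nodup hd) hp, hag]
      refine lt_of_le_of_lt (le_trans ?_ hnorm) hW
      exact Finset.single_le_sum (f := fun i => |u i|) (fun _ _ => abs_nonneg _)
        (mem_keys.2 (aggregate_hasDims hd p hp).1))
  simp only [hag] at hJ hJe
  refine ⟨J, hJ, hJe, ?_⟩
  have h3 : norm1 (keys n) (fun i => evalAt (cand (W + 1) k n r m x) i 0) ≤ norm1 (keys n) u := by
    refine Finset.sum_le_sum fun i _ => ?_
    have := hJe i
    change |evalAt (topk (W + 1) k (aggregate n l)) i 0| ≤ |u i|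
    rw [this]
    split_ifs
    · exact le_rfl
    · rw [abs_zero]
      exact abs_nonneg _
  have h4 := norm1_add_le (keys n) X (fun i => -evalAt (cand (W + 1) k n r m x) i 0)
  have h5 : norm1 (keys n) (fun i => -evalAt (cand (W + 1) k n r m x) i 0) =
      norm1 (keys n) (fun i => evalAt (cand (W + 1) k n r m x) i 0) :=
    Finset.sum_congr rfl fun i _ => abs_neg _
  simp only [← sub_eq_add_neg] at h4
  linarith

end

/-- The keys occurring in a list of items. -/
theorem evalAt_support {k n : ℕ} {y : List Item} (hy : IsSig n k y) :
    ∃ A : Finset (List Bool), A.card ≤ k ∧ ∀ i ∈ keys n, i ∉ A → evalAt y i 0 = 0 := by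
  refine ⟨(y.map Prod.fst).toFinset, ?_, fun i _ hi => ?_⟩
  · refine (List.toFinset_card_le _).trans ?_
    rw [List.length_map]
    exact hy.2
  · rw [List.mem_toFinset] at hi
    exact evalAt_of_notMem hi 0

theorem IsSig.mono {n N N' : ℕ} {x : List Item} (h : IsSig n N x) (hN : N ≤ N') : IsSig n N' x :=
  ⟨h.1, h.2.trans hN⟩

section

variable {n r N W k : ℕ} {X : List Bool → ℤ} {ms : List Meas} {x : List Item}

/-- A round returns an approximation that is, as measured by the bucket sums, at least as good as
all candidates. -/
theorem round_eq (hk : k ≤ N) (hm : ∀ m ∈ ms, IsMeas n r N m) (hX : ∀ m ∈ ms, Measures n r X m)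
    (hx : IsSig n k x) (hW : (ms.length + 1) * (2 * norm1 (keys n) X +
      2 * norm1 (keys n) fun i => X i - evalAt x i 0) < 2 ^ W) {nrm : ℤ}
    (hnrm : nrm = normBuckets (keys n) (keys r) (fun t : Fin ms.length => hashOf r ms[t])
      fun i => X i - evalAt x i 0) :
    ∃ y, IsSig n k y ∧ round (W + 1) k n r ms (nrm, x) =
        (normBuckets (keys n) (keys r) (fun t : Fin ms.length => hashOf r ms[t])
          fun i => X i - evalAt y i 0, y) ∧
      ∀ m ∈ ms, (normBuckets (keys n) (keys r) (fun t : Fin ms.length => hashOf r ms[t])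
          fun i => X i - evalAt y i 0) ≤
        normBuckets (keys n) (keys r) (fun t : Fin ms.length => hashOf r ms[t])
          fun i => X i - evalAt (cand (W + 1) k n r m x) i 0 := by
  set NB : List Item → ℤ := fun y => normBuckets (keys n) (keys r)
    (fun t : Fin ms.length => hashOf r ms[t]) fun i => X i - evalAt y i 0 with hNB
  set B := 2 * norm1 (keys n) X + 2 * norm1 (keys n) fun i => X i - evalAt x i 0 with hB
  have hX0 := norm1_nonneg (keys n) X
  have hx0 := norm1_nonneg (keys n) fun i => X i - evalAt x i 0
  have hlen : (0 : ℤ) ≤ ms.length := by positivity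
  have hBW : B < 2 ^ W := lt_of_le_of_lt (by nlinarith) hW
  have hNBle : ∀ y, norm1 (keys n) (fun i => X i - evalAt y i 0) ≤ B → 0 ≤ NB y ∧
      NB y < 2 ^ W := by
    intro y hy
    refine ⟨Finset.sum_nonneg fun _ _ => Finset.sum_nonneg fun _ _ => abs_nonneg _, ?_⟩
    have := normBuckets_le (keys n) (keys r) (fun t : Fin ms.length => hashOf r ms[t])
      (fun t i _ => hashOf_mem (hm _ (List.getElem_mem _)) i) fun i => X i - evalAt y i 0
    rw [Fintype.card_fin] at this
    have h2 := mul_le_mul_of_nonneg_left hy hlen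
    exact lt_of_le_of_lt (by linarith) hW
  have hcand : ∀ m ∈ ms, IsSig n k (cand (W + 1) k n r m x) ∧
      norm1 (keys n) (fun i => X i - evalAt (cand (W + 1) k n r m x) i 0) ≤ B := by
    intro m hmm
    refine ⟨topk_isSig (aggregate_hasDims (candInput_hasDims (hm m hmm) (hx.mono hk)).1) le_rfl, ?_⟩
    obtain ⟨_, _, _, h⟩ := cand_eq (k := k) (W := W) (hm m hmm) (hX m hmm) (hx.mono hk)
      (lt_of_le_of_lt (by linarith) hBW)
    exact h
  have key : ∀ (ms' : List Meas) (y : List Item), (∀ m ∈ ms', m ∈ ms) → IsSig n k y →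
      norm1 (keys n) (fun i => X i - evalAt y i 0) ≤ B →
      ∃ y', IsSig n k y' ∧ ms'.foldl (roundStep (W + 1) k n r ms x) (NB y, y) = (NB y', y') ∧
        NB y' ≤ NB y ∧ ∀ m ∈ ms', NB y' ≤ NB (cand (W + 1) k n r m x) := by
    intro ms'
    induction ms' with
    | nil => exact fun y _ hy _ => ⟨y, hy, rfl, le_rfl, by simp⟩
    | cons m ms' ih =>
      intro y hsub hy hyB
      have hmm := hsub m (by simp)
      obtain ⟨hc, hcB⟩ := hcand m hmm
      have hnc : normW (W + 1) r ms (cand (W + 1) k n r m x) = NB (cand (W + 1) k n r m x) :=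
        normW_eq hm hX (hc.mono hk) (hcB.trans_lt hBW)
      have h1 := hNBle y hyB
      have h2 := hNBle _ hcB
      have hstep : roundStep (W + 1) k n r ms x (NB y, y) m =
          if NB (cand (W + 1) k n r m x) < NB y then
            (NB (cand (W + 1) k n r m x), cand (W + 1) k n r m x) else (NB y, y) := by
        rw [roundStep, hnc, msb_eq _ _ (abs_lt.2 ⟨by linarith, by linarith⟩)]
        simp only [decide_eq_true_eq, sub_neg]
      rw [List.foldl_cons, hstep]
      split_ifs with hlt
      · obtain ⟨y', hy', he, hle, hall⟩ := ih _ (fun q hq => hsub q (by simp [hq])) hc hcB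
        refine ⟨y', hy', he, hle.trans hlt.le, fun q hq => ?_⟩
        rcases List.mem_cons.1 hq with rfl | hq
        · exact hle
        · exact hall q hq
      · obtain ⟨y', hy', he, hle, hall⟩ := ih y (fun q hq => hsub q (by simp [hq])) hy hyB
        refine ⟨y', hy', he, hle, fun q hq => ?_⟩
        rcases List.mem_cons.1 hq with rfl | hq
        · exact hle.trans (not_lt.1 hlt)
        · exact hall q hq
  obtain ⟨y, hy, he, _, hall⟩ := key ms x (fun _ h => h) hx (by linarith)
  exact ⟨y, hy, by rw [round, hnrm]; exact he, hall⟩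

/-- The recovery procedure is correct: the error decreases geometrically to a multiple of the tail,
and since all numbers are integers it ends up below this multiple. -/
theorem recover_norm1_le (hms : ms ≠ []) (hk : k ≤ N) (hm : ∀ m ∈ ms, IsMeas n r N m)
    (hX : ∀ m ∈ ms, Measures n r X m)
    (hE : IsExpander (keys n) (2 * k) fun t : Fin ms.length => hashOf r ms[t])
    (hW : (ms.length + 1) * (60 * norm1 (keys n) X) < 2 ^ W) {s : ℕ}
    (hs : norm1 (keys n) X < 2 ^ s) {S : Finset (List Bool)} (hS : S.card ≤ k) :
    norm1 (keys n) (fun i => X i - evalAt (recover (W + 1) k n r ms s) i 0) ≤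
      24 * norm1 (keys n) fun i => if i ∈ S then 0 else X i := by
  set E := norm1 (keys n) fun i => if i ∈ S then 0 else X i with hEdef
  have hE0 : 0 ≤ E := norm1_nonneg _ _
  have hEX : E ≤ norm1 (keys n) X := Finset.sum_le_sum fun i _ => by
    dsimp only
    split_ifs
    · rw [abs_zero]
      exact abs_nonneg _
    · exact le_rfl
  have hX0 := norm1_nonneg (keys n) X
  have : Nonempty (Fin ms.length) := ⟨⟨0, List.length_pos_iff.2 hms⟩⟩
  have hlen : (0 : ℤ) ≤ ms.length := by positivity
  have key : ∀ s : ℕ, ∃ x, IsSig n k x ∧ (round (W + 1) k n r ms)^[s] (normW (W + 1) r ms [], []) =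
      (normBuckets (keys n) (keys r) (fun t : Fin ms.length => hashOf r ms[t])
        fun i => X i - evalAt x i 0, x) ∧
      2 ^ s * (norm1 (keys n) (fun i => X i - evalAt x i 0) - 24 * E) ≤ norm1 (keys n) X := by
    intro s
    induction s with
    | zero =>
      have h0 : IsSig n N [] := ⟨fun p hp => by simp at hp, by simp⟩
      refine ⟨[], ⟨fun p hp => by simp at hp, by simp⟩, ?_, ?_⟩
      · rw [Function.iterate_zero, id, normW_eq hm hX h0]
        simp only [evalAt_nil, sub_zero]
        refine lt_of_le_of_lt ?_ hW
        change norm1 (keys n) X ≤ _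
        nlinarith
      · simp only [evalAt_nil, sub_zero, pow_zero, one_mul]
        change norm1 (keys n) X - _ ≤ _
        linarith
    | succ s ih =>
      obtain ⟨x, hx, he, hle⟩ := ih
      -- The residual stays bounded, so that no intermediate result overflows the word length.
      have hxn : norm1 (keys n) (fun i => X i - evalAt x i 0) ≤ 25 * norm1 (keys n) X := by
        have h1 : (1 : ℤ) ≤ 2 ^ s := one_le_pow₀ (by norm_num)
        by_contra! hcon
        have : norm1 (keys n) X <
            1 * (norm1 (keys n) (fun i => X i - evalAt x i 0) - 24 * E) := by linarith
        nlinarith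
      have hx0 := norm1_nonneg (keys n) fun i => X i - evalAt x i 0
      have hWx : (ms.length + 1) * (2 * norm1 (keys n) X +
          2 * norm1 (keys n) fun i => X i - evalAt x i 0) < 2 ^ W :=
        lt_of_le_of_lt (mul_le_mul_of_nonneg_left (by linarith) (by linarith)) hW
      have hWs : norm1 (keys n) X + 2 * norm1 (keys n) (fun i => X i - evalAt x i 0) < 2 ^ W :=
        lt_of_le_of_lt (by nlinarith) hWx
      obtain ⟨y, hy, hey, hall⟩ := round_eq hk hm hX hx hWx rfl
      refine ⟨y, hy, by rw [Function.iterate_succ_apply', he, hey], ?_⟩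
      obtain ⟨A, hA, hxA⟩ := evalAt_support hx
      obtain ⟨A', hA', hyA⟩ := evalAt_support hy
      have hmt : ∀ t : Fin ms.length, ms[t] ∈ ms := fun t => List.getElem_mem _
      have hc := fun t : Fin ms.length => cand_eq (k := k) (hm _ (hmt t)) (hX _ (hmt t))
        (hx.mono hk) hWs
      choose J hJ hJe _ using hc
      have hr := hE.round_le (Z := keys r) (fun t i _ => hashOf_mem (hm _ (hmt t)) i) hS hA hxA
        (fun t z => decodeAt (W + 1) n (resid r ms[t] x) z)
        (fun t z hz i hi hdom => decodeAt_eq (hm _ (hmt t)) (hX _ (hmt t)) (hx.mono hk)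
          (lt_of_le_of_lt (by linarith) hWs) hz hi hdom)
        (fun t j => evalAt (x ++ (resid r ms[t] x).map (decodeItem (W + 1))) j 0)
        (fun t j _ => evalAt_decoded (hm _ (hmt t)) (hX _ (hmt t)) (hx.mono hk) j)
        J hJ hA' hyA (fun t => by
          have := hall _ (hmt t)
          simp only [hJe] at this
          exact this)
      rw [pow_succ]
      have h2 : (0 : ℤ) ≤ 2 ^ s := by positivity
      nlinarith
  obtain ⟨x, _, he, hle⟩ := key s
  rw [recover, he]
  by_contra! hcon
  have h2 : (0 : ℤ) < 2 ^ s := by positivity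
  -- An integer that exceeds the bound exceeds it by at least one.
  have h3 : (1 : ℤ) ≤ norm1 (keys n) (fun i => X i - evalAt x i 0) - 24 * E := by
    simp only at hcon
    omega
  nlinarith

end

/-! ### Fast Walsh-Hadamard transform -/

/-- The sign `(-1) ^ c`. -/
def sg (c : Bool) : ℤ := if c then -1 else 1

theorem sg_xor (a b : Bool) : sg (a ^^ b) = sg a * sg b := by
  cases a <;> cases b <;> rfl

theorem abs_sg (a : Bool) : |sg a| = 1 := by
  cases a <;> rfl

/-- Replace the first bit of the key by a transformed bit at its end. -/
def whtStep (acc : List Item) (p : Item) : List Item :=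
  (p.1.tail ++ [false], p.2) ::
    (p.1.tail ++ [true], if p.1.headD false then vneg p.2 else p.2) :: acc

/-- Program for `whtStep`: the input is `(nothing, p, acc)`. -/
def whtStepP : Prog :=
  .cons (.cons (.cons (.tail ▷ .head ▷ .head ▷ .tail) (.cons .nil .nil) ▷ appendP)
    (.tail ▷ .head ▷ .tail))
    (.cons (.cons (.cons (.tail ▷ .head ▷ .head ▷ .tail) (.cons trueP .nil) ▷ appendP)
      (.cond (.tail ▷ .head ▷ .head ▷ .head) (.tail ▷ .head ▷ .tail ▷ vnegP)
        (.tail ▷ .head ▷ .tail))) (.tail ▷ .tail))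

theorem whtStepP_spec : ∃ c, IsPoly c ∧ ∀ (M W r m : ℕ) (env : Data) (acc : List Item) (p : Item),
    W ≤ M → r ≤ M → m ≤ M → p.1.length = r ∧ p.2.length = m →
    Does whtStepP (.cons env (.cons (encItem W p) (encItems W acc)))
      (encItems W (whtStep acc p)) (c M) := by
  obtain ⟨c₁, hc₁, h₁⟩ := vnegP_spec
  apply Exists.intro
  apply And.intro
  case right =>
    intro M W r m env acc p hW hr hm hp
    have e (b : Bool) := Does.append (encA := encBool) (l := p.1.tail) (l' := [b]) (N := M)
      (by simp; omega)
    have hc : Does (.cond (.tail ▷ .head ▷ .head ▷ .head) (.tail ▷ .head ▷ .tail ▷ vnegP)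
        (.tail ▷ .head ▷ .tail)) (.cons env (.cons (encItem W p) (encItems W acc)))
        (encV W (if p.1.headD false then vneg p.2 else p.2)) (c₁ M + 60) := by
      refine Does.mono (Does.ite (b := p.1.headD false) (T := c₁ M + 20)
        (Does.free rfl ?_) (fun h => ?_) (fun h => ?_)) ?_
      · rcases p with ⟨_ | ⟨a, k⟩, v⟩ <;> rfl
      · rw [if_pos h]
        exact Does.mono (Does.call rfl (h₁ M W p.2 hW (by omega))) (by simp only [Prog.sz]; omega)
      · rw [if_neg (by rw [h]; simp)]
        exact Does.mono (Does.free rfl rfl) (by simp only [Prog.sz]; omega)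
      · simp only [Prog.sz]
        omega
    have ht : (encBits p.1).tail = encBits p.1.tail := by
      rcases p with ⟨_ | ⟨a, k⟩, v⟩ <;> rfl
    refine Does.cons (Does.cons (Does.comp (Does.free rfl ?_) (e false)) (Does.free rfl rfl))
      (Does.cons (Does.cons (Does.comp (Does.free rfl ?_) (e true)) hc) (Does.free rfl rfl))
    · exact congrArg (fun d => Data.cons d _) ht
    · exact congrArg (fun d => Data.cons d _) ht
  case left => fun_prop

/-- One pass of the transform. -/
def whtPass (r : ℕ) (l : List Item) : List Item := aggregate r (l.foldl whtStep [])

/-- The Walsh-Hadamard transform of a function on bit strings of length `r`. -/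
def wht (r : ℕ) (l : List Item) : List Item := (whtPass r)^[r] l

/-- Program for `wht`: the input is `(r, l)`. -/
def whtP : Prog :=
  .cons .head (.cons .tail .head) ▷
    foldP (.cons .head (.cons .nil (.cons .nil (.tail ▷ .tail)) ▷ foldP whtStepP) ▷ aggregateP)

theorem foldl_whtStep {r m : ℕ} (hr : 0 < r) {l : List Item} (hl : HasDims r m l) (acc : List Item)
    (hacc : HasDims r m acc) : HasDims r m (l.foldl whtStep acc) ∧
      (l.foldl whtStep acc).length = 2 * l.length + acc.length ∧
      ∀ u z b, evalAt (l.foldl whtStep acc) (u ++ [z]) b =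
        evalAt l (false :: u) b + sg z * evalAt l (true :: u) b + evalAt acc (u ++ [z]) b := by
  induction l generalizing acc with
  | nil => exact ⟨hacc, by simp, by simp⟩
  | cons p l ih =>
    have hp := hl p (by simp)
    obtain ⟨i1, i2, i3⟩ := ih (fun q hq => hl q (by simp [hq])) (whtStep acc p) (by
      intro q hq
      rcases List.mem_cons.1 hq with rfl | hq
      · exact ⟨by simp; omega, hp.2⟩
      rcases List.mem_cons.1 hq with rfl | hq
      · refine ⟨by simp; omega, ?_⟩
        dsimp only
        split_ifs
        · simpa [vneg] using hp.2
        · exact hp.2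
      · exact hacc q hq)
    refine ⟨i1, by rw [List.foldl_cons, i2]; simp [whtStep]; omega, fun u z b => ?_⟩
    rw [List.foldl_cons, i3]
    rcases p with ⟨_ | ⟨a, k⟩, v⟩
    · simp at hp; omega
    · have hneg : (vneg v)[b]?.getD 0 = -v[b]?.getD 0 := by
        rw [vneg, List.getElem?_map]
        cases v[b]? <;> simp
      simp only [whtStep, evalAt_cons, List.tail_cons, List.headD_cons, List.cons.injEq]
      have e1 : k ++ [false] = u ++ [z] ↔ k = u ∧ z = false := by
        rw [List.append_singleton_inj, eq_comm (a := false)]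
      have e2 : k ++ [true] = u ++ [z] ↔ k = u ∧ z = true := by
        rw [List.append_singleton_inj, eq_comm (a := true)]
      simp only [e1, e2]
      by_cases hk : k = u <;> cases a <;> cases z <;> simp [hk, hneg, sg] <;> ring

theorem whtPass_hasDims {r m : ℕ} (hr : 0 < r) {l : List Item} (hl : HasDims r m l) :
    HasDims r m (whtPass r l) :=
  aggregate_hasDims (foldl_whtStep hr hl [] fun p hp => by simp at hp).1

theorem length_whtPass_le {r m : ℕ} (hr : 0 < r) {l : List Item} (hl : HasDims r m l) :
    (whtPass r l).length ≤ 2 ^ r :=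
  length_aggregate_le_two_pow (foldl_whtStep hr hl [] fun p hp => by simp at hp).1

theorem evalAt_whtPass {r m : ℕ} (hr : 0 < r) {l : List Item} (hl : HasDims r m l)
    (u : List Bool) (z : Bool) (b : ℕ) : evalAt (whtPass r l) (u ++ [z]) b =
      evalAt l (false :: u) b + sg z * evalAt l (true :: u) b := by
  obtain ⟨i1, _, i3⟩ := foldl_whtStep hr hl [] fun p hp => by simp at hp
  rw [whtPass, evalAt_aggregate i1, i3, evalAt_nil, add_zero]

theorem iterate_whtPass {r m : ℕ} (j : ℕ) {l : List Item} (hl : HasDims r m l)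
    (hlen : l.length ≤ 2 ^ r) (hr : 0 < j → 0 < r) : HasDims r m ((whtPass r)^[j] l) ∧
      ((whtPass r)^[j] l).length ≤ 2 ^ r ∧ ∀ u, ∀ v ∈ keys j, ∀ b,
        evalAt ((whtPass r)^[j] l) (u ++ v) b =
          ∑ w ∈ keys j, sg (dotB w v) * evalAt l (w ++ u) b := by
  induction j generalizing l with
  | zero => exact ⟨hl, hlen, by simp [keys, dotB, sg]⟩
  | succ j ih =>
    have hr := hr (by omega)
    obtain ⟨i1, i2, i3⟩ := ih (whtPass_hasDims hr hl) (length_whtPass_le hr hl) fun _ => hr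
    rw [Function.iterate_succ_apply]
    refine ⟨i1, i2, fun u v hv b => ?_⟩
    rcases v with _ | ⟨z, v⟩
    · simp at hv
    · have hv' : v ∈ keys j := by simpa using hv
      have := i3 (u ++ [z]) v hv' b
      rw [List.append_assoc, List.singleton_append] at this
      rw [this, sum_keys_succ]
      refine Finset.sum_congr rfl fun w _ => ?_
      rw [← List.append_assoc, evalAt_whtPass hr hl]
      simp only [dotB, sg_xor, Bool.false_and, Bool.true_and, List.cons_append]
      rw [mul_add, ← mul_assoc, mul_comm (sg (dotB w v)) (sg z),
        show sg false = 1 from rfl, one_mul]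

theorem wht_hasDims {r m : ℕ} {l : List Item} (hl : HasDims r m l) (hlen : l.length ≤ 2 ^ r) :
    HasDims r m (wht r l) ∧ (wht r l).length ≤ 2 ^ r := by
  obtain ⟨h1, h2, _⟩ := iterate_whtPass r hl hlen _root_.id
  exact ⟨h1, h2⟩

theorem evalAt_wht {r m : ℕ} {l : List Item} (hl : HasDims r m l) (hlen : l.length ≤ 2 ^ r)
    {z : List Bool} (hz : z ∈ keys r) (b : ℕ) :
    evalAt (wht r l) z b = ∑ w ∈ keys r, sg (dotB w z) * evalAt l w b := by
  have := (iterate_whtPass r hl hlen _root_.id).2.2 [] z hz b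
  rw [wht]
  simpa using this

theorem whtP_spec : ∃ c, IsLin c ∧ ∀ (M N : ℕ), 1 ≤ N → ∀ (W r m : ℕ) (l : List Item),
    W ≤ M → r ≤ M → m ≤ M → 2 ^ r ≤ N → l.length ≤ 2 ^ r → HasDims r m l →
    Does whtP (.cons (un r) (encItems W l)) (encItems W (wht r l)) (c M N) := by
  obtain ⟨c₁, hc₁, h₁⟩ := whtStepP_spec
  obtain ⟨c₂, hc₂, h₂⟩ := aggregateP_spec
  have hc₂' := hc₂.mul_const (a := 2) (by norm_num)
  apply Exists.intro
  apply And.intro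
  case right =>
    intro M N hN W r m l hW hr hm hrN hlen hl
    have hpos : ∀ a ∈ List.replicate r false, 0 < r := fun a ha => by
      rw [List.mem_replicate] at ha
      omega
    have e := Does.fold (encA := encBool) (encB := encItems W) (f := fun b _ => whtPass r b)
      (env := un r) (b := l) (l := List.replicate r false) (N := M)
      (p := .cons .head (.cons .nil (.cons .nil (.tail ▷ .tail)) ▷ foldP whtStepP) ▷ aggregateP)
      (fun b => HasDims r m b ∧ b.length ≤ 2 ^ r) (by simpa) ⟨hl, hlen⟩
      (fun b a ha hb => ⟨whtPass_hasDims (hpos a ha) hb.1, length_whtPass_le (hpos a ha) hb.1⟩)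
      (fun b a ha hb => by
        have e1 := Does.fold (encA := encItem W) (encB := encItems W) (f := whtStep)
          (env := .nil) (b := []) (l := b) (N := N) (fun _ => True) (hb.2.trans hrN) trivial
          (fun _ _ _ _ => trivial)
          (fun b' p hp _ => h₁ M W r m .nil b' p hW hr hm (hb.1 p hp))
        obtain ⟨i1, i2, _⟩ := foldl_whtStep (hpos a ha) hb.1 [] fun p hp => by simp at hp
        have e2 := h₂ M (2 * N) (by omega) W r m (b.foldl whtStep []) hW hr hm
          (by have := hb.2; simp at i2; omega) i1
        exact Does.comp (Does.cons (Does.free rfl rfl) (Does.call rfl e1)) e2)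
    rw [foldl_replicate] at e
    exact Does.mono (Does.call rfl e) le_rfl
  case left =>
    repeat' first
      | assumption
      | exact IsLin.self
      | exact IsLin.of_poly (by fun_prop)
      | refine IsLin.add ?_ ?_
      | refine IsLin.poly_mul (by fun_prop) ?_
      | refine IsLin.mul_poly ?_ (by fun_prop)

/-! ### Enumeration of bit strings -/

/-- Put a bit in front of all bit strings of a list. -/
def bitStep (l : List (List Bool)) : List (List Bool) :=
  l.foldl (fun acc v => (false :: v) :: (true :: v) :: acc) []

/-- All bit strings of length `r`. -/
def allBits (r : ℕ) : List (List Bool) := bitStep^[r] [[]]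

/-- Program for `allBits`: the input is `r` in unary. -/
def allBitsP : Prog :=
  .cons .nil (.cons (.cons .nil .nil) .id) ▷
    foldP (.cons .nil (.cons .nil (.tail ▷ .tail)) ▷
      foldP (.cons (.cons .nil (.tail ▷ .head)) (.cons (.cons trueP (.tail ▷ .head))
        (.tail ▷ .tail))))

theorem bitStep_perm (l : List (List Bool)) :
    (bitStep l).Perm (l.map (List.cons false) ++ l.map (List.cons true)) := by
  have key : ∀ (l acc : List (List Bool)),
      (l.foldl (fun acc v => (false :: v) :: (true :: v) :: acc) acc).Perm
        (l.map (List.cons false) ++ l.map (List.cons true) ++ acc) := by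
    intro l
    induction l with
    | nil => exact fun acc => .refl _
    | cons v l ih =>
      intro acc
      refine (ih _).trans (List.perm_middle.trans (.cons _ (List.perm_middle.trans ?_)))
      exact (List.perm_middle.append_right acc).symm
  rw [bitStep]
  simpa using key l []

theorem allBits_succ (r : ℕ) : allBits (r + 1) = bitStep (allBits r) := by
  rw [allBits, Function.iterate_succ_apply', allBits]

theorem length_allBits (r : ℕ) : (allBits r).length = 2 ^ r := by
  induction r with
  | zero => rfl
  | succ r ih =>
    rw [allBits_succ, (bitStep_perm _).length_eq]
    simp [ih]
    ring

theorem mem_allBits {r : ℕ} {w : List Bool} : w ∈ allBits r ↔ w ∈ keys r := by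
  induction r generalizing w with
  | zero => simp [allBits, keys]
  | succ r ih =>
    rw [allBits_succ, (bitStep_perm _).mem_iff, keys]
    simp [ih]

theorem nodup_allBits (r : ℕ) : (allBits r).Nodup := by
  refine List.dedup_eq_self.1 ?_
  have h : (allBits r).toFinset = keys r := by
    ext w
    rw [List.mem_toFinset, mem_allBits]
  have hc := congrArg Finset.card h
  rw [List.card_toFinset, card_keys, ← length_allBits] at hc
  exact (List.dedup_sublist _).eq_of_length hc

theorem allBitsP_spec : ∃ c, IsLin c ∧ ∀ (M N : ℕ), 1 ≤ N → ∀ r : ℕ, r ≤ M → 2 ^ r ≤ N →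
    Does allBitsP (un r) (encCols (allBits r)) (c M N) := by
  apply Exists.intro
  apply And.intro
  case right =>
    intro M N hN r hr hrN
    have e := Does.fold_prefix (encA := encBool) (encB := encCols) (f := fun b _ => bitStep b)
      (env := .nil) (b := [[]]) (l := List.replicate r false) (N := M) (T := N * 60 + 60)
      (p := .cons .nil (.cons .nil (.tail ▷ .tail)) ▷
        foldP (.cons (.cons .nil (.tail ▷ .head)) (.cons (.cons trueP (.tail ▷ .head))
        (.tail ▷ .tail)))) (by simpa)
      (fun pre a hpre => by
        have hp : pre = List.replicate pre.length false := by
          refine List.eq_replicate_of_mem fun x hx => ?_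
          exact (List.mem_replicate.1 (hpre.subset (List.mem_append_left _ hx))).2
        have hle := hpre.length_le
        rw [List.length_append, List.length_replicate] at hle
        rw [hp, foldl_replicate]
        generalize pre.length = j at hle
        have hlen : (allBits j).length ≤ N := by
          rw [length_allBits]
          exact (Nat.pow_le_pow_right (by norm_num) (by simp at hle; omega)).trans hrN
        have e1 := Does.fold (encA := encBits) (encB := encCols)
          (f := fun acc v => (false :: v) :: (true :: v) :: acc)
          (env := .nil) (b := []) (l := allBits j) (N := N) (T := 30)
          (p := .cons (.cons .nil (.tail ▷ .head)) (.cons (.cons trueP (.tail ▷ .head))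
            (.tail ▷ .tail))) (fun _ => True) hlen trivial
          (fun _ _ _ _ => trivial)
          (fun b' p hp _ => Does.mono (Does.free rfl rfl) (by decide))
        refine Does.mono (Does.call rfl e1) ?_
        simp only [Prog.sz]
        omega)
    rw [foldl_replicate] at e
    exact Does.mono (Does.call rfl e) le_rfl
  case left =>
    repeat' first
      | assumption
      | exact IsLin.self
      | exact IsLin.of_poly (by fun_prop)
      | refine IsLin.add ?_ ?_
      | refine IsLin.poly_mul (by fun_prop) ?_

/-! ### Unit vectors -/

/-- The unit vectors of length `n`. -/
def units : ℕ → List (List Bool)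
  | 0 => []
  | n + 1 => (true :: zeros n) :: (units n).map (List.cons false)

theorem length_units (n : ℕ) : (units n).length = n := by
  induction n with
  | zero => rfl
  | succ n ih => simp [units, ih]

theorem length_of_mem_units {n : ℕ} {u : List Bool} (hu : u ∈ units n) : u.length = n := by
  induction n generalizing u with
  | zero => simp [units] at hu
  | succ n ih =>
    rw [units, List.mem_cons, List.mem_map] at hu
    rcases hu with rfl | ⟨v, hv, rfl⟩
    · simp
    · simp [ih hv]

/-- Program for `units`: the input is `n` in unary. -/
def unitsP : Prog :=
  .cons .nil (.cons (.cons .nil .nil) .id) ▷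
    foldP (.cons (.cons .nil (.tail ▷ .tail ▷ .head))
      (.cons (.cons trueP (.tail ▷ .tail ▷ .head)) (.cons .nil (.tail ▷ .tail ▷ .tail) ▷
        mapP (.cons .nil .tail)))) ▷ .tail

theorem unitsP_spec : ∃ c, IsPoly c ∧ ∀ M n : ℕ, n ≤ M →
    Does unitsP (un n) (encCols (units n)) (c M) := by
  apply Exists.intro
  apply And.intro
  case right =>
    intro M n hn
    have e := Does.fold_prefix (encA := encBool)
      (encB := fun j : ℕ => .cons (un j) (encCols (units j)))
      (f := fun j _ => j + 1) (T := M * 140 + 150)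
      (env := .nil) (b := 0) (l := List.replicate n false) (N := M)
      (p := .cons (.cons .nil (.tail ▷ .tail ▷ .head))
        (.cons (.cons trueP (.tail ▷ .tail ▷ .head)) (.cons .nil (.tail ▷ .tail ▷ .tail) ▷
        mapP (.cons .nil .tail)))) (by simpa)
      (fun pre a hpre => by
        have hle := hpre.length_le
        rw [List.length_append, List.length_replicate] at hle
        have hj : pre.foldl (fun j _ => j + 1) 0 = pre.length := by
          rw [List.foldl_const, Nat.succ_iterate, zero_add]
        rw [hj]
        generalize pre.length = j at hle
        have e1 := Does.map (encA := encBits) (encB := encBits) (f := List.cons false)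
          (env := .nil) (l := units j) (N := M) (T := 5)
          (p := .cons .nil .tail) (by rw [length_units]; simp at hle; omega)
          (fun a _ => Does.mono (Does.free rfl rfl) (by decide))
        refine Does.mono (Does.cons (Does.free rfl rfl) (Does.cons (Does.free rfl rfl)
          (Does.call rfl e1))) ?_
        simp only [Prog.sz, trueP]
        omega)
    rw [List.foldl_const, List.length_replicate, Nat.succ_iterate, zero_add] at e
    exact Does.mono (Does.comp (Does.call rfl e) (Does.free rfl rfl)) le_rfl
  case left => fun_prop

/-- The offsets of the queries: the zero vector and the unit vectors. -/
def offsets (n : ℕ) : List (List Bool) := zeros n :: units n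

theorem length_offsets (n : ℕ) : (offsets n).length = n + 1 := by
  simp [offsets, length_units]

theorem length_of_mem_offsets {n : ℕ} {u : List Bool} (hu : u ∈ offsets n) : u.length = n := by
  rcases List.mem_cons.1 hu with rfl | hu
  · simp
  · exact length_of_mem_units hu

theorem dotB_zeros (n : ℕ) (i : List Bool) : dotB (zeros n) i = false := by
  induction n generalizing i with
  | zero => rfl
  | succ n ih =>
    cases i with
    | nil => rfl
    | cons a i => simpa [dotB, List.replicate_succ] using ih i

theorem dotB_offsets {n : ℕ} {i : List Bool} (hi : i.length = n) :
    (offsets n).map (fun e => dotB e i) = false :: i := by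
  rw [offsets, List.map_cons, dotB_zeros]
  congr 1
  induction n generalizing i with
  | zero => rw [List.length_eq_zero_iff.1 hi]; rfl
  | succ n ih =>
    cases i with
    | nil => simp at hi
    | cons a i =>
      rw [units, List.map_cons, List.map_map]
      have := ih (i := i) (by simpa using hi)
      simpa [dotB, dotB_zeros, Function.comp_def] using this

theorem hashB_cons (c : Bool) (z : List Bool) (cols : List (List Bool)) (i : List Bool) :
    hashB (c :: z) (cols.map (List.cons false)) i = c :: hashB z cols i := by
  induction cols generalizing z i with
  | nil => rfl
  | cons a cols ih =>
    cases i with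
    | nil => rfl
    | cons b i =>
      cases b
      · exact ih z i
      · have := ih (vxor z a) i
        simpa [hashB, vxor] using this

/-- The identity matrix has the unit vectors as columns. -/
theorem hashB_units {n : ℕ} {i : List Bool} (hi : i.length = n) :
    hashB (zeros n) (units n) i = i := by
  induction n generalizing i with
  | zero => rw [List.length_eq_zero_iff.1 hi]; rfl
  | succ n ih =>
    cases i with
    | nil => simp at hi
    | cons b i =>
      have h1 : hashB (zeros (n + 1)) (units (n + 1)) (b :: i) =
          hashB (b :: zeros n) ((units n).map (List.cons false)) i := by
        cases b
        · rfl
        · have h : vxor (zeros (n + 1)) (true :: zeros n) = true :: zeros n := by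
            simp [vxor, List.replicate_succ]
          rw [← h]
          rfl
      rw [h1, hashB_cons, ih (by simpa using hi)]

/-! ### Queries -/

/-- The row vector `wᵀ A`, where `A` has the columns `cols`. -/
def rowOf (cols : List (List Bool)) (w : List Bool) : List Bool := cols.map (dotB w)

/-- The queries for the matrix `m`. -/
def matQueries (n r : ℕ) (m : List (List Bool)) : List (List Bool) :=
  (allBits r).flatMap fun w => (offsets n).map fun e => vxor (rowOf m w) e

/-- All queries. -/
def allQueries (n r : ℕ) (mats : List (List (List Bool))) : List (List Bool) :=
  mats.flatMap (matQueries n r)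

theorem foldl_flatMap_reverse {α β : Type} (g : α → List β) (l : List α) (acc : List β) :
    l.foldl (fun acc a => (g a).reverse ++ acc) acc = (l.flatMap g).reverse ++ acc := by
  induction l generalizing acc with
  | nil => rfl
  | cons a l ih => simp [ih]

/-- Program for the queries with given `w`: the input is `((offsets, m), w, acc)`. -/
def rowQueriesP : Prog :=
  .cons (.cons (.tail ▷ .head) (.head ▷ .tail) ▷ mapP dotP)
    (.cons (.tail ▷ .tail) (.head ▷ .head)) ▷
    foldP (.cons (.cons .head (.tail ▷ .head) ▷ vxorP) (.tail ▷ .tail))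

theorem length_rowOf (m : List (List Bool)) (w : List Bool) : (rowOf m w).length = m.length := by
  simp [rowOf]

theorem rowQueriesP_spec : ∃ c, IsPoly c ∧ ∀ (M n r : ℕ) (m : List (List Bool)) (w : List Bool)
    (acc : List (List Bool)), n + 1 ≤ M → r ≤ M → IsMat n r m → w.length = r →
    Does rowQueriesP (.cons (.cons (encCols (offsets n)) (encCols m))
      (.cons (encBits w) (encCols acc)))
      (encCols (((offsets n).map fun e => vxor (rowOf m w) e).reverse ++ acc)) (c M) := by
  obtain ⟨c₁, hc₁, h₁⟩ := dotP_spec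
  obtain ⟨c₂, hc₂, h₂⟩ := vxorP_spec
  apply Exists.intro
  apply And.intro
  case right =>
    intro M n r m w acc hn hr hm hw
    have e1 := Does.map (encA := encBits) (encB := encBool) (f := dotB w) (env := encBits w)
      (l := m) (N := M) (p := dotP) (by have := hm.1; omega)
      (fun a ha => h₁ M w a (by omega) (by rw [hw, hm.2 a ha]))
    have e2 := Does.fold (encA := encBits) (encB := encCols) (env := encBits (rowOf m w))
      (f := fun acc e => vxor (rowOf m w) e :: acc)
      (b := acc) (l := offsets n) (N := M)
      (p := .cons (.cons .head (.tail ▷ .head) ▷ vxorP) (.tail ▷ .tail))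
      (fun _ => True) (by rw [length_offsets]; exact hn) trivial (fun _ _ _ _ => trivial)
      (fun b a ha _ => Does.cons (Does.call rfl (h₂ M (rowOf m w) a
        (by rw [length_rowOf, hm.1]; omega)
        (by rw [length_rowOf, hm.1, length_of_mem_offsets ha]))) (Does.free rfl rfl))
    rw [foldl_cons_map] at e2
    exact Does.mono (Does.comp (Does.cons (Does.call rfl e1) (Does.free rfl rfl)) e2) le_rfl
  case left => fun_prop

/-- Program for `allQueries`: the input is `(n, r, nothing, mats)`. -/
def queriesP : Prog :=
  letP (.tail ▷ .head) allBitsP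
    (letP (.head ▷ .head) (.cons .id unitsP)
      (.cons (.cons .tail (.head ▷ .tail)) (.cons .nil (.head ▷ .head ▷ .tail ▷ .tail ▷ .tail)) ▷
        foldP (.cons (.cons (.head ▷ .head) (.tail ▷ .head))
          (.cons (.tail ▷ .tail) (.head ▷ .tail)) ▷ foldP rowQueriesP) ▷ revP))

/-- Encoding of the data common to the two phases of the algorithm. -/
def encPrep (n r k : ℕ) (mats : List (List (List Bool))) : Data :=
  .cons (un n) (.cons (un r) (.cons (un k) (encList encCols mats)))

theorem length_matQueries (n r : ℕ) (m : List (List Bool)) :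
    (matQueries n r m).length = 2 ^ r * (n + 1) := by
  simp [matQueries, List.length_flatMap, length_offsets, length_allBits]

theorem length_allQueries (n r : ℕ) (mats : List (List (List Bool))) :
    (allQueries n r mats).length = mats.length * (2 ^ r * (n + 1)) := by
  simp [allQueries, List.length_flatMap, length_matQueries]

theorem queriesP_spec : ∃ c, IsLin c ∧ ∀ (M N : ℕ), 1 ≤ N → ∀ (n r k D : ℕ)
    (mats : List (List (List Bool))), n + 1 ≤ M → r ≤ M → 2 ^ r ≤ N → 1 ≤ D → mats.length ≤ D →
    (∀ m ∈ mats, IsMat n r m) →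
    Does queriesP (encPrep n r k mats) (encCols (allQueries n r mats)) (D * c M N) := by
  obtain ⟨c₁, hc₁, h₁⟩ := allBitsP_spec
  obtain ⟨c₂, hc₂, h₂⟩ := unitsP_spec
  obtain ⟨c₃, hc₃, h₃⟩ := rowQueriesP_spec
  refine ⟨fun M N => c₁ M N + c₂ M + N * (c₃ M + 30) + N * M * 40 + 500, ?_,
    fun M N hN n r k D mats hn hr hrN hD hmD hmats => ?_⟩
  · repeat' first
      | assumption
      | exact IsLin.self
      | exact IsLin.of_poly (by fun_prop)
      | refine IsLin.add ?_ ?_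
      | refine IsLin.mul_poly ?_ (by fun_prop)
  · have e3 := Does.fold (encA := encCols) (encB := encCols)
      (env := .cons (encCols (offsets n)) (encCols (allBits r)))
      (f := fun acc m => (matQueries n r m).reverse ++ acc)
      (b := []) (l := mats) (N := D) (T := N * (c₃ M + 30) + 60)
      (p := .cons (.cons (.head ▷ .head) (.tail ▷ .head))
          (.cons (.tail ▷ .tail) (.head ▷ .tail)) ▷ foldP rowQueriesP)
      (fun _ => True) hmD trivial (fun _ _ _ _ => trivial)
      (fun b a ha _ => by
        have e := Does.fold (encA := encBits) (encB := encCols)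
          (env := .cons (encCols (offsets n)) (encCols a))
          (f := fun acc w => ((offsets n).map fun e => vxor (rowOf a w) e).reverse ++ acc)
          (b := b) (l := allBits r) (N := N) (T := c₃ M) (p := rowQueriesP)
          (fun _ => True) (by rwa [length_allBits]) trivial (fun _ _ _ _ => trivial)
          (fun b' w hw _ => h₃ M n r a w b' hn hr (hmats a ha) (mem_keys.1 (mem_allBits.1 hw)))
        rw [foldl_flatMap_reverse] at e
        refine Does.mono (Does.call rfl e) ?_
        simp only [Prog.sz]
        omega)
    rw [foldl_flatMap_reverse, List.append_nil] at e3
    have hlen : (allQueries n r mats).reverse.length ≤ D * (N * M) := by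
      rw [List.length_reverse, length_allQueries]
      exact Nat.mul_le_mul hmD (Nat.mul_le_mul hrN hn)
    have e4 := Does.rev (encA := encBits) hlen
    rw [List.reverse_reverse] at e4
    refine Does.mono (Does.letP rfl (h₁ M N hN r hr hrN) (Does.letP rfl
      (Does.cons (Does.free (p := .id) rfl rfl) (h₂ M n (by omega))) (Does.comp
      (Does.call rfl e3) e4))) ?_
    simp only [Prog.sz]
    have i1 := Nat.mul_le_mul_right (c₁ M N) hD
    have i2 := Nat.mul_le_mul_right (c₂ M) hD
    have i3 : D * (c₁ M N + c₂ M + N * (c₃ M + 30) + N * M * 40 + 500) = D * c₁ M N + D * c₂ M +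
      D * (N * (c₃ M + 30)) + D * (N * M) * 40 + D * 500 := by ring
    have i4 : D * (N * (c₃ M + 30) + 60 + 30) = D * (N * (c₃ M + 30)) + D * 90 := by ring
    omega

/-! ### Measurements -/

/-- Map along a list while consuming a stream; `S post` is what remains of the stream before the
part `post` of the list is treated. -/
theorem Does.stream {α β : Type} {encA : α → Data} {encB : β → Data} {g : α → β}
    {S : List α → Data} {env : Data} {p : Prog} {T N : ℕ} {l : List α} (hl : l.length ≤ N)
    (h : ∀ a post, (a :: post) <:+ l →
      Does p (.cons env (.cons (encA a) (S (a :: post)))) (.cons (encB (g a)) (S post)) T) :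
    Does (mapAccP p) (.cons env (.cons (S l) (encList encA l)))
      (.cons (encList encB (l.map g)) (S [])) (N * (T + 110) + 80) := by
  have h1 := Does.fold_prefix (encA := encA)
    (encB := fun j => .cons (encList encB ((l.take j).map g).reverse) (S (l.drop j))) (env := env)
    (p := .cons (.tail ▷ .tail ▷ .head)
      (.cons .head (.cons (.tail ▷ .head) (.tail ▷ .tail ▷ .tail)) ▷ p) ▷
      .cons (.cons (.tail ▷ .head) .head) (.tail ▷ .tail))
    (f := fun j _ => j + 1) (b := 0) (T := T + 35) hl
    (fun pre a hpre => by
      obtain ⟨post, hpost⟩ := hpre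
      have hj : pre.foldl (fun j _ => j + 1) 0 = pre.length := by
        rw [List.foldl_const, Nat.succ_iterate, zero_add]
      rw [hj]
      rw [List.append_assoc, List.singleton_append] at hpost
      have d1 : l.drop pre.length = a :: post := by simp [← hpost]
      have d2 : l.drop (pre.length + 1) = post := by simp [← hpost]
      have t1 : l.take pre.length = pre := by simp [← hpost]
      have t2 : l.take (pre.length + 1) = pre ++ [a] := by simp [← hpost, List.take_add_one]
      rw [d1, d2, t1, t2, List.map_append, List.reverse_append]
      refine Does.mono (Does.comp (Does.cons (Does.free rfl rfl)
        (Does.call rfl (h a post ⟨pre, hpost⟩))) (Does.free rfl rfl)) ?_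
      simp only [Prog.sz]
      omega)
  rw [List.foldl_const, Nat.succ_iterate, zero_add, List.take_length, List.drop_length] at h1
  have h2 := Does.rev (encA := encB) (l := (l.map g).reverse) (N := N)
    (by simpa using hl)
  rw [List.reverse_reverse] at h2
  refine Does.mono (Does.comp (Does.call rfl h1) (Does.cons
    (Does.call (a := .head) rfl h2) (Does.free (p := .tail) rfl rfl))) ?_
  simp only [Prog.sz]
  have : N * (T + 110) = N * (T + 35 + 30) + N * 40 + N * 5 := by ring
  omega

/-- The integer `z * 2 ^ (B - e)`, that is, the fixed-point number `z / 2 ^ e` times `2 ^ B`. -/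
def conv (B : ℕ) (p : ℤ × ℕ) : ℤ := p.1 * 2 ^ (B - p.2)

/-- Program for `conv`: the input is `((B, W), z, e)`. -/
def convP : Prog :=
  letP (.tail ▷ .tail) unaryP (letP (.cons .tail (.head ▷ .head ▷ .head)) unSubP
    (letP (.cons .tail (.head ▷ .head ▷ .tail ▷ .head ▷ .tail)) appendP
      (letP (.cons .nil (.cons .tail (.head ▷ .head ▷ .head ▷ .head ▷ .tail)))
        (mapAccP (.cons (.tail ▷ .tail ▷ .head) (.tail ▷ .tail ▷ .tail)) ▷ .head)
        (.cond (.head ▷ .head ▷ .head ▷ .head ▷ .tail ▷ .head ▷ .head) (.tail ▷ negP) .tail))))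

theorem mapAcc_fit (W : ℕ) (l : List Bool) :
    (mapAcc (fun (s : List Bool) (_ : Bool) => (s.headD false, s.tail)) l
      (List.replicate W false)).1 = bz W (valB l) := by
  induction W generalizing l with
  | zero => rfl
  | succ W ih =>
    rw [List.replicate_succ, mapAcc, ih]
    cases l with
    | nil => simp [bz, valB]
    | cons b l =>
      have h1 : decide (((valB (b :: l) : ℕ) : ℤ) % 2 = 1) = b := by
        cases b <;> simp [valB]
      have h2 : ((valB (b :: l) : ℕ) : ℤ) / 2 = valB l := by
        cases b <;> (simp [valB]; try omega)
      rw [bz, h1, h2]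
      rfl

theorem valB_bits (m : ℕ) : valB m.bits = m := by
  induction m using Nat.binaryRec' with
  | zero => simp [valB]
  | bit b n h ih =>
    rw [Nat.bits_append_bit n b h, valB, ih, Nat.bit_val]
    omega

theorem valB_zeros_append (p : ℕ) (l : List Bool) : valB (zeros p ++ l) = valB l * 2 ^ p := by
  induction p with
  | zero => simp
  | succ p ih =>
    rw [zeros, List.replicate_succ, List.cons_append, valB, ih, pow_succ]
    simp
    ring

theorem length_bits_le_of_lt {m b : ℕ} (h : m < 2 ^ b) : m.bits.length ≤ b := by
  rw [Nat.size_eq_bits_len]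
  exact Nat.size_le.2 h

theorem convP_spec : ∃ c, IsPoly c ∧ ∀ (M W B : ℕ) (p : ℤ × ℕ), W ≤ M → B ≤ M →
    |p.1| < 2 ^ B → p.2 ≤ B →
    Does convP (.cons (.cons (un B) (un W)) (encAnswer p)) (encZ W (conv B p)) (c M) := by
  obtain ⟨c₁, hc₁, h₁⟩ := unSubP_spec
  obtain ⟨c₂, hc₂, h₂⟩ := negP_spec
  refine ⟨fun M => (M * (M * 80 + 300) + 100) + c₁ M + (M * 80 + 60) + (M * 130 + 80) + c₂ M + 300,
    by fun_prop, fun M W B p hW hB hz he => ?_⟩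
  have e1 := Does.unary p.2 M ((length_bits_le_of_lt (Nat.lt_two_pow_self)).trans (he.trans hB))
  have e2 := h₁ M p.2 B (he.trans hB)
  have e3 := Does.append (encA := encBool) (l := zeros (B - p.2)) (l' := p.1.natAbs.bits) (N := M)
    (by simp; omega)
  have e4 := Does.mapAcc (encA := encBool) (encB := encBool) (encS := encBits)
    (f := fun (s : List Bool) (_ : Bool) => (s.headD false, s.tail)) (env := .nil) (T := 20)
    (N := M) (p := .cons (.tail ▷ .tail ▷ .head) (.tail ▷ .tail ▷ .tail))
    (l := List.replicate W false) (s := zeros (B - p.2) ++ p.1.natAbs.bits) (fun _ => True)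
    (by simpa) trivial (fun _ _ _ _ => trivial) (fun s a _ _ => by
      refine Does.mono (Does.free rfl ?_) (by decide : _ ≤ 20)
      cases s <;> rfl)
  have hv : ((valB (zeros (B - p.2) ++ p.1.natAbs.bits) : ℕ) : ℤ) = |p.1| * 2 ^ (B - p.2) := by
    rw [valB_zeros_append, valB_bits]
    push_cast
    rfl
  refine Does.mono (Does.letP rfl e1 (Does.letP rfl e2 (Does.letP rfl e3 (Does.letP rfl
    (Does.comp e4 (Does.free (y := encZ W (|p.1| * 2 ^ (B - p.2))) rfl ?_))
    (Does.ite (b := decide (p.1 < 0)) (T := c₂ M + 10) (Does.free rfl rfl)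
      (fun h => ?_) (fun h => ?_)))))) ?_
  · rw [← hv, encZ, ← mapAcc_fit]
    rfl
  · have h := of_decide_eq_true h
    have hc : conv B p = -(|p.1| * 2 ^ (B - p.2)) := by
      rw [conv, abs_of_neg h]
      ring
    rw [hc]
    exact Does.mono (Does.call rfl (h₂ M W _ hW)) (by simp only [Prog.sz]; omega)
  · have h := of_decide_eq_false h
    have hc : conv B p = |p.1| * 2 ^ (B - p.2) := by
      rw [conv, abs_of_nonneg (not_lt.1 h)]
    rw [hc]
    exact Does.mono (Does.free rfl rfl) (by simp only [Prog.sz]; omega)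
  · have : p.2 * 80 ≤ M * 80 := by omega
    have h3 : M * (p.2 * 80 + 300) ≤ M * (M * 80 + 300) := Nat.mul_le_mul_left _ (by omega)
    simp only [Prog.sz]
    have : M * (20 + 110) = M * 130 := by ring
    omega

/-- Program for the measurements with given `w`: the input is `(((B, W), offsets), w, answers)`,
and the answers not used are returned, too. -/
def rowMeasP : Prog :=
  letP (.cons (.head ▷ .head) (.cons (.tail ▷ .tail) (.head ▷ .tail)))
    (mapAccP (.cons (.cons .head (.tail ▷ .tail ▷ .head) ▷ convP) (.tail ▷ .tail ▷ .tail)))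
    (.cons (.cons (.head ▷ .tail ▷ .head) (.tail ▷ .head)) (.tail ▷ .tail))

theorem rowMeasP_spec : ∃ c, IsPoly c ∧ ∀ (M W B : ℕ) (E : List (List Bool))
    (q : List Bool → ℤ × ℕ) (rest : List (ℤ × ℕ)) (w : List Bool), W ≤ M → B ≤ M → E.length ≤ M →
    (∀ e ∈ E, |(q e).1| < 2 ^ B ∧ (q e).2 ≤ B) →
    Does rowMeasP (.cons (.cons (.cons (un B) (un W)) (encCols E))
      (.cons (encBits w) (encList encAnswer (E.map q ++ rest))))
      (.cons (encItem W (w, E.map fun e => conv B (q e))) (encList encAnswer rest)) (c M) := by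
  obtain ⟨c₁, hc₁, h₁⟩ := convP_spec
  apply Exists.intro
  apply And.intro
  case right =>
    intro M W B E q rest w hW hB hE hq
    have e1 := Does.stream (encA := encBits) (encB := encZ W) (g := fun e => conv B (q e))
      (env := .cons (un B) (un W)) (l := E) (N := M)
      (S := fun post => encList encAnswer (post.map q ++ rest))
      (p := .cons (.cons .head (.tail ▷ .tail ▷ .head) ▷ convP) (.tail ▷ .tail ▷ .tail)) hE
      (fun a post hp => by
        have ha := hq a (hp.subset (by simp))
        exact Does.cons (Does.call rfl (h₁ M W B (q a) hW hB ha.1 ha.2)) (Does.free rfl rfl))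
    exact Does.mono (Does.letP rfl e1 (Does.free rfl rfl)) le_rfl
  case left => fun_prop

/-- The measurements for the matrix `m`, if `A q` is the value at `q` of the transform. -/
def measOf (n r : ℕ) (A : List Bool → ℤ) (m : List (List Bool)) : Meas :=
  (m, wht r ((allBits r).map fun w => (w, (offsets n).map fun e => A (vxor (rowOf m w) e))))

/-- Program for `measOf`: the input is `((r, ((B, W), offsets), strings), m, answers)`, and the
answers not used are returned, too. -/
def matMeasP : Prog :=
  letP (.cons (.head ▷ .tail ▷ .head) (.cons (.tail ▷ .tail) (.head ▷ .tail ▷ .tail)))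
    (mapAccP rowMeasP)
    (letP (.cons (.head ▷ .head ▷ .head) (.tail ▷ .head)) whtP
      (.cons (.cons (.head ▷ .head ▷ .tail ▷ .head) .tail) (.head ▷ .tail ▷ .tail)))

theorem measOf_input_hasDims (n r : ℕ) (A : List Bool → ℤ) (m : List (List Bool)) :
    HasDims r (n + 1)
      ((allBits r).map fun w => (w, (offsets n).map fun e => A (vxor (rowOf m w) e))) := by
  intro p hp
  obtain ⟨w, hw, rfl⟩ := List.mem_map.1 hp
  exact ⟨mem_keys.1 (mem_allBits.1 hw), by simp [length_offsets]⟩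

theorem measOf_isMeas {n r N : ℕ} (A : List Bool → ℤ) {m : List (List Bool)} (hm : IsMat n r m)
    (hN : 2 ^ r ≤ N) : IsMeas n r N (measOf n r A m) := by
  obtain ⟨h1, h2⟩ := wht_hasDims (measOf_input_hasDims n r A m) (by simp [length_allBits])
  exact ⟨hm, h1, h2.trans hN⟩

theorem matMeasP_spec : ∃ c, IsLin c ∧ ∀ (M N : ℕ), 1 ≤ N → ∀ (W B n r : ℕ)
    (ans : List Bool → ℤ × ℕ) (rest : List (ℤ × ℕ)) (m : List (List Bool)),
    W ≤ M → B ≤ M → n + 1 ≤ M → r ≤ M → 2 ^ r ≤ N → IsMat n r m →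
    (∀ e : List Bool, e.length = n → |(ans e).1| < 2 ^ B ∧ (ans e).2 ≤ B) →
    Does matMeasP (.cons (.cons (un r) (.cons (.cons (.cons (un B) (un W)) (encCols (offsets n)))
      (encCols (allBits r))))
      (.cons (encCols m) (encList encAnswer ((matQueries n r m).map ans ++ rest))))
      (.cons (encMeas W (measOf n r (fun e => conv B (ans e)) m)) (encList encAnswer rest))
      (c M N) := by
  obtain ⟨c₁, hc₁, h₁⟩ := rowMeasP_spec
  obtain ⟨c₂, hc₂, h₂⟩ := whtP_spec
  apply Exists.intro
  apply And.intro
  case right =>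
    intro M N hN W B n r ans rest m hW hB hn hr hrN hm hans
    have e1 := Does.stream (encA := encBits) (encB := encItem W)
      (g := fun w => (w, (offsets n).map fun e => conv B (ans (vxor (rowOf m w) e))))
      (env := .cons (.cons (un B) (un W)) (encCols (offsets n))) (l := allBits r) (N := N)
      (S := fun post => encList encAnswer ((post.flatMap fun w =>
        (offsets n).map fun e => vxor (rowOf m w) e).map ans ++ rest))
      (p := rowMeasP) (by rwa [length_allBits])
      (fun w post _ => by
        have := h₁ M W B (offsets n) (fun e => ans (vxor (rowOf m w) e))
          ((post.flatMap fun w => (offsets n).map fun e => vxor (rowOf m w) e).map ans ++ rest) w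
          hW hB (by rwa [length_offsets])
          (fun e he => hans _ (by simp [vxor, length_rowOf, hm.1, length_of_mem_offsets he]))
        rw [List.flatMap_cons, List.map_append, List.append_assoc, List.map_map]
        exact this)
    have e2 := h₂ M N hN W r (n + 1)
      ((allBits r).map fun w => (w, (offsets n).map fun e => conv B (ans (vxor (rowOf m w) e))))
      hW hr hn hrN (by simp [length_allBits])
      (measOf_input_hasDims n r (fun e => conv B (ans e)) m)
    exact Does.mono (Does.letP rfl e1 (Does.letP rfl e2 (Does.free rfl rfl))) le_rfl
  case left =>
    repeat' first
      | assumption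
      | exact IsLin.self
      | exact IsLin.of_poly (by fun_prop)
      | refine IsLin.add ?_ ?_
      | refine IsLin.mul_poly ?_ (by fun_prop)

/-- Program for all measurements: the input is `((n, r, nothing, mats), answers, (B, W))`. -/
def measP : Prog :=
  letP (.head ▷ .tail ▷ .head) allBitsP
    (letP (.head ▷ .head ▷ .head) (.cons .id unitsP)
      (.cons (.cons (.head ▷ .head ▷ .head ▷ .tail ▷ .head)
        (.cons (.cons (.head ▷ .head ▷ .tail ▷ .tail) .tail) (.head ▷ .tail)))
        (.cons (.head ▷ .head ▷ .tail ▷ .head)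
          (.head ▷ .head ▷ .head ▷ .tail ▷ .tail ▷ .tail)) ▷ mapAccP matMeasP ▷ .head))

theorem measP_spec : ∃ c, IsLin c ∧ ∀ (M N : ℕ), 1 ≤ N → ∀ (W B n r k D : ℕ)
    (mats : List (List (List Bool))) (ans : List Bool → ℤ × ℕ),
    W ≤ M → B ≤ M → n + 1 ≤ M → r ≤ M → 2 ^ r ≤ N → 1 ≤ D → mats.length ≤ D →
    (∀ m ∈ mats, IsMat n r m) →
    (∀ e : List Bool, e.length = n → |(ans e).1| < 2 ^ B ∧ (ans e).2 ≤ B) →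
    Does measP (.cons (encPrep n r k mats)
      (.cons (encList encAnswer ((allQueries n r mats).map ans)) (.cons (un B) (un W))))
      (encList (encMeas W) (mats.map (measOf n r fun e => conv B (ans e)))) (D * c M N) := by
  obtain ⟨c₁, hc₁, h₁⟩ := allBitsP_spec
  obtain ⟨c₂, hc₂, h₂⟩ := unitsP_spec
  obtain ⟨c₃, hc₃, h₃⟩ := matMeasP_spec
  refine ⟨fun M N => c₁ M N + c₂ M + c₃ M N + 500, ?_,
    fun M N hN W B n r k D mats ans hW hB hn hr hrN hD hmD hmats hans => ?_⟩
  · repeat' first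
      | assumption
      | exact IsLin.of_poly (by fun_prop)
      | refine IsLin.add ?_ ?_
  · have e3 := Does.stream (encA := encCols) (encB := encMeas W)
      (g := measOf n r fun e => conv B (ans e))
      (env := .cons (un r) (.cons (.cons (.cons (un B) (un W)) (encCols (offsets n)))
        (encCols (allBits r)))) (l := mats) (N := D)
      (S := fun post => encList encAnswer ((post.flatMap (matQueries n r)).map ans))
      (p := matMeasP) hmD
      (fun m post hp => by
        have := h₃ M N hN W B n r ans ((post.flatMap (matQueries n r)).map ans) m hW hB hn hr hrN
          (hmats m (hp.subset (by simp))) hans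
        rw [List.flatMap_cons, List.map_append]
        exact this)
    refine Does.mono (Does.letP rfl (h₁ M N hN r hr hrN) (Does.letP rfl
      (Does.cons (Does.free (p := .id) rfl rfl) (h₂ M n (by omega))) (Does.comp
      (Does.call rfl e3) (Does.free rfl rfl)))) ?_
    simp only [Prog.sz]
    have i1 := Nat.mul_le_mul_right (c₁ M N) hD
    have i2 := Nat.mul_le_mul_right (c₂ M) hD
    have i3 : D * (c₁ M N + c₂ M + c₃ M N + 500) = D * c₁ M N + D * c₂ M +
      D * c₃ M N + D * 500 := by ring
    have i4 : D * (c₃ M N + 110) = D * c₃ M N + D * 110 := by ring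
    omega

/-! ### Output -/

/-- Remove the zeros at the end of a bit string. -/
def trim (l : List Bool) : List Bool :=
  l.foldr (fun b acc => if b || !acc.isEmpty then b :: acc else []) []

theorem trim_bz {W m : ℕ} (h : m < 2 ^ W) : trim (bz W m) = m.bits := by
  induction W generalizing m with
  | zero =>
    have : m = 0 := by simpa using h
    subst this
    simp [bz, trim]
  | succ W ih =>
    have h2 : ((m : ℤ) / 2) = ((m / 2 : ℕ) : ℤ) := by simp
    have hb : decide ((m : ℤ) % 2 = 1) = m.bodd := by
      have := Nat.mod_two_of_bodd m
      cases hb : m.bodd <;> simp [hb] at this ⊢ <;> omega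
    have hm : Nat.bit m.bodd (m / 2) = m := by
      rw [← Nat.div2_val, Nat.bit_bodd_div2]
    have hi := ih (m := m / 2) (by rw [pow_succ] at h; omega)
    rw [trim] at hi
    rw [bz, h2, hb, trim, List.foldr_cons, hi]
    by_cases h0 : m = 0
    · subst h0
      rfl
    · have hne : (m / 2 = 0 → m.bodd = true) := by
        intro h'
        have : m = 1 := by omega
        subst this
        rfl
      conv_rhs => rw [← hm, Nat.bits_append_bit _ _ hne]
      rw [if_pos]
      rw [Bool.or_eq_true]
      by_cases h3 : m / 2 = 0
      · exact Or.inl (hne h3)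
      · right
        simpa using fun h' => h3 (by rw [← valB_bits (m / 2), h']; rfl)

/-- Program for `trim`. -/
def trimP : Prog :=
  revP ▷ .cons .nil (.cons .nil .id) ▷
    foldP (.cond (.tail ▷ .head) .tail (.cond (.tail ▷ .tail) .tail .nil))

theorem Does.trim {l : List Bool} {N : ℕ} (hl : l.length ≤ N) :
    Does trimP (encBits l) (encBits (trim l)) (N * 100 + 100) := by
  have h1 := Does.rev (encA := encBool) hl
  have h2 := Does.fold (encA := encBool) (encB := encBits)
    (f := fun acc b => if b || !acc.isEmpty then b :: acc else []) (env := .nil)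
    (l := l.reverse) (b := []) (T := 20) (N := N)
    (p := .cond (.tail ▷ .head) .tail (.cond (.tail ▷ .tail) .tail .nil))
    (fun _ => True) (by simpa) trivial (fun _ _ _ _ => trivial)
    (fun acc b _ _ => by
      refine Does.mono (Does.free rfl ?_) (by decide : _ ≤ 20)
      cases acc <;> cases b <;> rfl)
  rw [List.foldl_reverse] at h2
  refine Does.mono (Does.comp (Does.comp h1 (Does.free rfl rfl)) h2) ?_
  simp only [Prog.sz]
  omega

/-- Conversion of an integer from two's complement. -/
def intP : Prog := .cons msbP (absP ▷ trimP)

theorem intP_spec : ∃ c, IsPoly c ∧ ∀ (M W : ℕ) (z : ℤ), W + 1 ≤ M → |z| < 2 ^ W →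
    Does intP (encZ (W + 1) z) (encInt z) (c M) := by
  obtain ⟨c₁, hc₁, h₁⟩ := msbP_spec
  obtain ⟨c₂, hc₂, h₂⟩ := absP_spec
  apply Exists.intro
  apply And.intro
  case right =>
    intro M W z hW hz
    have e1 := h₁ M (W + 1) z hW
    have e2 := h₂ M (W + 1) z hW
    rw [msb_eq W z hz] at e1
    rw [absW_eq W z hz, Int.abs_eq_natAbs] at e2
    have e3 := Does.trim (l := bz (W + 1) (z.natAbs : ℤ)) (N := M) (by simpa)
    rw [trim_bz] at e3
    · exact Does.mono (Does.cons e1 (Does.comp e2 e3)) le_rfl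
    · rw [Int.abs_eq_natAbs] at hz
      have : z.natAbs < 2 ^ W := by exact_mod_cast hz
      rw [pow_succ]
      omega
  case left => fun_prop

/-- Conversion of unary to binary numbers. -/
def binP : Prog := .cons .nil (.cons .nil .id) ▷ foldP (.tail ▷ .tail ▷ incP)

theorem binP_spec : ∃ c, IsPoly c ∧ ∀ M m : ℕ, m ≤ M → Does binP (un m) (encNat m) (c M) := by
  apply Exists.intro
  apply And.intro
  case right =>
    intro M m hm
    have e := Does.fold_prefix (encA := encBool) (encB := encNat) (env := .nil) (b := 0)
      (f := fun j _ => j + 1) (l := List.replicate m false) (N := M) (p := .tail ▷ .tail ▷ incP)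
      (by simpa)
      (fun pre a hpre => by
        have hle := hpre.length_le
        rw [List.length_append, List.length_replicate] at hle
        have hj : pre.foldl (fun j _ => j + 1) 0 = pre.length := by
          rw [List.foldl_const, Nat.succ_iterate, zero_add]
        rw [hj]
        exact Does.call rfl (Does.inc pre.length M
          ((length_bits_le_of_lt Nat.lt_two_pow_self).trans (by simp at hle; omega))))
    rw [List.foldl_const, List.length_replicate, Nat.succ_iterate, zero_add] at e
    rw [encNat, Nat.zero_bits] at e
    exact Does.mono (Does.call rfl e) le_rfl
  case left => fun_prop

/-! ### Preparation of the matrices -/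

/-- The numbers below `D` in binary: the input is `D` in unary. -/
def seedsP : Prog :=
  .cons .nil (.cons (.cons .nil .nil) .id) ▷
    foldP (.cons (.tail ▷ .tail ▷ .head ▷ incP)
      (.cons (.tail ▷ .tail ▷ .head) (.tail ▷ .tail ▷ .tail))) ▷ .tail ▷ revP

theorem seedsP_spec : ∃ c, IsPoly c ∧ ∀ M D : ℕ, 1 ≤ D → D.bits.length ≤ M →
    Does seedsP (un D) (encList encNat (List.range D)) (D * c M) := by
  refine ⟨fun M => M * 300 + 1000, by fun_prop, fun M D hD hM => ?_⟩
  have e := Does.fold_prefix (encA := encBool)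
    (encB := fun j : ℕ => .cons (encNat j) (encList encNat (List.range j).reverse)) (env := .nil)
    (b := 0) (f := fun j _ => j + 1) (l := List.replicate D false) (N := D) (T := M * 300 + 400)
    (p := .cons (.tail ▷ .tail ▷ .head ▷ incP)
      (.cons (.tail ▷ .tail ▷ .head) (.tail ▷ .tail ▷ .tail)))
    (by simp)
    (fun pre a hpre => by
      have hle := hpre.length_le
      rw [List.length_append, List.length_replicate] at hle
      have hj : pre.foldl (fun j _ => j + 1) 0 = pre.length := by
        rw [List.foldl_const, Nat.succ_iterate, zero_add]
      rw [hj]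
      have hb : pre.length.bits.length ≤ M := by
        refine le_trans ?_ hM
        rw [Nat.size_eq_bits_len, Nat.size_eq_bits_len]
        exact Nat.size_le_size (by simp at hle; omega)
      rw [List.range_succ, List.reverse_append]
      refine Does.mono (Does.cons (Does.call rfl (Does.inc pre.length M hb)) (Does.free rfl rfl)) ?_
      simp only [Prog.sz]
      omega)
  rw [List.foldl_const, List.length_replicate, Nat.succ_iterate, zero_add] at e
  have e2 := Does.rev (encA := encNat) (l := (List.range D).reverse) (N := D) (by simp)
  rw [List.reverse_reverse] at e2
  rw [encNat, Nat.zero_bits] at e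
  refine Does.mono (Does.comp (Does.comp (Does.call rfl e) (Does.free rfl rfl)) e2) ?_
  simp only [Prog.sz]
  have : D * (M * 300 + 1000) = D * (M * 300 + 400 + 30) + D * 570 := by ring
  omega

/-- The matrices of the linear maps `H · t`. -/
def matricesOf (n D : ℕ) (H : List Bool → ℕ → List Bool) : List (List (List Bool)) :=
  (List.range D).map fun t => (units n).map fun u => H u t

/-- Program for `matricesOf`: the input is `((params, unit vectors), D)`, with `D` in binary, and
`P` computes `H`. -/
def matricesP (P : Prog) : Prog :=
  .cons .head (.tail ▷ unaryP ▷ seedsP) ▷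
    mapP (.cons (.cons (.head ▷ .head) .tail) (.head ▷ .tail) ▷
      mapP (.cons (.head ▷ .head) (.cons .tail (.head ▷ .tail)) ▷ P))

theorem matricesP_spec (P : Prog) : ∃ c, IsPoly c ∧ ∀ (M n D : ℕ) (params : Data)
    (H : List Bool → ℕ → List Bool), n ≤ M → 1 ≤ D → D.bits.length ≤ M →
    (∀ u t, u.length = n → t < D →
      Does P (.cons params (.cons (encBits u) (encNat t))) (encBits (H u t)) M) →
    Does (matricesP P) (.cons (.cons params (encCols (units n))) (encNat D))
      (encList encCols (matricesOf n D H)) (D * c M) := by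
  obtain ⟨c₁, hc₁, h₁⟩ := seedsP_spec
  refine ⟨fun M => c₁ M + M * (M + 170) + M * 400 + 800, by fun_prop,
    fun M n D params H hn hD hM hP => ?_⟩
  have e1 := Does.unary D M hM
  have e2 := h₁ M D hD hM
  have e3 := Does.map (encA := encNat) (encB := encCols) (env := .cons params (encCols (units n)))
    (f := fun t => (units n).map fun u => H u t) (l := List.range D) (N := D)
    (T := M * (M + 170) + 150)
    (p := .cons (.cons (.head ▷ .head) .tail) (.head ▷ .tail) ▷
      mapP (.cons (.head ▷ .head) (.cons .tail (.head ▷ .tail)) ▷ P)) (by simp)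
    (fun t ht => by
      have e := Does.map (encA := encBits) (encB := encBits) (env := .cons params (encNat t))
        (f := fun u => H u t) (l := units n) (N := M)
        (p := .cons (.head ▷ .head) (.cons .tail (.head ▷ .tail)) ▷ P)
        (by rwa [length_units])
        (fun u hu => Does.call rfl (hP u t (length_of_mem_units hu) (List.mem_range.1 ht)))
      refine Does.mono (Does.call rfl e) ?_
      simp only [Prog.sz]
      have : M * (M + 170) = M * (1 + 1 + 1 + (1 + (1 + 1 + 1) + 1) + 1 + M + 1 + 130) + M * 30 := by
        ring
      omega)
  refine Does.mono (Does.comp (Does.cons (Does.free rfl rfl) (Does.comp (Does.comp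
    (Does.free rfl rfl) e1) e2)) e3) ?_
  simp only [Prog.sz]
  have i1 : D * (c₁ M + M * (M + 170) + M * 400 + 800) = D * c₁ M + D * (M * (M + 170)) +
    M * D * 400 + D * 800 := by ring
  have i2 : D * (M * (M + 170) + 150 + 130) = D * (M * (M + 170)) + D * 280 := by ring
  have i3 : M * (D * 80 + 300) = M * D * 80 + M * 300 := by ring
  have i4 : M ≤ M * D := Nat.le_mul_of_pos_right _ hD
  omega

/-- Preparation: the input is `(n, k, r, D)`. If there are at least `2 ^ n` seeds, then time
`2 ^ n` is available and the identity matrix takes the place of the condenser. -/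
def prepP (P : Prog) : Prog :=
  letP .head unaryP (letP .tail unitsP (letP (.head ▷ .head ▷ .tail ▷ .head) unaryP
    (.cond (.cons (.head ▷ .head ▷ .tail) (.head ▷ .head ▷ .head ▷ .tail ▷ .tail ▷ .tail) ▷ unSubP)
      (.cons (.head ▷ .head ▷ .tail) (.cons (.head ▷ .head ▷ .tail)
        (.cons .tail (.cons (.head ▷ .tail) .nil))))
      (.cons (.head ▷ .head ▷ .tail) (.cons (.head ▷ .head ▷ .head ▷ .tail ▷ .tail ▷ .head ▷ unaryP)
        (.cons .tail (.cons (.cons (.head ▷ .head ▷ .head) (.head ▷ .tail))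
          (.head ▷ .head ▷ .head ▷ .tail ▷ .tail ▷ .tail) ▷ matricesP P)))))))

theorem Does.drop (n : ℕ) (l : List Bool) :
    Does unSubP (.cons (un n) (encBits l)) (encBits (l.drop n)) (n * 40 + 30) := by
  have h := Does.fold (encA := encBool) (encB := encBits) (f := fun s _ => s.tail) (env := .nil)
    (l := List.replicate n false) (b := l) (N := n) (p := .tail ▷ .tail ▷ .tail) (T := 10)
    (fun _ => True) (by simp) trivial
    (fun _ _ _ _ => trivial)
    (fun s _ _ _ => by
      refine Does.mono (Does.free rfl ?_) (by decide : _ ≤ 10)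
      cases s <;> rfl)
  have e : ∀ l : List Bool, (List.replicate n false).foldl (fun s _ => s.tail) l = l.drop n := by
    clear h
    induction n with
    | zero => simp
    | succ n ih =>
      intro l
      rw [List.replicate_succ, List.foldl_cons, ih, List.drop_tail]
  rw [e] at h
  refine Does.mono (Does.call (a := .cons .nil (.cons .tail .head)) rfl h) ?_
  simp only [Prog.sz]
  omega

theorem prepP_spec (P : Prog) : ∃ c, IsLin c ∧ ∀ (M N : ℕ), 1 ≤ N → ∀ (n k r D : ℕ)
    (H : List Bool → ℕ → List Bool), n + 1 ≤ M → r ≤ n → 1 ≤ D → k ≤ N → k.bits.length ≤ M →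
    (D.bits.length ≤ n → (∀ u t, u.length = n → t < D →
      Does P (.cons (encParams n k r D) (.cons (encBits u) (encNat t))) (encBits (H u t)) M) →
      Does (prepP P) (encParams n k r D) (encPrep n r k (matricesOf n D H)) (D * c M N)) ∧
    (n < D.bits.length → Does (prepP P) (encParams n k r D) (encPrep n n k [units n]) (c M N)) := by
  obtain ⟨c₁, hc₁, h₁⟩ := unitsP_spec
  obtain ⟨c₂, hc₂, h₂⟩ := matricesP_spec P
  refine ⟨fun M N => c₁ M + c₂ M + 2 * (M * (M * 80 + 300)) + M * (N * 80 + 300) + M * 40 + 1000,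
    ?_, fun M N hN n k r D H hn hr hD hk hkM => ?_⟩
  · repeat' first
      | assumption
      | exact IsLin.self
      | exact IsLin.of_poly (by fun_prop)
      | refine IsLin.add ?_ ?_
      | refine IsLin.poly_mul (by fun_prop) ?_
  · have ub : ∀ m, m + 1 ≤ M → m.bits.length ≤ M := fun m hm =>
      (length_bits_le_of_lt Nat.lt_two_pow_self).trans (by omega)
    have uc : ∀ m, m ≤ M → M * (m * 80 + 300) ≤ M * (M * 80 + 300) := fun m hm =>
      Nat.mul_le_mul_left _ (by omega)
    have e1 := Does.unary n M (ub n hn)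
    have e2 := h₁ M n (by omega)
    have e3 := Does.unary k M hkM
    have e4 := Does.drop n D.bits
    have j1 := uc n (by omega)
    have j2 := uc r (by omega)
    have j3 : M * (k * 80 + 300) ≤ M * (N * 80 + 300) := Nat.mul_le_mul_left _ (by omega)
    refine ⟨fun hDn hP => ?_, fun hDn => ?_⟩
    · have e5 := Does.unary r M (ub r (by omega))
      have e6 := h₂ M n D (encParams n k r D) H (by omega) hD (by omega) hP
      rw [List.drop_eq_nil_of_le hDn] at e4
      refine Does.mono (Does.letP rfl e1 (Does.letP rfl e2 (Does.letP rfl e3 (Does.cond_false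
        (Does.call rfl e4) (Does.cons (Does.free rfl rfl) (Does.cons (Does.call rfl e5)
        (Does.cons (Does.free rfl rfl) (Does.call rfl e6)))))))) ?_
      simp only [Prog.sz]
      have i1 : D * (c₁ M + c₂ M + 2 * (M * (M * 80 + 300)) + M * (N * 80 + 300) + M * 40 + 1000) =
        D * (c₁ M + 2 * (M * (M * 80 + 300)) + M * (N * 80 + 300) + M * 40 + 1000) + D * c₂ M := by
        ring
      have i2 := Nat.mul_le_mul_right
        (c₁ M + 2 * (M * (M * 80 + 300)) + M * (N * 80 + 300) + M * 40 + 1000) hD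
      omega
    · obtain ⟨d, t, hdt⟩ : ∃ d t, encBits (D.bits.drop n) = .cons d t := by
        cases hdr : D.bits.drop n with
        | nil => rw [List.drop_eq_nil_iff] at hdr; omega
        | cons d t => exact ⟨_, _, rfl⟩
      rw [hdt] at e4
      refine Does.mono (Does.letP rfl e1 (Does.letP rfl e2 (Does.letP rfl e3 (Does.cond_true
        (Does.call rfl e4) (Does.free rfl rfl))))) ?_
      simp only [Prog.sz]
      omega

/-! ### The algorithm -/

/-- Encoding of an entry of the output. -/
def encOut (p : List Bool × ℤ × ℕ) : Data :=
  .cons (encBits p.1) (.cons (encInt p.2.1) (encNat p.2.2))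

/-- The output of the algorithm; `e` is the common exponent of the entries. -/
def outputOf (W n k r s e : ℕ) (ms : List Meas) : List (List Bool × ℤ × ℕ) :=
  (aggregate n (recover W k n r ms s)).map fun p => (p.1, p.2.getD 0 0, e)

/-- The part of the second phase that comes after the preparation: the input is
`((nothing, answers), prep)`; the programs `pB`, `pW`, `ps`, `pe` compute the precision of the
measurements, the word length, the number of rounds and an exponent from `n`. -/
def finishP (pB pW ps pe : Prog) : Prog :=
  letP (.tail ▷ .head) pB (letP (.head ▷ .tail ▷ .head) pW
    (letP (.head ▷ .head ▷ .tail ▷ .head) ps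
    (letP (.cons (.head ▷ .head ▷ .head ▷ .tail)
      (.cons (.head ▷ .head ▷ .head ▷ .head ▷ .tail) (.cons (.head ▷ .head ▷ .tail)
        (.head ▷ .tail)))) measP
    (letP (.cons (.cons (.cons (.head ▷ .head ▷ .head ▷ .head ▷ .tail ▷ .tail ▷ .head)
        (.cons (.head ▷ .head ▷ .head ▷ .head ▷ .tail ▷ .head)
          (.cons (.head ▷ .head ▷ .head ▷ .head ▷ .tail ▷ .tail ▷ .tail ▷ .head)
            (.head ▷ .head ▷ .tail)))) .tail) (.head ▷ .tail)) recoverP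
    (letP (.cons (.head ▷ .head ▷ .head ▷ .head ▷ .head ▷ .tail ▷ .head) .tail) aggregateP
    (.cons (.cons (.head ▷ .head ▷ .head ▷ .head ▷ .head ▷ .head ▷ .tail ▷ .tail ▷ .head)
      (.cons (.head ▷ .head ▷ .head ▷ .head ▷ .head ▷ .head ▷ .tail ▷ .tail ▷ .head)
        (.head ▷ .head ▷ .head ▷ .head ▷ .head ▷ .head ▷ .tail ▷ .head ▷ pe) ▷ appendP) ▷
          appendP ▷ binP) .tail ▷
      mapP (.cons (.tail ▷ .head) (.cons (.tail ▷ .tail ▷ .head ▷ intP) .head))))))))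

theorem finishP_spec {pB pW ps pe : Prog} {c : ℕ → ℕ} (hc : IsPoly c) :
    ∃ d, IsLin d ∧ ∀ (M N : ℕ), 1 ≤ N → ∀ (W B s e n r k D : ℕ)
    (mats : List (List (List Bool))) (ans : List Bool → ℤ × ℕ) (x : Data),
    W + 1 ≤ M → B ≤ M → s ≤ M → e + 2 * r ≤ M → n + 1 ≤ M → r ≤ M → 2 ^ r ≤ N → k ≤ N → 1 ≤ D →
    mats.length ≤ D → (∀ m ∈ mats, IsMat n r m) →
    (∀ e : List Bool, e.length = n → |(ans e).1| < 2 ^ B ∧ (ans e).2 ≤ B) →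
    Does pB (un n) (un B) (c M) → Does pW (un n) (un (W + 1)) (c M) →
    Does ps (un n) (un s) (c M) → Does pe (un n) (un e) (c M) →
    (∀ p ∈ outputOf (W + 1) n k r s (r + (r + e))
      (mats.map (measOf n r fun e => conv B (ans e))), |p.2.1| < 2 ^ W) →
    Does (finishP pB pW ps pe)
      (.cons (.cons x (encList encAnswer ((allQueries n r mats).map ans))) (encPrep n r k mats))
      (encList encOut (outputOf (W + 1) n k r s (r + (r + e))
        (mats.map (measOf n r fun e => conv B (ans e))))) (D ^ 2 * d M N) := by
  obtain ⟨c₁, hc₁, h₁⟩ := measP_spec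
  obtain ⟨c₂, hc₂, h₂⟩ := recoverP_spec
  obtain ⟨c₃, hc₃, h₃⟩ := aggregateP_spec
  obtain ⟨c₄, hc₄, h₄⟩ := binP_spec
  obtain ⟨c₅, hc₅, h₅⟩ := intP_spec
  refine ⟨fun M N => 4 * c M + c₁ M N + c₂ M N + c₃ M N + c₄ M + N * (c₅ M + 200) +
    160 * M + 2000, ?_,
    fun M N hN W B s e n r k D mats ans x hW hB hs he hn hr hrN hk hD hmD hmats hans hpB hpW hps
      hpe hout => ?_⟩
  · repeat' first
      | assumption
      | exact IsLin.self
      | exact IsLin.of_poly (by fun_prop)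
      | refine IsLin.add ?_ ?_
      | refine IsLin.mul_poly ?_ (by fun_prop)
  · set ms := mats.map (measOf n r fun e => conv B (ans e)) with hms
    have hmeas : ∀ m ∈ ms, IsMeas n r N m := by
      intro m hm
      obtain ⟨m', hm', rfl⟩ := List.mem_map.1 hm
      exact measOf_isMeas _ (hmats m' hm') hrN
    have hmsD : ms.length ≤ D := by rwa [hms, List.length_map]
    have e1 := h₁ M N hN (W + 1) B n r k D mats ans hW hB hn hr hrN hD hmD hmats hans
    have e2 := h₂ M N hN (W + 1) k n r D s ms hW hn hr hs hD hk hmsD hmeas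
    have hsig : IsSig n N (recover (W + 1) k n r ms s) := recover_isSig hk hmeas
    have e3 := h₃ M N hN (W + 1) n 1 (recover (W + 1) k n r ms s) hW (by omega) (by omega) hsig.2
      hsig.1
    have e4 := Does.unAdd r e M (by omega)
    have e5 := Does.unAdd r (r + e) M (by omega)
    have e6 := h₄ M (r + (r + e)) (by omega)
    have e7 := Does.map (encA := encItem (W + 1)) (encB := encOut) (env := encNat (r + (r + e)))
      (f := fun p => (p.1, p.2.getD 0 0, r + (r + e)))
      (l := aggregate n (recover (W + 1) k n r ms s)) (N := N) (T := c₅ M + 30)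
      (p := .cons (.tail ▷ .head) (.cons (.tail ▷ .tail ▷ .head ▷ intP) .head))
      ((length_aggregate_le hsig.1).trans hsig.2)
      (fun p hp => by
        have hv := (aggregate_hasDims hsig.1 p hp).2
        have hlt := hout _ (List.mem_map_of_mem hp)
        rcases p with ⟨i, _ | ⟨v, t⟩⟩
        · simp at hv
        · refine Does.mono (Does.cons (Does.free rfl rfl) (Does.cons (Does.call rfl
            (h₅ M W v hW hlt)) (Does.free rfl rfl))) ?_
          simp only [Prog.sz]
          omega)
    refine Does.mono (Does.letP rfl hpB (Does.letP rfl hpW (Does.letP rfl hps (Does.letP rfl e1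
      (Does.letP rfl e2 (Does.letP rfl e3 (Does.comp (Does.cons (Does.comp (Does.comp
      (Does.cons (Does.free rfl rfl) (Does.comp (Does.cons (Does.free rfl rfl) (Does.call rfl hpe))
        e4)) e5) e6) (Does.free rfl rfl)) e7))))))) ?_
    simp only [Prog.sz]
    have hD2 : 1 ≤ D ^ 2 := Nat.one_le_pow _ _ hD
    have i1 := Nat.mul_le_mul_right (4 * c M + c₃ M N + c₄ M + N * (c₅ M + 200) +
      160 * M + 2000) hD2
    have i2 := Nat.mul_le_mul_right (c₁ M N) (Nat.le_self_pow (n := 2) (by norm_num) D)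
    have i3 : D ^ 2 * (4 * c M + c₁ M N + c₂ M N + c₃ M N + c₄ M + N * (c₅ M + 200) +
      160 * M + 2000) = D ^ 2 * (4 * c M + c₃ M N + c₄ M + N * (c₅ M + 200) +
      160 * M + 2000) + D ^ 2 * c₁ M N + D ^ 2 * c₂ M N := by ring
    have i4 : N * (c₅ M + 200) = N * (c₅ M + 30 + 130) + N * 40 := by ring
    omega

/-! ### The measurements computed from values of the transform -/

theorem dotB_comm (u v : List Bool) : dotB u v = dotB v u := by
  induction u generalizing v with
  | nil => cases v <;> rfl
  | cons a u ih =>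
    cases v with
    | nil => rfl
    | cons b v => simp [dotB, ih v, Bool.and_comm]

theorem dotB_vxor (w : List Bool) {u v : List Bool} (h : u.length = v.length) :
    dotB w (vxor u v) = (dotB w u ^^ dotB w v) := by
  induction u generalizing v w with
  | nil => cases v <;> cases w <;> simp_all [vxor, dotB]
  | cons a u ih =>
    cases v with
    | nil => simp at h
    | cons b v =>
      cases w with
      | nil => rfl
      | cons c w =>
        have := ih w (v := v) (by simpa using h)
        rw [vxor] at this
        simp only [vxor, List.zipWith_cons_cons, dotB, this]
        cases a <;> cases b <;> cases c <;> cases dotB w u <;> cases dotB w v <;> rfl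

theorem dotB_hashB {r : ℕ} (w : List Bool) {z : List Bool} {cols : List (List Bool)}
    (hz : z.length = r) (hc : ∀ c ∈ cols, c.length = r) (i : List Bool) :
    dotB w (hashB z cols i) = (dotB w z ^^ dotB (rowOf cols w) i) := by
  induction cols generalizing z i with
  | nil => simp [hashB, rowOf, dotB]
  | cons c cols ih =>
    have hcr := hc c (by simp)
    have hc' : ∀ c ∈ cols, c.length = r := fun d hd => hc d (by simp [hd])
    cases i with
    | nil => simp [hashB, rowOf, dotB]
    | cons b i =>
      cases b
      · have := ih hz hc' i
        simp only [rowOf, List.map_cons, dotB, Bool.and_false, Bool.false_xor]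
        exact this
      · have := ih (z := vxor z c) (by simp [vxor, hz, hcr]) hc' i
        rw [dotB_vxor w (hz.trans hcr.symm)] at this
        simp only [rowOf, List.map_cons, dotB, Bool.and_true]
        rw [← Bool.xor_assoc]
        exact this

/-- Orthogonality of characters. -/
theorem sum_sg_mul_sg {r : ℕ} {z y : List Bool} (hz : z ∈ keys r) (hy : y ∈ keys r) :
    ∑ w ∈ keys r, sg (dotB w z) * sg (dotB w y) = if z = y then 2 ^ r else 0 := by
  induction r generalizing z y with
  | zero =>
    rw [mem_keys, List.length_eq_zero_iff] at hz hy
    subst hz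
    subst hy
    rfl
  | succ r ih =>
    rcases z with _ | ⟨c, z⟩
    · simp at hz
    rcases y with _ | ⟨d, y⟩
    · simp at hy
    rw [sum_keys_succ]
    have e : ∀ w ∈ keys r, sg (dotB (false :: w) (c :: z)) * sg (dotB (false :: w) (d :: y)) +
        sg (dotB (true :: w) (c :: z)) * sg (dotB (true :: w) (d :: y)) =
        (1 + sg c * sg d) * (sg (dotB w z) * sg (dotB w y)) := by
      intro w _
      simp only [dotB, sg_xor, Bool.false_and, Bool.true_and]
      rw [show sg false = 1 from rfl]
      ring
    rw [Finset.sum_congr rfl e, ← Finset.mul_sum, ih (by simpa using hz) (by simpa using hy)]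
    by_cases h : z = y
    · cases c <;> cases d <;> simp [h, sg, pow_succ, mul_comm]
    · simp [h]

/-- The signal with the transform `a`, up to scaling. -/
def signalOf (n r : ℕ) (a : List Bool → ℤ) (j : List Bool) : ℤ :=
  2 ^ r * ∑ q ∈ keys n, sg (dotB q j) * a q

theorem sum_sg_mul_signalOf {n r : ℕ} (a : List Bool → ℤ) {q : List Bool} (hq : q ∈ keys n) :
    ∑ j ∈ keys n, sg (dotB q j) * signalOf n r a j = 2 ^ r * (2 ^ n * a q) := by
  have e : ∀ j ∈ keys n, sg (dotB q j) * signalOf n r a j =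
      ∑ p ∈ keys n, 2 ^ r * (a p * (sg (dotB j q) * sg (dotB j p))) := by
    intro j _
    rw [signalOf, Finset.mul_sum, Finset.mul_sum]
    refine Finset.sum_congr rfl fun p _ => ?_
    rw [dotB_comm q j, dotB_comm p j]
    ring
  rw [Finset.sum_congr rfl e, Finset.sum_comm]
  have e2 : ∀ p ∈ keys n, ∑ j ∈ keys n, 2 ^ r * (a p * (sg (dotB j q) * sg (dotB j p))) =
      if q = p then 2 ^ r * (2 ^ n * a p) else 0 := by
    intro p hp
    rw [← Finset.mul_sum, ← Finset.mul_sum, sum_sg_mul_sg hq hp]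
    split_ifs
    · ring
    · simp
  rw [Finset.sum_congr rfl e2, Finset.sum_ite_eq, if_pos hq]

theorem evalAt_map_of_mem {ws : List (List Bool)} (hn : ws.Nodup) (f : List Bool → List ℤ)
    {w : List Bool} (hw : w ∈ ws) (b : ℕ) :
    evalAt (ws.map fun w => (w, f w)) w b = (f w).getD b 0 := by
  refine evalAt_of_mem (l := ws.map fun w => (w, f w)) (p := (w, f w)) ?_
    (List.mem_map_of_mem hw) b
  rwa [List.map_map, show (Prod.fst ∘ fun w => (w, f w)) = _root_.id from rfl, List.map_id]

theorem signAt_eq {n b : ℕ} {i : List Bool} (hi : i.length = n) (hb : b < n + 1) :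
    signAt i b = sg (dotB ((offsets n)[b]'(by rwa [length_offsets])) i) := by
  have h : b < ((offsets n).map fun e => dotB e i).length := by
    rwa [List.length_map, length_offsets]
  have e := List.getD_eq_getElem _ false h
  rw [List.getElem_map] at e
  rw [← e, dotB_offsets hi]
  rfl

/-- By the Poisson summation formula, the transform of `w ↦ A (wᵀ h + e)` gives the sums over the
buckets of `h`, with the signs determined by `e`. -/
theorem measures_measOf {n r : ℕ} (a : List Bool → ℤ) {m : List (List Bool)} (hm : IsMat n r m) :
    Measures n r (signalOf n r a) (measOf n r (fun q => 2 ^ n * a q) m) := by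
  intro z hz b hb
  set A : List Bool → ℤ := fun q => 2 ^ n * a q with hA
  have hlt : b < (offsets n).length := by rw [length_offsets]; omega
  have hel := length_of_mem_offsets (List.getElem_mem hlt)
  rw [measOf, evalAt_wht (measOf_input_hasDims n r A m) (by simp [length_allBits]) hz]
  have e1 : ∀ w ∈ keys r, evalAt ((allBits r).map fun w =>
      (w, (offsets n).map fun e => A (vxor (rowOf m w) e))) w b =
      A (vxor (rowOf m w) (offsets n)[b]) := by
    intro w hw
    rw [evalAt_map_of_mem (nodup_allBits r) _ (mem_allBits.2 hw),
      List.getD_eq_getElem _ _ (by simpa using hlt), List.getElem_map]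
  rw [Finset.sum_congr rfl fun w hw => by rw [e1 w hw]]
  refine mul_left_cancel₀ (pow_ne_zero r (two_ne_zero' ℤ)) ?_
  rw [Finset.mul_sum, Finset.mul_sum]
  have e2 : ∀ w ∈ keys r, 2 ^ r * (sg (dotB w z) * A (vxor (rowOf m w) (offsets n)[b])) =
      ∑ j ∈ keys n, signAt j b * signalOf n r a j *
        (sg (dotB w z) * sg (dotB w (hashB (zeros r) m j))) := by
    intro w hw
    have hq : vxor (rowOf m w) (offsets n)[b] ∈ keys n := by
      simp [vxor, length_rowOf, hm.1, hel]
    have := sum_sg_mul_signalOf (r := r) a hq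
    rw [mul_left_comm, hA, ← this, Finset.mul_sum]
    refine Finset.sum_congr rfl fun j hj => ?_
    rw [dotB_comm _ j, dotB_vxor j (by rw [length_rowOf, hm.1, hel]), sg_xor,
      dotB_hashB w (by simp : (zeros r).length = r) hm.2, dotB_comm w (zeros r), dotB_zeros,
      Bool.false_xor, dotB_comm j, dotB_comm j, signAt_eq (mem_keys.1 hj) (by omega)]
    ring
  rw [Finset.sum_congr rfl e2, Finset.sum_comm, bucket, Finset.sum_filter]
  refine Finset.sum_congr rfl fun j hj => ?_
  have hH : hashB (zeros r) m j ∈ keys r := mem_keys.2 (length_hashB (by simp) hm.2)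
  rw [← Finset.mul_sum, sum_sg_mul_sg hz hH]
  by_cases h : z = hashB (zeros r) m j
  · rw [if_pos h, if_pos h.symm]
    ring
  · rw [if_neg h, if_neg (fun h' => h h'.symm)]
    ring

theorem abs_signalOf_le {n r : ℕ} {a : List Bool → ℤ} {C : ℤ} (ha : ∀ q ∈ keys n, |a q| ≤ C)
    (j : List Bool) : |signalOf n r a j| ≤ 2 ^ r * (2 ^ n * C) := by
  rw [signalOf, abs_mul, abs_of_nonneg (by positivity : (0 : ℤ) ≤ 2 ^ r)]
  refine mul_le_mul_of_nonneg_left ?_ (by positivity)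
  refine (Finset.abs_sum_le_sum_abs _ _).trans ((Finset.sum_le_card_nsmul _ _ C fun q hq => ?_).trans
    (le_of_eq ?_))
  · rw [abs_mul, abs_sg, one_mul]
    exact ha q hq
  · rw [card_keys]
    simp

theorem norm1_signalOf_le {n r : ℕ} {a : List Bool → ℤ} {C : ℤ} (ha : ∀ q ∈ keys n, |a q| ≤ C) :
    norm1 (keys n) (signalOf n r a) ≤ 2 ^ n * (2 ^ r * (2 ^ n * C)) := by
  refine (Finset.sum_le_card_nsmul _ _ _ fun j _ => abs_signalOf_le ha j).trans (le_of_eq ?_)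
  rw [card_keys]
  simp

/-! ### Vectors over `𝔽₂` as bit strings -/

/-- The bit string of a vector. -/
def bits {n : ℕ} (v : F2 n) : List Bool := List.ofFn fun i => decide (v i = 1)

/-- The vector of a bit string. -/
def vec (n : ℕ) (l : List Bool) : F2 n := fun i => if l.getD i false then 1 else 0

@[simp] theorem length_bits {n : ℕ} (v : F2 n) : (bits v).length = n := by simp [bits]

theorem bits_mem_keys {n : ℕ} (v : F2 n) : bits v ∈ keys n := by simp

theorem bits_vec {n : ℕ} {l : List Bool} (hl : l.length = n) : bits (vec n l) = l := by
  refine List.ext_getElem (by simp [hl]) fun i h1 h2 => ?_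
  simp only [bits, vec, List.getElem_ofFn, List.getD_eq_getElem _ _ h2]
  cases l[i] <;> simp

theorem vec_bits {n : ℕ} (v : F2 n) : vec n (bits v) = v := by
  funext i
  have h : (i : ℕ) < (bits v).length := by simp
  simp only [vec, List.getD_eq_getElem _ _ h]
  simp only [bits, List.getElem_ofFn, Fin.eta, decide_eq_true_eq]
  generalize v i = c
  revert c
  decide

theorem bits_injective {n : ℕ} : Function.Injective (bits (n := n)) :=
  Function.LeftInverse.injective vec_bits

theorem sum_bits {β : Type} [AddCommMonoid β] {n : ℕ} (f : List Bool → β) :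
    ∑ v : F2 n, f (bits v) = ∑ k ∈ keys n, f k :=
  Finset.sum_bij' (fun v _ => bits v) (fun l _ => vec n l) (fun v _ => bits_mem_keys v)
    (fun _ _ => Finset.mem_univ _) (fun v _ => vec_bits v) (fun _ hl => bits_vec (mem_keys.1 hl))
    fun _ _ => rfl

theorem bits_add {n : ℕ} (u v : F2 n) : bits (u + v) = vxor (bits u) (bits v) := by
  refine List.ext_getElem (by simp [vxor]) fun i h1 h2 => ?_
  simp only [bits, vxor, List.getElem_ofFn, List.getElem_zipWith, Pi.add_apply]
  exact (by decide : ∀ c d : ZMod 2, decide (c + d = 1) = (decide (c = 1) ^^ decide (d = 1))) _ _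

theorem bits_zero (n : ℕ) : bits (0 : F2 n) = zeros n := by
  simp [bits]

theorem vec_vxor {n : ℕ} {u v : List Bool} (hu : u.length = n) (hv : v.length = n) :
    vec n (vxor u v) = vec n u + vec n v := by
  refine bits_injective ?_
  rw [bits_add, bits_vec hu, bits_vec hv, bits_vec (by simp [vxor, hu, hv])]

theorem hashB_map {n : ℕ} {φ : List Bool → List Bool}
    (hφ : ∀ u v, u.length = n → v.length = n → φ (vxor u v) = vxor (φ u) (φ v))
    {z : List Bool} {cols : List (List Bool)} (hz : z.length = n)
    (hc : ∀ c ∈ cols, c.length = n) (i : List Bool) :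
    hashB (φ z) (cols.map φ) i = φ (hashB z cols i) := by
  induction cols generalizing z i with
  | nil => rfl
  | cons c cols ih =>
    have hcr := hc c (by simp)
    have hc' : ∀ c ∈ cols, c.length = n := fun d hd => hc d (by simp [hd])
    cases i with
    | nil => rfl
    | cons b i =>
      cases b
      · exact ih hz hc' i
      · have := ih (z := vxor z c) (by simp [vxor, hz, hcr]) hc' i
        rw [hφ z c hz hcr] at this
        exact this

/-- A linear map is given by the matrix of its values at the unit vectors. -/
theorem hashB_linear {n r : ℕ} {f : F2 n → F2 r} (hf : IsLinearMap (ZMod 2) f) {i : List Bool}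
    (hi : i.length = n) :
    hashB (zeros r) ((units n).map fun u => bits (f (vec n u))) i = bits (f (vec n i)) := by
  have h := hashB_map (n := n) (φ := fun u => bits (f (vec n u)))
    (fun u v hu hv => by rw [vec_vxor hu hv, hf.map_add, bits_add]) (z := zeros n) (by simp)
    (fun c hc => length_of_mem_units hc) i
  rw [hashB_units hi] at h
  rw [← h, ← bits_zero n, vec_bits, hf.map_zero, bits_zero]

/-! ### The transform on bit strings -/

theorem neg_one_pow_dotProduct {n : ℕ} (u v : F2 n) :
    (-1 : ℝ) ^ (ZMod.val (u ⬝ᵥ v)) = sg (dotB (bits u) (bits v)) := by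
  have hadd : ∀ c d : ZMod 2, (-1 : ℝ) ^ (c + d).val = (-1) ^ c.val * (-1) ^ d.val := by
    intro c d
    rw [← pow_add, ZMod.val_add]
    exact (neg_one_pow_eq_pow_mod_two (c.val + d.val)).symm
  have hmul : ∀ c d : ZMod 2, (-1 : ℝ) ^ (c * d).val = sg (decide (c = 1) && decide (d = 1)) := by
    intro c d
    rw [(by decide : ∀ c d : ZMod 2, (c * d).val = (decide (c = 1) && decide (d = 1)).toNat) c d]
    cases decide (c = 1) && decide (d = 1) <;> simp [sg]
  induction n with
  | zero => simp [bits, dotB, sg]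
  | succ n ih =>
    have := ih (fun i => u i.succ) (fun i => v i.succ)
    rw [dotProduct, Fin.sum_univ_succ, hadd, hmul, bits, bits, List.ofFn_succ, List.ofFn_succ,
      dotB, sg_xor]
    push_cast
    rw [← bits, ← bits, ← this]
    rfl

/-- Inversion of the transform. -/
theorem sum_sg_mul_dht {n : ℕ} (x : F2 n → ℝ) (j : F2 n) :
    ∑ q ∈ keys n, (sg (dotB q (bits j)) : ℝ) * dht x (vec n q) = Real.sqrt (2 ^ n) * x j := by
  have hs : Real.sqrt (2 ^ n) ≠ 0 := by positivity
  have hs2 : Real.sqrt (2 ^ n) * Real.sqrt (2 ^ n) = 2 ^ n := Real.mul_self_sqrt (by positivity)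
  have e : ∀ q ∈ keys n, (sg (dotB q (bits j)) : ℝ) * dht x (vec n q) =
      ∑ p ∈ keys n, (1 / Real.sqrt (2 ^ n)) * x (vec n p) *
        ((sg (dotB q (bits j)) * sg (dotB q p) : ℤ) : ℝ) := by
    intro q hq
    rw [dht, ← sum_bits, Finset.mul_sum, Finset.mul_sum]
    refine Finset.sum_congr rfl fun p _ => ?_
    rw [neg_one_pow_dotProduct, bits_vec (mem_keys.1 hq), vec_bits]
    push_cast
    ring
  rw [Finset.sum_congr rfl e, Finset.sum_comm]
  have e2 : ∀ p ∈ keys n, ∑ q ∈ keys n, (1 / Real.sqrt (2 ^ n)) * x (vec n p) *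
        ((sg (dotB q (bits j)) * sg (dotB q p) : ℤ) : ℝ) =
      if bits j = p then (1 / Real.sqrt (2 ^ n)) * x (vec n p) * 2 ^ n else 0 := by
    intro p hp
    rw [← Finset.mul_sum, ← Int.cast_sum, sum_sg_mul_sg (bits_mem_keys j) hp]
    split_ifs <;> simp
  rw [Finset.sum_congr rfl e2, Finset.sum_ite_eq, if_pos (bits_mem_keys j), vec_bits]
  generalize Real.sqrt (2 ^ n) = t at hs hs2 ⊢
  rw [← hs2]
  field_simp

/-! ### Lossless condensers are expanders -/

theorem le_of_minEntropy {Ω : Type} [Fintype Ω] (Y : PMF Ω) {m : ℝ} (hm : 0 < m)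
    (h : Real.logb 2 m ≤ minEntropy Y) (s : Ω) : (Y s).toReal ≤ 1 / m := by
  by_cases hs : s ∈ Y.support
  · have h1 : minEntropy Y ≤ -Real.logb 2 (Y s).toReal :=
      ciInf_le (f := fun s : Y.support => -Real.logb 2 (Y s).toReal)
        (Set.finite_range _).bddBelow ⟨s, hs⟩
    have hpos : 0 < (Y s).toReal :=
      ENNReal.toReal_pos ((PMF.mem_support_iff _ _).1 hs) (PMF.apply_ne_top _ _)
    have h2 := h.trans h1
    rw [← Real.logb_inv, Real.logb_le_logb (by norm_num) hm (by positivity)] at h2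
    rw [one_div]
    exact (le_inv_comm₀ hm hpos).1 h2
  · rw [PMF.mem_support_iff, not_not] at hs
    rw [hs]
    simp
    positivity

theorem sum_toReal {Ω : Type} [Fintype Ω] (p : PMF Ω) : ∑ s, (p s).toReal = 1 := by
  rw [← ENNReal.toReal_sum fun s _ => PMF.apply_ne_top p s, ← tsum_fintype (L := .unconditional Ω),
    PMF.tsum_coe]
  rfl

/-- If `p` is supported on `T`, then it is far from all distributions of min-entropy much larger
than `log |T|`. -/
theorem le_statDist {Ω : Type} [Fintype Ω] [DecidableEq Ω] (p Y : PMF Ω) (T : Finset Ω)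
    (hT : ∀ s, s ∉ T → p s = 0) {m : ℝ} (hm : 0 < m) (h : Real.logb 2 m ≤ minEntropy Y) :
    1 - T.card / m ≤ statDist p Y := by
  have hp := sum_toReal p
  have hY := sum_toReal Y
  rw [← Finset.sum_add_sum_compl T] at hp hY
  have h0 : ∑ s ∈ Tᶜ, (p s).toReal = 0 :=
    Finset.sum_eq_zero fun s hs => by rw [hT s (by simpa using hs)]; rfl
  have h1 : ∑ s ∈ T, (Y s).toReal ≤ T.card / m := by
    refine (Finset.sum_le_card_nsmul _ _ _ fun s _ => le_of_minEntropy Y hm h s).trans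
      (le_of_eq ?_)
    rw [nsmul_eq_mul, mul_one_div]
  have h2 : ∑ s ∈ T, ((p s).toReal - (Y s).toReal) ≤ ∑ s ∈ T, |(p s).toReal - (Y s).toReal| :=
    Finset.sum_le_sum fun s _ => le_abs_self _
  have h3 : ∑ s ∈ Tᶜ, ((Y s).toReal - (p s).toReal) ≤ ∑ s ∈ Tᶜ, |(p s).toReal - (Y s).toReal| :=
    Finset.sum_le_sum fun s _ => by rw [abs_sub_comm]; exact le_abs_self _
  rw [Finset.sum_sub_distrib] at h2 h3
  rw [statDist, ← Finset.sum_add_sum_compl T]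
  linarith

section

variable {n r D : ℕ} [NeZero D] {h : F2 n × Fin D → F2 r}

theorem condenserOutput_eq_zero {S : Finset (F2 n)} (hS : S.Nonempty) (s : Fin D × F2 r)
    (hs : s ∉ (Finset.univ.sigma fun t : Fin D => S.image fun u => h (u, t)).map
      (Equiv.sigmaEquivProd (Fin D) (F2 r)).toEmbedding) : condenserOutput h S hS s = 0 := by
  rw [PMF.apply_eq_zero_iff]
  intro hsup
  refine hs ?_
  rw [condenserOutput, PMF.mem_support_bind_iff] at hsup
  obtain ⟨u, hu, hsup⟩ := hsup
  rw [PMF.mem_support_bind_iff] at hsup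
  obtain ⟨t, _, hsup⟩ := hsup
  rw [PMF.mem_support_pure_iff] at hsup
  rw [PMF.mem_support_uniformOfFinset_iff] at hu
  rw [Finset.mem_map]
  exact ⟨⟨t, h (u, t)⟩, by simpa using ⟨u, hu, rfl⟩, hsup.symm⟩

/-- Most of the pairs `(t, h (u, t))` are distinct. -/
theorem IsLosslessCondenser.le_sum_card_image {k : ℕ} (hk : 0 < k)
    (hh : IsLosslessCondenser (Real.logb 2 (4 * (k : ℝ))) (1 / 32) h) {S : Finset (F2 n)}
    (hS : S.card ≤ 4 * k) :
    31 * (D * S.card) ≤ 32 * ∑ t : Fin D, (S.image fun u => h (u, t)).card := by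
  rcases S.eq_empty_or_nonempty with rfl | hne
  · simp
  have hk' : (0 : ℝ) < 4 * k := by positivity
  obtain ⟨Y, hY, hd⟩ := hh S hne (by
    rw [Real.rpow_logb (by norm_num) (by norm_num) hk']
    exact_mod_cast hS)
  have hD : (0 : ℝ) < D := by exact_mod_cast NeZero.pos D
  have hc : (0 : ℝ) < S.card := by exact_mod_cast hne.card_pos
  have hm : (0 : ℝ) < D * S.card := mul_pos hD hc
  have h1 := (le_statDist (condenserOutput h S hne) Y _ (condenserOutput_eq_zero hne) hm hY).trans
    hd
  rw [Finset.card_map, Finset.card_sigma] at h1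
  rw [sub_le_comm, le_div_iff₀ hm] at h1
  have h2 : (31 : ℝ) * (D * S.card) ≤
      32 * (∑ t : Fin D, (S.image fun u => h (u, t)).card : ℕ) := by linarith
  exact_mod_cast h2

/-- For most seeds, the condenser is almost injective on a set of `k` points, so that its range
cannot be much smaller. -/
theorem IsLosslessCondenser.le_two_pow {k : ℕ} (hk : 0 < k) (hkn : k ≤ 2 ^ n)
    (hh : IsLosslessCondenser (Real.logb 2 (4 * (k : ℝ))) (1 / 32) h) : k ≤ 2 * 2 ^ r := by
  obtain ⟨S, -, hS⟩ := Finset.exists_subset_card_eq (s := (Finset.univ : Finset (F2 n))) (n := k)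
    (by simpa using hkn)
  have h1 := hh.le_sum_card_image hk (S := S) (by omega)
  have h2 : ∑ t : Fin D, (S.image fun u => h (u, t)).card ≤ D * 2 ^ r := by
    refine (Finset.sum_le_card_nsmul _ _ (2 ^ r) fun t _ => ?_).trans (le_of_eq (by simp))
    exact (Finset.card_le_univ _).trans (le_of_eq (by simp))
  have hD := NeZero.pos D
  rw [hS] at h1
  have h3 : D * (31 * k) ≤ D * (32 * 2 ^ r) := by nlinarith
  have := Nat.le_of_mul_le_mul_left h3 hD
  omega

/-- The map given by `h` on bit strings. -/
def hashBits (h : F2 n × Fin D → F2 r) (u : List Bool) (t : ℕ) : List Bool :=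
  bits (h (vec n u, Fin.ofNat D t))

theorem IsLosslessCondenser.isExpander {k : ℕ} (hk : 0 < k)
    (hh : IsLosslessCondenser (Real.logb 2 (4 * (k : ℝ))) (1 / 32) h) :
    IsExpander (keys n) (2 * k) fun (t : Fin D) (u : List Bool) => hashBits h u t := by
  intro S hS hSk
  have hinj : Set.InjOn (vec n) S := fun u hu v hv huv => by
    rw [← bits_vec (mem_keys.1 (hS hu)), huv, bits_vec (mem_keys.1 (hS hv))]
  have h1 := hh.le_sum_card_image hk (S := S.image (vec n)) (by
    rw [Finset.card_image_of_injOn hinj]; omega)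
  rw [Finset.card_image_of_injOn hinj] at h1
  rw [Fintype.card_fin]
  refine h1.trans (le_of_eq ?_)
  congr 1
  refine Finset.sum_congr rfl fun t _ => ?_
  rw [← Finset.card_image_of_injective ((S.image (vec n)).image fun u => h (u, t)) bits_injective,
    Finset.image_image, Finset.image_image]
  congr 2
  funext u
  simp [hashBits]

theorem isExpander_matrices {k : ℕ} (hlin : LinearInFirst h) {A : List Bool → ℤ}
    (hE : IsExpander (keys n) k fun (t : Fin D) (u : List Bool) => hashBits h u t) :
    IsExpander (keys n) k fun t : Fin ((matricesOf n D (hashBits h)).map (measOf n r A)).length =>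
      hashOf r ((matricesOf n D (hashBits h)).map (measOf n r A))[t] := by
  have hlen : ((matricesOf n D (hashBits h)).map (measOf n r A)).length = D := by
    simp [matricesOf]
  intro S hS hSk
  have h1 := hE S hS hSk
  rw [Fintype.card_fin] at h1 ⊢
  refine (le_of_eq (by rw [hlen])).trans (h1.trans (le_of_eq ?_))
  congr 1
  refine Fintype.sum_equiv (finCongr hlen.symm) _ _ fun t => ?_
  congr 1
  refine Finset.image_congr fun i hi => ?_
  have hcols : ∀ (j : ℕ) (hj : j < ((matricesOf n D (hashBits h)).map (measOf n r A)).length),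
      ((matricesOf n D (hashBits h)).map (measOf n r A))[j].1 =
        (units n).map fun u => hashBits h u j := by
    intro j hj
    simp [measOf, matricesOf]
  have := hashB_linear (hlin t) (mem_keys.1 (hS hi))
  change hashBits h i t = hashB (zeros r)
    (((matricesOf n D (hashBits h)).map (measOf n r A))[(t : ℕ)]'(by rw [hlen]; exact t.2)).1 i
  rw [hcols]
  simp only [hashBits, Fin.ofNat_val_eq_self]
  exact this.symm

end

theorem isExpander_units (n k : ℕ) (A : List Bool → ℤ) :
    IsExpander (keys n) k fun t : Fin ([units n].map (measOf n n A)).length =>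
      hashOf n ([units n].map (measOf n n A))[t] := by
  intro S hS _
  have h1 : ∀ t : Fin ([units n].map (measOf n n A)).length,
      (S.image (hashOf n ([units n].map (measOf n n A))[t])).card = S.card := by
    intro t
    refine Finset.card_image_of_injOn fun u hu v hv huv => ?_
    have ht : ([units n].map (measOf n n A))[t].1 = units n := by
      obtain ⟨t, h⟩ := t
      have h0 : t = 0 := by simpa using h
      subst h0
      rfl
    rwa [hashOf, hashOf, ht, hashB_units (mem_keys.1 (hS hu)),
      hashB_units (mem_keys.1 (hS hv))] at huv
  rw [Finset.sum_congr rfl fun t _ => h1 t]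
  simp
  omega

/-! ### Correctness of the output -/

theorem conv_add {B m : ℕ} {p : ℤ × ℕ} (h : p.2 ≤ B) : conv (B + m) p = 2 ^ m * conv B p := by
  rw [conv, conv, Nat.sub_add_comm h, pow_add]
  ring

theorem abs_conv_le {B : ℕ} {p : ℤ × ℕ} (h : |p.1| < 2 ^ B) : |conv B p| ≤ 2 ^ (2 * B) := by
  rw [conv, abs_mul, abs_of_pos (by positivity : (0 : ℤ) < 2 ^ (B - p.2)), two_mul, pow_add]
  exact mul_le_mul h.le (pow_le_pow_right₀ (by norm_num) (Nat.sub_le _ _)) (by positivity)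
    (by positivity)

section

variable {n k r β N : ℕ} {mats : List (List (List Bool))} {ans : List Bool → ℤ × ℕ}

theorem norm1_signalOf_conv_le (hr : r ≤ n) (hans : ∀ q, |(ans q).1| < 2 ^ β) :
    norm1 (keys n) (signalOf n r fun q => conv β (ans q)) ≤ 2 ^ (3 * n + 2 * β) := by
  refine (norm1_signalOf_le fun q _ => abs_conv_le (hans q)).trans ?_
  calc (2 : ℤ) ^ n * (2 ^ r * (2 ^ n * 2 ^ (2 * β))) = 2 ^ (n + (r + (n + 2 * β))) := by
        simp only [pow_add]
    _ ≤ 2 ^ (3 * n + 2 * β) := pow_le_pow_right₀ (by norm_num) (by omega)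

/-- Error bound for the scaled signal. Its norm is at most `2 ^ (3 * n + 2 * β)`, which gives the
number of rounds, and there are at most `2 ^ n` matrices; the remaining `n + 8` bits of the word
length pay for sums over the matrices, for the constant `60` and for the sign. -/
theorem norm1_recover_le (hr : r ≤ n) (hk : k ≤ N) (hN : 2 ^ r ≤ N) (hne : mats ≠ [])
    (hlen : mats.length ≤ 2 ^ n) (hmats : ∀ m ∈ mats, IsMat n r m)
    (hans : ∀ q, |(ans q).1| < 2 ^ β ∧ (ans q).2 ≤ β)
    (hE : ∀ A, IsExpander (keys n) (2 * k) fun t : Fin (mats.map (measOf n r A)).length =>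
      hashOf r (mats.map (measOf n r A))[t]) {S : Finset (List Bool)} (hS : S.card ≤ k) :
    norm1 (keys n) (fun i => signalOf n r (fun q => conv β (ans q)) i -
      evalAt (recover (4 * n + 2 * β + 7 + 1) k n r
        (mats.map (measOf n r fun q => conv (β + n) (ans q))) (3 * n + 2 * β + 1)) i 0) ≤
      24 * norm1 (keys n) fun i =>
        if i ∈ S then 0 else signalOf n r (fun q => conv β (ans q)) i := by
  have hA : (fun q => conv (β + n) (ans q)) = fun q => 2 ^ n * conv β (ans q) := by
    funext q
    exact conv_add (hans q).2
  have hX := norm1_signalOf_conv_le hr fun q => (hans q).1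
  rw [hA]
  refine recover_norm1_le (N := N) (by simpa using hne) hk (fun m hm => ?_) (fun m hm => ?_)
    (hE _) ?_ ?_ hS
  · obtain ⟨m', hm', rfl⟩ := List.mem_map.1 hm
    exact measOf_isMeas _ (hmats m' hm') hN
  · obtain ⟨m', hm', rfl⟩ := List.mem_map.1 hm
    exact measures_measOf _ (hmats m' hm')
  · rw [List.length_map]
    have h1 : ((mats.length : ℤ) + 1) ≤ 2 * 2 ^ n := by
      have : (mats.length : ℤ) ≤ 2 ^ n := by exact_mod_cast hlen
      have : (1 : ℤ) ≤ 2 ^ n := one_le_pow₀ (by norm_num)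
      linarith
    have h0 : (0 : ℤ) < 2 ^ n * 2 ^ (3 * n + 2 * β) := by positivity
    calc ((mats.length : ℤ) + 1) * (60 * norm1 (keys n) (signalOf n r fun q => conv β (ans q)))
        ≤ (2 * 2 ^ n) * (60 * 2 ^ (3 * n + 2 * β)) := by
          refine mul_le_mul h1 (by linarith) ?_ (by positivity)
          have := norm1_nonneg (keys n) (signalOf n r fun q => conv β (ans q))
          positivity
      _ < 2 ^ 7 * (2 ^ n * 2 ^ (3 * n + 2 * β)) := by linarith
      _ = 2 ^ (4 * n + 2 * β + 7) := by
          rw [← pow_add, ← pow_add]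
          congr 1
          ring
  · refine hX.trans_lt ?_
    exact pow_lt_pow_right₀ (by norm_num) (by omega)

/-- The entries of the output do not overflow. -/
theorem abs_outputOf_lt (hr : r ≤ n) (hk : k ≤ N) (hN : 2 ^ r ≤ N) (hne : mats ≠ [])
    (hlen : mats.length ≤ 2 ^ n) (hmats : ∀ m ∈ mats, IsMat n r m)
    (hans : ∀ q, |(ans q).1| < 2 ^ β ∧ (ans q).2 ≤ β)
    (hE : ∀ A, IsExpander (keys n) (2 * k) fun t : Fin (mats.map (measOf n r A)).length =>
      hashOf r (mats.map (measOf n r A))[t]) {e : ℕ} {l : List Item}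
    (hl : l = recover (4 * n + 2 * β + 7 + 1) k n r
        (mats.map (measOf n r fun q => conv (β + n) (ans q))) (3 * n + 2 * β + 1))
    (hd : HasDims n 1 l) {p : List Bool × ℤ × ℕ}
    (hp : p ∈ (aggregate n l).map fun p => (p.1, p.2.getD 0 0, e)) :
    |p.2.1| < 2 ^ (4 * n + 2 * β + 7) := by
  obtain ⟨q, hq, rfl⟩ := List.mem_map.1 hp
  have hqk : q.1 ∈ keys n := mem_keys.2 (aggregate_hasDims hd q hq).1
  have h1 := norm1_recover_le hr hk hN hne hlen hmats hans hE (S := ∅) (by simp)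
  rw [← hl] at h1
  have hX := norm1_signalOf_conv_le hr fun q => (hans q).1
  set X := signalOf n r fun q => conv β (ans q)
  have h2 : |X q.1| ≤ norm1 (keys n) X :=
    Finset.single_le_sum (f := fun i => |X i|) (fun _ _ => abs_nonneg _) hqk
  have h3 : |X q.1 - evalAt l q.1 0| ≤ norm1 (keys n) fun i => X i - evalAt l i 0 :=
    Finset.single_le_sum (f := fun i => |X i - evalAt l i 0|) (fun _ _ => abs_nonneg _) hqk
  have h4 : norm1 (keys n) (fun i => if i ∈ (∅ : Finset (List Bool)) then 0 else X i) =
      norm1 (keys n) X := by simp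
  have h5 : |evalAt l q.1 0| ≤ |X q.1| + |X q.1 - evalAt l q.1 0| := by
    have := abs_sub (X q.1) (X q.1 - evalAt l q.1 0)
    rwa [sub_sub_cancel] at this
  rw [h4] at h1
  rw [← evalAt_of_mem (aggregate_nodup hd) hq, evalAt_aggregate hd]
  have h6 : (2 : ℤ) ^ (3 * n + 2 * β) ≤ 2 ^ (4 * n + 2 * β) :=
    pow_le_pow_right₀ (by norm_num) (by omega)
  have h7 : (0 : ℤ) < 2 ^ (4 * n + 2 * β) := by positivity
  rw [pow_add]
  linarith

/-- The scaled signal is the signal up to a power of `√2`. -/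
theorem signalOf_eq {b : ℕ} {x : F2 n → ℝ} {ans : F2 n → ℤ × ℕ} (hx : HasBits b (dht x) ans)
    (j : F2 n) : (signalOf n r (fun q => conv b (ans (vec n q))) (bits j) : ℝ) =
      Real.sqrt 2 ^ (r + (r + (2 * b + n))) * x j := by
  have h1 : ∀ q, (conv b (ans (vec n q)) : ℝ) = 2 ^ b * dht x (vec n q) := by
    intro q
    obtain ⟨h2, _, h3⟩ := hx (vec n q)
    rw [h2, conv]
    push_cast
    rw [pow_sub₀ _ (two_ne_zero) h3]
    ring
  have h2 : Real.sqrt 2 ^ (r + (r + (2 * b + n))) = 2 ^ r * 2 ^ b * Real.sqrt (2 ^ n) := by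
    have hs : Real.sqrt 2 ^ 2 = 2 := Real.sq_sqrt (by norm_num)
    rw [show r + (r + (2 * b + n)) = 2 * r + 2 * b + n by ring, pow_add, pow_add, pow_mul, pow_mul,
      hs, Real.sqrt_eq_rpow, Real.sqrt_eq_rpow, ← Real.rpow_natCast (2 ^ (1 / 2 : ℝ)) n,
      ← Real.rpow_mul (by norm_num), ← Real.rpow_natCast 2 n, ← Real.rpow_mul (by norm_num),
      mul_comm (1 / 2 : ℝ)]
  rw [h2, signalOf, mul_assoc, ← sum_sg_mul_dht x j]
  push_cast
  rw [mul_assoc, Finset.mul_sum, Finset.mul_sum, Finset.mul_sum]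
  refine Finset.sum_congr rfl fun q _ => ?_
  rw [h1]
  ring

theorem outputVector_eq {l : List Item} (hd : HasDims n 1 l) (e : ℕ) (j : F2 n) :
    outputVector (l.map fun p => (vec n p.1, p.2.getD 0 0, e)) j =
      (evalAt l (bits j) 0 : ℝ) / Real.sqrt 2 ^ e := by
  rw [outputVector]
  induction l with
  | nil => simp
  | cons p l ih =>
    have hp := hd p (by simp)
    simp only [List.map_cons, List.sum_cons, evalAt_cons, ih fun q hq => hd q (by simp [hq])]
    have h : vec n p.1 = j ↔ p.1 = bits j := by
      constructor
      · rintro rfl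
        exact (bits_vec hp.1).symm
      · intro h
        rw [h, vec_bits]
    simp only [h]
    push_cast
    split_ifs <;> ring

/-- Translation of an error bound for the scaled signal. -/
theorem l1norm_outputVector_le {b : ℕ} {x y : F2 n → ℝ} {ans : F2 n → ℤ × ℕ}
    (hx : HasBits b (dht x) ans) (hy : IsHk k x y) {l : List Item} (hd : HasDims n 1 l)
    (hl : ∀ S : Finset (List Bool), S.card ≤ k →
      norm1 (keys n) (fun i => signalOf n r (fun q => conv b (ans (vec n q))) i - evalAt l i 0) ≤
        24 * norm1 (keys n) fun i =>
          if i ∈ S then 0 else signalOf n r (fun q => conv b (ans (vec n q))) i) :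
    l1norm (outputVector (l.map fun p =>
      (vec n p.1, p.2.getD 0 0, r + (r + (2 * b + n)))) - x) ≤ 24 * l1norm (x - y) := by
  obtain ⟨S, hS, _, rfl⟩ := hy
  have hsc := signalOf_eq (r := r) hx
  set X := signalOf n r (fun q => conv b (ans (vec n q)))
  set t := Real.sqrt 2 ^ (r + (r + (2 * b + n))) with ht
  have ht0 : 0 < t := by positivity
  have h1 := hl (S.image bits) (by rw [Finset.card_image_of_injective _ bits_injective, hS])
  have h2 : l1norm (outputVector (l.map fun p =>
      (vec n p.1, p.2.getD 0 0, r + (r + (2 * b + n)))) - x) =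
      (norm1 (keys n) (fun i => X i - evalAt l i 0) : ℝ) / t := by
    rw [l1norm, norm1, ← sum_bits, Int.cast_sum, Finset.sum_div]
    refine Finset.sum_congr rfl fun j _ => ?_
    rw [Pi.sub_apply, outputVector_eq hd, ← ht, Int.cast_abs, Int.cast_sub, hsc, abs_sub_comm]
    rw [show x j - (evalAt l (bits j) 0 : ℝ) / t = (t * x j - evalAt l (bits j) 0) / t by
      field_simp, abs_div, abs_of_pos ht0]
  have h3 : l1norm (x - fun i => if i ∈ S then x i else 0) =
      (norm1 (keys n) (fun i => if i ∈ S.image bits then 0 else X i) : ℝ) / t := by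
    rw [l1norm, norm1, ← sum_bits, Int.cast_sum, Finset.sum_div]
    refine Finset.sum_congr rfl fun j _ => ?_
    have hj : bits j ∈ S.image bits ↔ j ∈ S := by
      rw [Finset.mem_image]
      exact ⟨fun ⟨i, hi, hij⟩ => bits_injective hij ▸ hi, fun h => ⟨j, h, rfl⟩⟩
    simp only [Pi.sub_apply, hj]
    split_ifs
    · simp
    · rw [sub_zero, Int.cast_abs, hsc, abs_mul, abs_of_pos ht0]
      field_simp
  rw [h2, h3, ← mul_div_assoc]
  refine div_le_div_of_nonneg_right ?_ ht0.le
  exact_mod_cast h1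

end

/-! ### Sizes -/

theorem size_encList_le {α : Type} {f : α → Data} {B : ℕ} {l : List α}
    (h : ∀ a ∈ l, (f a).size ≤ B) : (encList f l).size ≤ l.length * (B + 1) + 1 := by
  induction l with
  | nil => simp [encList, Data.size]
  | cons a l ih =>
    have h1 := h a (by simp)
    have h2 := ih fun b hb => h b (by simp [hb])
    simp only [encList, Data.size, List.length_cons, add_mul, one_mul]
    omega

theorem size_encBits_le (l : List Bool) : (encBits l).size ≤ l.length * 4 + 1 :=
  size_encList_le fun a _ => by cases a <;> simp [encBool, Data.size]

theorem size_encOut_le {M : ℕ} {p : List Bool × ℤ × ℕ} (h1 : p.1.length ≤ M)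
    (h2 : |p.2.1| < 2 ^ M) (h3 : p.2.2 ≤ M) : (encOut p).size ≤ 12 * M + 20 := by
  have i1 := size_encBits_le p.1
  have i2 := size_encBits_le p.2.1.natAbs.bits
  have i3 := size_encBits_le p.2.2.bits
  have j2 : p.2.1.natAbs.bits.length ≤ M := by
    refine length_bits_le_of_lt ?_
    rw [Int.abs_eq_natAbs] at h2
    exact_mod_cast h2
  have j3 : p.2.2.bits.length ≤ M := (length_bits_le_of_lt Nat.lt_two_pow_self).trans h3
  have i4 : (encBool (decide (p.2.1 < 0))).size ≤ 3 := by
    cases decide (p.2.1 < 0) <;> simp [encBool, Data.size]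
  simp only [encOut, encInt, encNat, encBits, Data.size] at i1 i2 i3 ⊢
  omega

/-! ### The algorithm and its running time -/

theorem isMat_units (n : ℕ) : IsMat n n (units n) :=
  ⟨length_units n, fun _ hc => length_of_mem_units hc⟩

theorem isMat_of_mem_matricesOf {n r D : ℕ} [NeZero D] {h : F2 n × Fin D → F2 r}
    {m : List (List Bool)} (hm : m ∈ matricesOf n D (hashBits h)) : IsMat n r m := by
  obtain ⟨t, _, rfl⟩ := List.mem_map.1 hm
  refine ⟨by simp [length_units], fun c hc => ?_⟩
  obtain ⟨u, _, rfl⟩ := List.mem_map.1 hc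
  simp [hashBits]

/-- The matrices used by the algorithm: there are at most `d` of them, they have `s` rows, and
`N` bounds the number of buckets. -/
theorem exists_matrices (P : Prog) : ∃ c, IsLin c ∧ ∀ (n k r D M T : ℕ) [NeZero D]
    (h : F2 n × Fin D → F2 r), 0 < k → k ≤ 2 ^ n → r ≤ n →
    IsLosslessCondenser (Real.logb 2 (4 * (k : ℝ))) (1 / 32) h → LinearInFirst h →
    ComputesWithin P k h T → T ≤ M → n + 1 ≤ M →
    ∃ (s d N : ℕ) (mats : List (List (List Bool))), s ≤ n ∧ 1 ≤ d ∧ 1 ≤ N ∧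
      d ^ 2 * N ≤ 2 * (2 ^ r * D ^ 2) ∧ k ≤ N ∧ 2 ^ s ≤ N ∧ mats ≠ [] ∧ mats.length ≤ d ∧
      mats.length ≤ 2 ^ n ∧ (∀ m ∈ mats, IsMat n s m) ∧
      (∀ A, IsExpander (keys n) (2 * k) fun t : Fin (mats.map (measOf n s A)).length =>
        hashOf s (mats.map (measOf n s A))[t]) ∧
      Does (prepP P) (encParams n k r D) (encPrep n s k mats) (d * c M N) := by
  obtain ⟨c, hc, hprep⟩ := prepP_spec P
  refine ⟨c, hc, fun n k r D M T _ h hk hkn hr hcond hlin hP hTM hnM => ?_⟩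
  have hD : 1 ≤ D := NeZero.one_le
  have hkr := hcond.le_two_pow hk hkn
  have hkb : k.bits.length ≤ M :=
    (length_bits_le_of_lt (lt_of_le_of_lt hkn (Nat.pow_lt_pow_succ (by norm_num)))).trans hnM
  have hD2 : D ≤ D ^ 2 := Nat.le_self_pow (by norm_num) D
  have hr1 : 1 ≤ 2 ^ r := Nat.one_le_two_pow
  -- If `D` has more than `n` bits, then `2 ^ n ≤ D`, and the identity matrix alone fits into the
  -- time bound; otherwise the matrices of `h` are computed by `P`.
  rcases Nat.lt_or_ge n D.bits.length with hn | hn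
  · obtain ⟨-, hdo⟩ := hprep M (2 ^ n) Nat.one_le_two_pow n k r D (hashBits h) hnM hr hD hkn hkb
    refine ⟨n, 1, 2 ^ n, [units n], le_rfl, le_rfl, Nat.one_le_two_pow, ?_, hkn, le_rfl, by simp,
      by simp, Nat.one_le_two_pow, fun m hm => ?_, isExpander_units n _, ?_⟩
    · rw [Nat.size_eq_bits_len, Nat.lt_size] at hn
      have := Nat.mul_le_mul hr1 hD2
      omega
    · rw [List.mem_singleton.1 hm]
      exact isMat_units n
    · rw [one_mul]
      exact hdo hn
  · obtain ⟨hdo, -⟩ := hprep M (2 * 2 ^ r) (by omega) n k r D (hashBits h) hnM hr hD hkr hkb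
    have hlen : (matricesOf n D (hashBits h)).length = D := by simp [matricesOf]
    refine ⟨r, D, 2 * 2 ^ r, matricesOf n D (hashBits h), hr, hD, by omega, le_of_eq (by ring),
      hkr, by omega, fun h0 => ?_, hlen.le, ?_, fun m hm => isMat_of_mem_matricesOf hm,
      fun A => isExpander_matrices hlin (hcond.isExpander hk), hdo hn fun u t hu ht => ?_⟩
    · rw [h0] at hlen
      simp at hlen
      omega
    · rw [hlen]
      rw [ge_iff_le, Nat.size_eq_bits_len, Nat.size_le] at hn
      exact hn.le
    · obtain ⟨s, hs, hrun⟩ := hP (vec n u) ⟨t, ht⟩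
      refine ⟨s, hs.trans hTM, ?_⟩
      have h1 : encVec (vec n u) = encBits u := by
        rw [← bits_vec hu, vec_bits]
        rfl
      have h2 : Fin.ofNat D t = ⟨t, ht⟩ := Fin.ext (Nat.mod_eq_of_lt ht)
      rw [h1] at hrun
      rw [hashBits, h2]
      exact hrun

/-- The second phase of the algorithm. -/
def mainP (P pB pW ps pe : Prog) : Prog := letP .head (prepP P) (finishP pB pW ps pe)

theorem encList_encOut {n e : ℕ} {l : List Item} (hd : HasDims n 1 l) :
    encList encEntry (l.map fun p => (vec n p.1, p.2.getD 0 0, e)) =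
      encList encOut (l.map fun p => (p.1, p.2.getD 0 0, e)) := by
  induction l with
  | nil => rfl
  | cons p l ih =>
    have h : encVec (vec n p.1) = encBits p.1 := by
      rw [← bits_vec (hd p (by simp)).1, vec_bits]
      rfl
    simp only [List.map_cons, encList, ih fun q hq => hd q (by simp [hq]), encEntry, encOut, h]

end SparseHadamard

theorem mainTheorem2 :
    ∃ c ε : ℝ, 0 < c ∧ 0 < ε ∧
      ∀ (P : Prog) (a b : Polynomial ℕ), ∃ (Q R : Prog) (q : Polynomial ℕ),
        ∀ (n k r D : ℕ) [NeZero D] (h : F2 n × Fin D → F2 r),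
          0 < n → 0 < k → k ≤ 2 ^ n → r ≤ n →
          IsLosslessCondenser (Real.logb 2 (4 * (k : ℝ))) ε h →
          LinearInFirst h →
          ComputesWithin P k h (a.eval n) →
          ∀ (x : F2 n → ℝ) (ans : F2 n → ℤ × ℕ), HasBits (b.eval n) (dht x) ans →
            ∃ L : List (F2 n × ℤ × ℕ),
              OutputsWithin Q R (encParams n k r D) ans L (2 ^ r * D ^ 2 * q.eval n) ∧
              ∀ y : F2 n → ℝ, IsHk k x y →
                l1norm (outputVector L - x) ≤ c * l1norm (x - y) := by
  refine ⟨24, 1 / 32, by norm_num, by norm_num, fun P a b => ?_⟩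
  obtain ⟨pB, cB, ⟨qB, hqB⟩, hpB⟩ := exists_unPolyP (b + Polynomial.X)
  obtain ⟨pW, cW, ⟨qW, hqW⟩, hpW⟩ := exists_unPolyP
    (Polynomial.C 4 * Polynomial.X + Polynomial.C 2 * b + Polynomial.C 8)
  obtain ⟨ps, cs, ⟨qs, hqs⟩, hps⟩ := exists_unPolyP
    (Polynomial.C 3 * Polynomial.X + Polynomial.C 2 * b + Polynomial.C 1)
  obtain ⟨pe, ce, ⟨qe, hqe⟩, hpe⟩ := exists_unPolyP (Polynomial.C 2 * b + Polynomial.X)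
  obtain ⟨c₁, ⟨f₁, hf₁, hc₁⟩, h₁⟩ := exists_matrices P
  obtain ⟨c₂, ⟨f₂, hf₂, hc₂⟩, h₂⟩ := queriesP_spec
  obtain ⟨c₃, ⟨f₃, hf₃, hc₃⟩, h₃⟩ := finishP_spec (pB := pB) (pW := pW) (ps := ps) (pe := pe)
    IsPoly.id
  -- All polynomial bounds are expressed in terms of the single quantity `M = μ n`.
  set μ : Polynomial ℕ := a + qB + qW + qs + qe + Polynomial.C 4 * b +
    Polynomial.C 6 * Polynomial.X + Polynomial.C 20 with hμ
  obtain ⟨g, hg⟩ : IsPoly fun M => 2 * f₁ M + f₂ M + f₃ M + 30 * (M * M) + 100 * M + 100 := by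
    fun_prop
  refine ⟨prepP P ▷ queriesP, mainP P pB pW ps pe, Polynomial.C 2 * g.comp μ,
    fun n k r D _ h hn hk hkn hr hcond hlin hP x ans hx => ?_⟩
  set M := μ.eval n with hM
  set β := b.eval n with hβ
  have hMe : M = a.eval n + qB.eval n + qW.eval n + qs.eval n + qe.eval n + 4 * β + 6 * n + 20 := by
    simp [hM, hμ, hβ]
  have eB : (b + Polynomial.X).eval n = β + n := by simp [hβ]
  have eW : (Polynomial.C 4 * Polynomial.X + Polynomial.C 2 * b + Polynomial.C 8).eval n =
    4 * n + 2 * β + 7 + 1 := by simp [hβ]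
  have es : (Polynomial.C 3 * Polynomial.X + Polynomial.C 2 * b + Polynomial.C 1).eval n =
    3 * n + 2 * β + 1 := by simp [hβ]
  have ee : (Polynomial.C 2 * b + Polynomial.X).eval n = 2 * β + n := by simp [hβ]
  have dB := (hpB n).mono ((hqB n).trans (by omega : _ ≤ M))
  have dW := (hpW n).mono ((hqW n).trans (by omega : _ ≤ M))
  have ds := (hps n).mono ((hqs n).trans (by omega : _ ≤ M))
  have de := (hpe n).mono ((hqe n).trans (by omega : _ ≤ M))
  rw [eB] at dB
  rw [eW] at dW
  rw [es] at ds
  rw [ee] at de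
  obtain ⟨s, d, N, mats, hs, hd, hN, hdN, hkN, hsN, hne, hlen, hlen', hmats, hE, hprep⟩ :=
    h₁ n k r D M (a.eval n) h hk hkn hr hcond hlin hP (by omega) (by omega)
  have hans : ∀ q : List Bool, |(ans (vec n q)).1| < 2 ^ β ∧ (ans (vec n q)).2 ≤ β :=
    fun q => (hx (vec n q)).2
  set l := recover (4 * n + 2 * β + 7 + 1) k n s
    (mats.map (measOf n s fun q => conv (β + n) (ans (vec n q)))) (3 * n + 2 * β + 1) with hl
  have hmeas : ∀ m ∈ mats.map (measOf n s fun q => conv (β + n) (ans (vec n q))),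
      IsMeas n s N m := by
    intro m hm
    obtain ⟨m', hm', rfl⟩ := List.mem_map.1 hm
    exact measOf_isMeas _ (hmats m' hm') hsN
  have hsig : IsSig n N l := recover_isSig hkN hmeas
  have hdl := aggregate_hasDims hsig.1
  have hbound := fun p hp => abs_outputOf_lt (e := s + (s + (2 * β + n))) (p := p) hs hkN hsN hne
    hlen' hmats hans hE hl hsig.1 hp
  have hQ := h₂ M N hN n s k d mats (by omega) (by omega) hsN hd hlen hmats
  have hR := h₃ M N hN (4 * n + 2 * β + 7) (β + n) (3 * n + 2 * β + 1) (2 * β + n) n s k d mats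
    (fun q => ans (vec n q)) (encParams n k r D) (by omega) (by omega) (by omega) (by omega)
    (by omega) (by omega) hsN hkN hd hlen hmats
    (fun q _ => ⟨(hans q).1.trans_le (pow_le_pow_right₀ (by norm_num) (by omega)),
      (hans q).2.trans (by omega)⟩) dB dW ds de hbound
  have hallQ : ∀ v ∈ allQueries n s mats, v.length = n := by
    intro v hv
    obtain ⟨m, hm, hv⟩ := List.mem_flatMap.1 hv
    obtain ⟨w, hw, hv⟩ := List.mem_flatMap.1 hv
    obtain ⟨e, he, rfl⟩ := List.mem_map.1 hv
    simp [vxor, length_rowOf, (hmats m hm).1, length_of_mem_offsets he]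
  have hqs : encList encVec ((allQueries n s mats).map (vec n)) =
      encCols (allQueries n s mats) := by
    generalize allQueries n s mats = l at hallQ
    induction l with
    | nil => rfl
    | cons v l ih =>
      rw [List.map_cons, encList, ih fun u hu => hallQ u (by simp [hu]), encVec,
        ← bits, bits_vec (hallQ v (by simp))]
      rfl
  obtain ⟨t₁, ht₁, hrun₁⟩ := Does.comp hprep hQ
  obtain ⟨t₂, ht₂, hrun₂⟩ := Does.letP (a := .head) (rest := finishP pB pW ps pe)
    (x := .cons (encParams n k r D)
      (encList encAnswer ((allQueries n s mats).map fun q => ans (vec n q)))) rfl hprep hR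
  refine ⟨(aggregate n l).map fun p => (vec n p.1, p.2.getD 0 0, s + (s + (2 * β + n))),
    ⟨(allQueries n s mats).map (vec n), t₁, t₂, ?_, ?_, ?_⟩, fun y hy => ?_⟩
  · rw [hqs]
    exact hrun₁
  · rw [encList_encOut hdl, List.map_map]
    exact hrun₂
  · rw [hqs, encList_encOut hdl]
    -- The sizes of the queries and of the output count as well.
    have z1 : (encCols (allQueries n s mats)).size ≤ d * (N * M) * (4 * M + 2) + 1 := by
      refine (size_encList_le (B := 4 * M + 1) fun v hv => (size_encBits_le v).trans ?_).trans ?_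
      · rw [hallQ v hv]
        omega
      · rw [length_allQueries]
        gcongr
        omega
    have z2 : (encList encOut ((aggregate n l).map fun p =>
        (p.1, p.2.getD 0 0, s + (s + (2 * β + n))))).size ≤ N * (12 * M + 21) + 1 := by
      refine (size_encList_le (B := 12 * M + 20) fun p hp => ?_).trans ?_
      · obtain ⟨q, hq, rfl⟩ := List.mem_map.1 hp
        refine size_encOut_le ?_ ((hbound _ hp).trans_le
          (pow_le_pow_right₀ (by norm_num) (by omega))) (by dsimp only; omega)
        rw [(hdl q hq).1]
        omega
      · rw [List.length_map]
        gcongr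
        exact (length_aggregate_le hsig.1).trans hsig.2
    -- Every cost is at most `d ^ 2 * N` times a polynomial in `M`.
    have y1 : d * c₁ M N ≤ d ^ 2 * N * f₁ M := by
      rw [mul_assoc]
      exact Nat.mul_le_mul (Nat.le_self_pow (by norm_num) d) (hc₁ M N hN)
    have y2 : d * c₂ M N ≤ d ^ 2 * N * f₂ M := by
      rw [mul_assoc]
      exact Nat.mul_le_mul (Nat.le_self_pow (by norm_num) d) (hc₂ M N hN)
    have y3 : d ^ 2 * c₃ M N ≤ d ^ 2 * N * f₃ M := by
      rw [mul_assoc]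
      exact Nat.mul_le_mul le_rfl (hc₃ M N hN)
    have y4 : d * (N * M) * (4 * M + 2) ≤ d ^ 2 * N * (M * (4 * M + 2)) := by
      rw [show d * (N * M) * (4 * M + 2) = d * N * (M * (4 * M + 2)) by ring]
      gcongr
      exact Nat.le_self_pow (by norm_num) d
    have y5 : N ≤ d ^ 2 * N := Nat.le_mul_of_pos_left _ (by positivity)
    have y6 : N * (12 * M + 21) ≤ d ^ 2 * N * (12 * M + 21) := Nat.mul_le_mul_right _ y5
    have y7 : d ^ 2 * N * (2 * f₁ M + f₂ M + f₃ M + 30 * (M * M) + 100 * M + 100) ≤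
        2 * (2 ^ r * D ^ 2) * g.eval M := Nat.mul_le_mul hdN (hg M)
    have y8 : 2 ^ r * D ^ 2 * (Polynomial.C 2 * g.comp μ).eval n =
        2 * (2 ^ r * D ^ 2) * g.eval M := by
      simp [hM]
      ring
    rw [y8]
    simp only [Prog.sz] at ht₂
    set K := d ^ 2 * N with hK
    have y9 : K * (2 * f₁ M + f₂ M + f₃ M + 30 * (M * M) + 100 * M + 100) =
      2 * (K * f₁ M) + K * f₂ M + K * f₃ M + K * (M * (4 * M + 2)) + K * (12 * M + 21) +
        (26 * (K * (M * M)) + 86 * (K * M) + 79 * K) := by ring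
    omega
  · exact l1norm_outputVector_le hx hy hdl fun S hS => by
      simp only [evalAt_aggregate hsig.1]
      exact norm1_recover_le hs hkN hsN hne hlen' hmats hans hE hS
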